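/- Let $R\in\mathbb{C}(y)$ be a rational function, and suppose that the Riccati equation $$\frac{du}{dy}+u^2+\frac12 R(y)=0$$ has no solution $u$ in the algebraic closure $\mathbb{C}(y)^{\mathrm{alg}}$, where $\frac{d}{dy}$ is the unique extension of the usual derivation of $\mathbb{C}(y)$. Regard $\mathbb{C}$ as a differential field with the zero derivation, and consider the Schwarzian equation $$(\star')\qquad S(y)+(y')^2R(y)=0,\qquad S(y)=\left(\frac{y''}{y'}\right)'-\frac12\left(\frac{y''}{y'}\right)^2,$$ where a solution is required to satisfy $y'\neq 0$ and not to be a zero of the denominator of $R$. (a) Let $K$ be any differential field extension of $\mathbb{C}$, and let $y$ be a solution of $(\star')$ in any differential field extension of $K$. Let $K\langle y\rangle=K(y,y',y'',\dots)$ be the differential field generated by $y$ over $K$. Then $$\operatorname{tr.deg}_K K\langle y\rangle = 0 \text{ or } 3 .$$ (b) The equation $(\star')$ is strongly minimal: in every differentially closed field $U$ extending $\mathbb{C}$, the set of solutions of $(\star')$ in $U$ is an infinite definable set, and each of its definable subsets is finite or cofinite in it. Here definable means definable by a first-order formula in the language of differential rings with parameters from $U$. -/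

import Mathlib

open scoped Differential Polynomial TensorProduct

/-! ### Algebraic functions of one variable `y` and the derivation `d/dy` -/

/-- The algebraic closure `ℂ(y)^alg` of the field of rational functions in one variable. -/
abbrev AlgFun : Type := AlgebraicClosure (RatFunc ℂ)

/-- The coordinate `y`, as an element of `ℂ(y)^alg`. -/
noncomputable def AlgFun.y : AlgFun := algebraMap (RatFunc ℂ) AlgFun RatFunc.X

/-- There is exactly one `ℂ`-linear derivation of `ℂ(y)^alg` that sends `y` to `1`. -/
theorem AlgFun.existsUnique_derivation :
    ∃! D : Derivation ℂ AlgFun AlgFun, D AlgFun.y = 1 := by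
  have h1 : Algebra.FormallyEtale ℂ[X] (RatFunc ℂ) :=
    Algebra.FormallyEtale.of_isLocalization (nonZeroDivisors ℂ[X])
  have h2 : Algebra.FormallyEtale (RatFunc ℂ) AlgFun := Algebra.FormallyEtale.of_isSeparable _ _
  have h3 : Algebra.FormallyEtale ℂ[X] AlgFun :=
    Algebra.FormallyEtale.comp ℂ[X] (RatFunc ℂ) AlgFun
  have hX : algebraMap ℂ[X] AlgFun Polynomial.X = AlgFun.y := by
    rw [IsScalarTower.algebraMap_apply ℂ[X] (RatFunc ℂ) AlgFun, RatFunc.algebraMap_X]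
    rfl
  let e := KaehlerDifferential.tensorKaehlerEquivOfFormallyEtale ℂ ℂ[X] AlgFun
  have he : ∀ p : ℂ[X], e.symm (KaehlerDifferential.D ℂ AlgFun (algebraMap ℂ[X] AlgFun p)) =
      1 ⊗ₜ KaehlerDifferential.D ℂ ℂ[X] p :=
    KaehlerDifferential.tensorKaehlerEquivOfFormallyEtale_symm_D_algebraMap ℂ ℂ[X] AlgFun
  have key : ∀ D₁ D₂ : Derivation ℂ AlgFun AlgFun, D₁ AlgFun.y = D₂ AlgFun.y → D₁ = D₂ := by
    intro D₁ D₂ h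
    have hpoly : ∀ p : ℂ[X], D₁ (algebraMap ℂ[X] AlgFun p) = D₂ (algebraMap ℂ[X] AlgFun p) := by
      intro p
      have : D₁.compAlgebraMap ℂ[X] = D₂.compAlgebraMap ℂ[X] := by
        apply Polynomial.derivation_ext
        simpa [hX] using h
      exact congrArg (fun d => d p) this
    have hlin : D₁.liftKaehlerDifferential ∘ₗ e.toLinearMap =
        D₂.liftKaehlerDifferential ∘ₗ e.toLinearMap := by
      apply TensorProduct.AlgebraTensorModule.curry_injective
      apply LinearMap.ext_ring
      apply Derivation.liftKaehlerDifferential_unique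
      ext
      simp [← he, hpoly]
    ext x
    have := LinearMap.congr_fun hlin (e.symm (KaehlerDifferential.D ℂ AlgFun x))
    simpa using this
  refine ⟨((LinearMap.liftBaseChange AlgFun
    (Polynomial.mkDerivation ℂ (1 : AlgFun)).liftKaehlerDifferential).comp
      e.symm.toLinearMap).compDer (KaehlerDifferential.D ℂ AlgFun), ?_, ?_⟩
  · have := he Polynomial.X
    rw [hX] at this
    simp [this]
  · intro D hD
    apply key
    rw [hD]
    have := he Polynomial.X
    rw [hX] at this
    simp [this]

/-- The derivation `d/dy` on `ℂ(y)^alg`. -/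
noncomputable def AlgFun.ddy : Derivation ℂ AlgFun AlgFun :=
  AlgFun.existsUnique_derivation.choose

theorem AlgFun.ddy_y : AlgFun.ddy AlgFun.y = 1 :=
  AlgFun.existsUnique_derivation.choose_spec.1

/-- `u ∈ ℂ(y)^alg` solves the Riccati equation `du/dy + u² + (1/2) R(y) = 0`. -/
def IsAlgebraicRiccatiSolution (R : RatFunc ℂ) (u : AlgFun) : Prop :=
  AlgFun.ddy u + u ^ 2 + 1 / 2 * algebraMap (RatFunc ℂ) AlgFun R = 0

/-! ### Differential fields

A differential field is a field with Mathlib's `Differential` structure, and a differential field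
extension is an algebra satisfying `DifferentialAlgebra`. -/

/-- `ℂ` is regarded as a differential field with the zero derivation, so that a differential field
extension of `ℂ` is one in which all complex numbers are constants. -/
instance Complex.instDifferentialZero : Differential ℂ := ⟨0⟩

/-- The `n`-th derivative `y⁽ⁿ⁾`. -/
def iterDer {F : Type*} [Field F] [Differential F] (n : ℕ) (y : F) : F :=
  (fun z : F => z′)^[n] y

/-- `K⟨y⟩`, the differential field generated by `y` over `K`. -/
def diffAdjoin (K : Type*) {F : Type*} [Field K] [Field F] [Differential F] [Algebra K F]
    (y : F) : IntermediateField K F :=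
  IntermediateField.adjoin K (Set.range fun n : ℕ => iterDer n y)

/-- The Schwarzian derivative `S(y) = (y''/y')' - (1/2) (y''/y')²` (meaningful for `y' ≠ 0`). -/
def schwarzian {F : Type*} [Field F] [Differential F] (y : F) : F :=
  (y′′ / y′)′ - 1 / 2 * (y′′ / y′) ^ 2

/-- `y` is a solution of the Schwarzian equation `S(y) + (y')² R(y) = 0`. As `S(y)` and `R(y)` have
to be defined, this includes `y' ≠ 0` and that the denominator of `R` does not vanish at `y`. -/
structure IsSchwarzianSolution {F : Type*} [Field F] [Differential F] [Algebra ℂ F]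
    (R : RatFunc ℂ) (y : F) : Prop where
  deriv_ne_zero : y′ ≠ 0
  denom_ne_zero : R.denom.aeval y ≠ 0
  equation : schwarzian y + y′ ^ 2 * (R.num.aeval y / R.denom.aeval y) = 0

/-- A differential field `U` (of characteristic zero) is differentially closed if, for all
differential polynomials `f`, `g` in one variable over `U` such that `f` has order exactly `n`
and `g` is nonzero of order less than `n`, there is `a ∈ U` with `f(a) = 0` and `g(a) ≠ 0`. -/
def IsDifferentiallyClosed (U : Type*) [Field U] [Differential U] : Prop :=
  ∀ (n : ℕ) (f : MvPolynomial (Fin (n + 1)) U) (g : MvPolynomial (Fin n) U),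
    0 < f.degreeOf (Fin.last n) → g ≠ 0 →
      ∃ a : U, f.eval (fun i : Fin (n + 1) => iterDer (i : ℕ) a) = 0 ∧
        g.eval (fun i : Fin n => iterDer (i : ℕ) a) ≠ 0

/-! ### The first-order language of differential rings and strong minimality -/

/-- The function symbols `+, *, -, 0, 1, ′`. -/
inductive DiffRingFunc : ℕ → Type
  | add : DiffRingFunc 2
  | mul : DiffRingFunc 2
  | neg : DiffRingFunc 1
  | zero : DiffRingFunc 0
  | one : DiffRingFunc 0
  | der : DiffRingFunc 1

/-- The language of differential rings. -/
def diffRingLang : FirstOrder.Language := ⟨DiffRingFunc, fun _ => Empty⟩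

/-- Every differential field is a structure for the language of differential rings. -/
instance diffRingStructure (F : Type*) [Field F] [Differential F] : diffRingLang.Structure F where
  funMap {n} f :=
    match n, f with
    | _, DiffRingFunc.add => fun x => x 0 + x 1
    | _, DiffRingFunc.mul => fun x => x 0 * x 1
    | _, DiffRingFunc.neg => fun x => -x 0
    | _, DiffRingFunc.zero => fun _ => 0
    | _, DiffRingFunc.one => fun _ => 1
    | _, DiffRingFunc.der => fun x => ((x 0)′)
  RelMap {_} r := Empty.elim r

/-- A set `Y` in a differential field `U` is strongly minimal if it is definable (by a first-order
formula with parameters from `U`), infinite, and every definable subset of it is finite or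
cofinite in it. -/
structure IsStronglyMinimal {U : Type*} [Field U] [Differential U] (Y : Set U) : Prop where
  definable : (Set.univ : Set U).Definable₁ diffRingLang Y
  infinite : Y.Infinite
  finite_or_cofinite : ∀ D : Set U, D ⊆ Y → (Set.univ : Set U).Definable₁ diffRingLang D →
    D.Finite ∨ (Y \ D).Finite

universe u v w

/-! Put v = y' and u = y''/(2y'²). The equation becomes the system y' = v, v' = 2uv², u' = -v(u² +
R(y)/2), so along y the function u follows the Riccati vector field. The core is that y, u, v are
algebraically independent over K as soon as y is transcendental over K (`notMem_acl_jet`). As K⟨y⟩ =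
K(y, u, v), this gives (a). Any dependence is turned into an algebraic solution of the Riccati
equation. Larger fields of constants do no harm: a minimal polynomial of such a solution specializes
to ℂ (`exists_isAlgebraicRiccatiSolution`).

Let Δ be the given derivation and ∂ = d/dy, killing K. Suppose u is algebraic over K(y). Then so is
Δu - v∂u = -v(∂u + u² + R/2), hence so is v (`riccati_of_notMem_acl`). Now [Δ, ∂] = -(∂v)∂, and a
multiple θ of ∂ commutes with Δ. In `exists_riccati_of_commutator`, either a Riccati solution is
visible, or there is a derivation η that commutes with θ, moves y and kills the Schwarzian
expression of y along θ. Then w = ηy satisfies w''' + 2Rw' + R'w = 0, the symmetric square of ψ'' +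
(R/2)ψ = 0, and w yields a Riccati solution (`exists_riccati_of_deformation`).

Suppose instead that u is transcendental over K(y) but v is algebraic over K(y, u). The coefficients
g of the minimal polynomial of v satisfy, one after another, ∂g - 2jug = δh/h, with ∂ now the
Riccati vector field on K(y, u) and δ = Δ - v∂. Poles force g = 0 (`eq_zero_of_riccati_identity`): a
pole of g must lie along a curve invariant under the Riccati field, hence yield an algebraic
solution, and at u = ∞ the degrees disagree. So v = 0, which is excluded (`notMem_acl_of_riccati`).

For (b), (a) shows that all solutions transcendental over U generate isomorphic differential fields
over U. If a definable set D and its complement both contained infinitely many solutions, the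
ultrapower of U would contain two such solutions, one satisfying the formula of D and one not. A
back-and-forth argument in the countably saturated ultrapower (`IsDiffSpan.realize_iff`) forbids
this. Infinitude comes directly from the axioms of differentially closed fields. -/

/-! ### Derivations and algebraic dependence -/

section AlgebraicDependence

/-- A derivation extends along a formally étale extension. -/
theorem Derivation.exists_extension_of_formallyEtale {R S T : Type*} [CommRing R] [CommRing S]
    [CommRing T] [Algebra R S] [Algebra R T] [Algebra S T] [IsScalarTower R S T]
    [Algebra.FormallyEtale S T] (d : Derivation R S T) :
    ∃ D : Derivation R T T, ∀ s : S, D (algebraMap S T s) = d s := by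
  let e := KaehlerDifferential.tensorKaehlerEquivOfFormallyEtale R S T
  refine ⟨((LinearMap.liftBaseChange T d.liftKaehlerDifferential).comp
      e.symm.toLinearMap).compDer (KaehlerDifferential.D R T), fun s => ?_⟩
  have := KaehlerDifferential.tensorKaehlerEquivOfFormallyEtale_symm_D_algebraMap R S T s
  simp [e, this]

variable {k L : Type*} [Field k] [Field L] [Algebra k L]

variable (k) in
/-- The relative algebraic closure in `L` of the field generated by a set. -/
noncomputable def acl (S : Set L) : IntermediateField k L :=
  (algebraicClosure (IntermediateField.adjoin k S) L).restrictScalars k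

theorem mem_acl {S : Set L} {x : L} :
    x ∈ acl k S ↔ IsAlgebraic (IntermediateField.adjoin k S) x := mem_algebraicClosure_iff

/-- This link with the algebraic matroid makes exchange and basis arguments available. -/
theorem coe_acl (S : Set L) : (acl k S : Set L) = (AlgebraicIndependent.matroid k L).closure S := by
  ext x
  rw [AlgebraicIndependent.matroid_closure_eq]
  simp only [SetLike.mem_coe, mem_acl]
  exact IntermediateField.isAlgebraic_adjoin_iff 

theorem subset_acl (S : Set L) : S ⊆ acl k S := fun x hx =>
  mem_acl.2 (isAlgebraic_algebraMap (⟨x, IntermediateField.subset_adjoin k S hx⟩ :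
    IntermediateField.adjoin k S))

theorem acl_le {S : Set L} {T : Set L} (h : S ⊆ acl k T) : acl k S ≤ acl k T := by
  rw [← SetLike.coe_subset_coe, coe_acl, coe_acl]
  rw [coe_acl] at h
  exact Matroid.closure_subset_closure_of_subset_closure h

theorem acl_mono {S T : Set L} (h : S ⊆ T) : acl k S ≤ acl k T :=
  acl_le (h.trans (subset_acl T))

theorem acl_exchange {S : Set L} {x y : L} (h : y ∈ acl k (insert x S)) (hy : y ∉ acl k S) :
    x ∈ acl k (insert y S) := by
  rw [← SetLike.mem_coe, coe_acl] at *
  exact (Matroid.closure_exchange ⟨h, hy⟩).1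

theorem IsAlgebraic.mono_intermediateField {E E' : IntermediateField k L} (h : E ≤ E') {x : L}
    (hx : IsAlgebraic E x) : IsAlgebraic E' x :=
  IsAlgebraic.tower_top_of_subalgebra_le (A := E.toSubalgebra) (B := E'.toSubalgebra) h hx

theorem mem_acl_of_isAlgebraic {S : Set L} {E : IntermediateField k L} (hE : E ≤ acl k S) {x : L}
    (hx : IsAlgebraic E x) : x ∈ acl k S := by
  apply acl_le (k := k) (S := acl k S) (T := S) le_rfl
  rw [mem_acl]
  exact hx.mono_intermediateField (hE.trans fun z hz => IntermediateField.subset_adjoin k _ hz)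

/-- If a derivation maps a field `E` into a field `E'` which contains `E` and `x` and is
relatively algebraically closed, it maps the elements algebraic over `E` into `E'`. -/
theorem Derivation.apply_mem_of_isAlgebraic [CharZero k] (D : Derivation k L L)
    (E E' : IntermediateField k L) (hE : ∀ x ∈ E, D x ∈ E') (hEE' : E ≤ E') {x : L}
    (hx : IsAlgebraic E x) (hxE' : x ∈ E') : D x ∈ E' := by
  have : CharZero E := charZero_of_injective_algebraMap (algebraMap k E).injective
  set p := minpoly E x
  have h0 : D (Polynomial.aeval x p) = 0 := by rw [minpoly.aeval, map_zero]
  have hs : Polynomial.aeval x (Polynomial.derivative p) ≠ 0 :=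
    (minpoly.irreducible hx.isIntegral).separable.aeval_derivative_ne_zero (minpoly.aeval E x)
  have hmem : ∀ q : E[X], Polynomial.aeval x q ∈ E' := by
    intro q
    rw [Polynomial.aeval_eq_sum_range]
    exact sum_mem fun i _ => by
      rw [Algebra.smul_def]
      exact mul_mem (hEE' (q.coeff i).2) (pow_mem hxE' i)
  -- The difference is q with its coefficients differentiated, evaluated at x. For q = p the first
  -- term vanishes, and separability allows division by p'(x).
  have key : ∀ q : E[X], D (Polynomial.aeval x q) -
      Polynomial.aeval x (Polynomial.derivative q) * D x ∈ E' := by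
    intro q
    induction q using Polynomial.induction_on' with
    | add p q hp hq =>
      have := add_mem hp hq
      simp only [map_add, add_mul]
      convert this using 1
      ring
    | monomial n a =>
      simp only [Polynomial.aeval_monomial, Derivation.leibniz, Derivation.leibniz_pow,
        Polynomial.derivative_monomial, map_mul, smul_eq_mul, nsmul_eq_mul]
      have : x ^ n * D (algebraMap E L a) ∈ E' := mul_mem (pow_mem hxE' n) (hE _ a.2)
      convert this using 1
      rw [_root_.map_natCast]
      ring
  have h1 := key p
  rw [h0, zero_sub, neg_mem_iff] at h1
  have := div_mem h1 (hmem (Polynomial.derivative p))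
  rwa [mul_div_cancel_left₀ _ hs] at this

/-- The constants of a derivation. -/
def Derivation.constants (D : Derivation k L L) : IntermediateField k L where
  carrier := {x | D x = 0}
  mul_mem' {a b} ha hb := by simp only [Set.mem_ofPred_eq] at *; simp [ha, hb]
  add_mem' {a b} ha hb := by simp only [Set.mem_ofPred_eq] at *; simp [ha, hb]
  algebraMap_mem' r := by simp
  inv_mem' a ha := by
    simp only [Set.mem_ofPred_eq] at *
    simp [Derivation.leibniz_inv, ha]

@[simp]
theorem Derivation.mem_constants {D : Derivation k L L} {x : L} : x ∈ D.constants ↔ D x = 0 :=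
  Iff.rfl

theorem Derivation.eq_zero_of_isAlgebraic_constants [CharZero k] (D : Derivation k L L) {x : L}
    (hx : IsAlgebraic D.constants x) : D x = 0 := by
  have : CharZero D.constants := charZero_of_injective_algebraMap (algebraMap k _).injective
  set p := minpoly D.constants x
  have hs : Polynomial.aeval x (Polynomial.derivative p) ≠ 0 :=
    (minpoly.irreducible hx.isIntegral).separable.aeval_derivative_ne_zero (minpoly.aeval _ x)
  have key : ∀ q : D.constants[X], D (Polynomial.aeval x q) =
      Polynomial.aeval x (Polynomial.derivative q) * D x := by
    intro q
    induction q using Polynomial.induction_on' with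
    | add p q hp hq => simp [hp, hq, add_mul]
    | monomial n a =>
      have : D (algebraMap D.constants L a) = 0 := a.2
      simp only [Polynomial.aeval_monomial, Derivation.leibniz, Derivation.leibniz_pow,
        Polynomial.derivative_monomial, map_mul, smul_eq_mul, nsmul_eq_mul, this]
      rw [_root_.map_natCast]
      ring
  have := key p
  rw [minpoly.aeval, map_zero] at this
  simpa [hs] using this.symm

theorem Derivation.eq_zero_of_mem_acl [CharZero k] (D : Derivation k L L) {S : Set L}
    (hS : ∀ s ∈ S, D s = 0) {x : L} (hx : x ∈ acl k S) : D x = 0 := by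
  have h : IntermediateField.adjoin k S ≤ D.constants := IntermediateField.adjoin_le_iff.2 hS
  exact D.eq_zero_of_isAlgebraic_constants ((mem_acl.1 hx).mono_intermediateField h)

theorem Derivation.eqOn_acl [CharZero k] {D₁ D₂ : Derivation k L L} {S : Set L}
    (hS : ∀ s ∈ S, D₁ s = D₂ s) {x : L} (hx : x ∈ acl k S) : D₁ x = D₂ x := by
  have := (D₁ - D₂).eq_zero_of_mem_acl (S := S) (fun s hs => by simp [hS s hs]) hx
  simpa [sub_eq_zero] using this

theorem Derivation.apply_mem_of_mem_adjoin (D : Derivation k L L) {S : Set L}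
    {E : IntermediateField k L} (hSE : S ⊆ E) (hS : ∀ s ∈ S, D s ∈ E) {x : L}
    (hx : x ∈ IntermediateField.adjoin k S) : D x ∈ E := by
  have hle : IntermediateField.adjoin k S ≤ E := IntermediateField.adjoin_le_iff.2 hSE
  induction hx using IntermediateField.adjoin_induction with
  | mem z hz => exact hS z hz
  | algebraMap r => simp
  | add a b _ _ ha hb => simpa using add_mem ha hb
  | mul a b ha' hb' ha hb =>
    rw [Derivation.leibniz]
    exact add_mem (mul_mem (hle ha') hb) (mul_mem (hle hb') ha)
  | inv a ha' ha =>
    rw [Derivation.leibniz_inv]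
    exact mul_mem (neg_mem (pow_mem (inv_mem (hle ha')) 2)) ha

theorem Derivation.apply_mem_acl [CharZero k] (D : Derivation k L L) {S T : Set L}
    (hST : S ⊆ acl k T) (hS : ∀ s ∈ S, D s ∈ acl k T) {x : L} (hx : x ∈ acl k S) :
    D x ∈ acl k T :=
  D.apply_mem_of_isAlgebraic (IntermediateField.adjoin k S) (acl k T)
    (fun _ hz => D.apply_mem_of_mem_adjoin hST hS hz) (IntermediateField.adjoin_le_iff.2 hST)
    (mem_acl.1 hx) (acl_le hST hx)

/-- The restriction of a derivation to a stable subfield. -/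
def Derivation.restrictField (D : Derivation k L L) (E : IntermediateField k L)
    (h : ∀ x ∈ E, D x ∈ E) : Derivation k E E where
  toFun x := ⟨D x, h x x.2⟩
  map_add' a b := by ext; simp
  map_smul' c a := by ext; simp
  map_one_eq_zero' := by ext; simp
  leibniz' a b := by ext; simp

@[simp]
theorem Derivation.coe_restrictField (D : Derivation k L L) (E : IntermediateField k L)
    (h : ∀ x ∈ E, D x ∈ E) (x : E) : (D.restrictField E h x : L) = D x := rfl

/-- Complete x to a transcendence basis over k(S). The partial derivative in the direction x extends
from the polynomial ring to L, which is formally étale over it in characteristic zero. -/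
theorem exists_derivation_of_notMem_acl [CharZero k] {S : Set L} {x : L} (hx : x ∉ acl k S) :
    ∃ D : Derivation k L L, (∀ s ∈ S, D s = 0) ∧ D x = 1 := by
  classical
  set E := IntermediateField.adjoin k S with hE
  have : CharZero E := charZero_of_injective_algebraMap (algebraMap k E).injective
  have hx' : Transcendental E x := fun h => hx (mem_acl.2 h)
  have hind : AlgebraicIndepOn E id ({x} : Set L) := by
    rw [AlgebraicIndepOn]
    exact (algebraicIndependent_unique_type_iff).2 hx'
  obtain ⟨B, hxB, hB⟩ := exists_isTranscendenceBasis_superset hind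
  have hxB' : x ∈ B := hxB rfl
  let φ : MvPolynomial B E →ₐ[E] L := MvPolynomial.aeval (Subtype.val : B → L)
  let : Algebra (MvPolynomial B E) L := φ.toRingHom.toAlgebra
  have : IsScalarTower E (MvPolynomial B E) L := IsScalarTower.of_algebraMap_eq' φ.comp_algebraMap.symm
  have hinj : Function.Injective (algebraMap (MvPolynomial B E) L) := hB.1
  have : FaithfulSMul (MvPolynomial B E) L := (faithfulSMul_iff_algebraMap_injective _ _).2 hinj
  let : Algebra (FractionRing (MvPolynomial B E)) L := FractionRing.liftAlgebra _ _
  have : IsScalarTower (MvPolynomial B E) (FractionRing (MvPolynomial B E)) L :=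
    FractionRing.isScalarTower_liftAlgebra _ _
  have : Algebra.IsAlgebraic (MvPolynomial B E) L := by
    have := hB.isAlgebraic
    refine ⟨fun z => ?_⟩
    exact (this.isAlgebraic z).of_ringHom_of_comp_eq hB.1.aevalEquiv.toRingEquiv (RingHom.id L)
      hB.1.aevalEquiv.surjective Function.injective_id (by ext <;> simp [RingHom.algebraMap_toAlgebra, φ])
  have : Algebra.IsAlgebraic (FractionRing (MvPolynomial B E)) L :=
    Algebra.IsAlgebraic.extendScalars (R := MvPolynomial B E)
      (IsFractionRing.injective (MvPolynomial B E) (FractionRing (MvPolynomial B E)))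
  have h1 : Algebra.FormallyEtale (MvPolynomial B E) (FractionRing (MvPolynomial B E)) :=
    Algebra.FormallyEtale.of_isLocalization (nonZeroDivisors (MvPolynomial B E))
  have h2 : Algebra.FormallyEtale (FractionRing (MvPolynomial B E)) L :=
    Algebra.FormallyEtale.of_isSeparable _ _
  have h3 : Algebra.FormallyEtale (MvPolynomial B E) L :=
    Algebra.FormallyEtale.comp _ (FractionRing (MvPolynomial B E)) L
  obtain ⟨D, hD⟩ := Derivation.exists_extension_of_formallyEtale (R := E)
    (MvPolynomial.mkDerivation E (fun b : B => if (b : L) = x then (1 : L) else 0))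
  refine ⟨D.restrictScalars k, fun s hs => ?_, ?_⟩
  · exact D.map_algebraMap (⟨s, IntermediateField.subset_adjoin k S hs⟩ : E)
  · have := hD (MvPolynomial.X ⟨x, hxB'⟩)
    rw [MvPolynomial.mkDerivation_X, if_pos rfl] at this
    rw [← this]
    change D x = D (φ _)
    simp [φ]

end AlgebraicDependence

/-! ### Derivations of polynomial rings -/

section PolynomialDerivations

namespace Polynomial

variable {r A B : Type*} [CommRing r] [CommRing A] [Algebra r A] [CommRing B] [Algebra r B]

theorem coeff_lsum_monomial (d : A →ₗ[r] A) (p : A[X]) (n : ℕ) :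
    (lsum (fun n => ((monomial n : A →ₗ[A] A[X]).restrictScalars r).comp d) p).coeff n =
      d (p.coeff n) := by
  change (p.sum fun n a => monomial n (d a)).coeff n = _
  rw [sum_def, finsetSum_coeff]
  simp only [coeff_monomial]
  rw [Finset.sum_ite_eq' p.support n]
  split_ifs with h
  · rfl
  · rw [notMem_support_iff.1 h, map_zero]

/-- The derivation of `A[X]` that kills `X` and acts on coefficients as `d`. -/
noncomputable def mapDeriv (d : Derivation r A A) : Derivation r A[X] A[X] :=
  Derivation.mk'
    (lsum fun n => ((monomial n : A →ₗ[A] A[X]).restrictScalars r).comp d.toLinearMap) (by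
    intro p q
    ext n
    rw [smul_eq_mul, smul_eq_mul, coeff_add, coeff_lsum_monomial, coeff_mul, coeff_mul,
      mul_comm q, coeff_mul, map_sum, ← Finset.sum_add_distrib]
    refine Finset.sum_congr rfl fun i _ => ?_
    rw [coeff_lsum_monomial, coeff_lsum_monomial]
    exact (d.leibniz _ _).trans (by simp only [smul_eq_mul]; congr 1; exact mul_comm _ _))

@[simp]
theorem coeff_mapDeriv (d : Derivation r A A) (p : A[X]) (n : ℕ) :
    (mapDeriv d p).coeff n = d (p.coeff n) := coeff_lsum_monomial _ _ _
@[simp]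
theorem mapDeriv_C (d : Derivation r A A) (a : A) : mapDeriv d (C a) = C (d a) := by
  ext n
  simp only [coeff_mapDeriv, coeff_C]
  split_ifs <;> simp

@[simp]
theorem mapDeriv_X (d : Derivation r A A) : mapDeriv d (X : A[X]) = 0 := by
  ext n
  simp only [coeff_mapDeriv, coeff_X, coeff_zero]
  split_ifs <;> simp

theorem map_mapDeriv (d : Derivation r A A) (d' : Derivation r B B) (f : A →+* B)
    (h : ∀ a, d' (f a) = f (d a)) (p : A[X]) :
    (mapDeriv d p).map f = mapDeriv d' (p.map f) := by
  ext n
  simp [h]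

theorem deriv_eval₂ (d : Derivation r A A) (D : Derivation r B B) (f : A →+* B)
    (h : ∀ a, D (f a) = f (d a)) (p : A[X]) (x : B) :
    D (p.eval₂ f x) = (mapDeriv d p).eval₂ f x + p.derivative.eval₂ f x * D x := by
  induction p using Polynomial.induction_on' with
  | add p q hp hq => simp only [eval₂_add, map_add, hp, hq]; ring
  | monomial n a =>
    rw [← C_mul_X_pow_eq_monomial]
    simp only [eval₂_mul, eval₂_C, eval₂_pow, eval₂_X, Derivation.leibniz, Derivation.leibniz_pow,
      smul_eq_mul, nsmul_eq_mul, h, mapDeriv_C, mapDeriv_X, mul_zero, zero_add, derivative_mul,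
      derivative_C, derivative_X_pow, zero_mul, eval₂_C]
    simp
    ring

theorem natDegree_mapDeriv_le (d : Derivation r A A) (p : A[X]) :
    (mapDeriv d p).natDegree ≤ p.natDegree :=
  natDegree_le_iff_coeff_eq_zero.2 fun n hn => by
    rw [coeff_mapDeriv, coeff_eq_zero_of_natDegree_lt hn, map_zero]

/-- Division with remainder by a polynomial which need not be monic. -/
theorem exists_pow_mul_eq_mul_add (P T : A[X]) (hP : 0 < P.natDegree) :
    ∃ (n : ℕ) (Q r : A[X]), C (P.leadingCoeff ^ n) * T = Q * P + r ∧ r.natDegree < P.natDegree := by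
  induction hn : T.natDegree using Nat.strong_induction_on generalizing T with
  | _ N ih =>
    by_cases hlt : T.natDegree < P.natDegree
    · exact ⟨0, 0, T, by simp, hlt⟩
    push Not at hlt
    -- Cross-multiplication by the leading coefficients cancels the top term, so the degree drops
    -- without any inversion.
    set T' := C P.leadingCoeff * T - C T.leadingCoeff * X ^ (T.natDegree - P.natDegree) * P with hT'
    have hdeg : T'.natDegree < N := by
      rw [← hn]
      have hpos : 0 < T.natDegree := lt_of_lt_of_le hP hlt
      suffices T'.natDegree ≤ T.natDegree - 1 by omega
      refine natDegree_le_iff_coeff_eq_zero.2 fun m hm => ?_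
      have hm' : T.natDegree ≤ m := by omega
      rw [hT', coeff_sub, coeff_C_mul, mul_assoc, coeff_C_mul, coeff_X_pow_mul']
      rw [if_pos (by omega)]
      rcases hm'.eq_or_lt with rfl | hm'
      · rw [Nat.sub_sub_self hlt]
        simp only [leadingCoeff]
        ring
      · rw [coeff_eq_zero_of_natDegree_lt hm', coeff_eq_zero_of_natDegree_lt (p := P) (by omega)]
        simp
    obtain ⟨n, Q, r, h, hr⟩ := ih _ hdeg T' rfl
    refine ⟨n + 1, Q + C (P.leadingCoeff ^ n) * (C T.leadingCoeff *
      X ^ (T.natDegree - P.natDegree)), r, ?_, hr⟩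
    rw [hT'] at h
    rw [pow_succ, C_mul]
    linear_combination h

/-- If P = (X - α)^(m+1) H with H(α) ≠ 0, then modulo (X - α)^(m+1) only (m+1)(X - α)^m H D(X - α)
survives in D P. So a component of an invariant curve is invariant. -/
theorem eval_deriv_X_sub_C_eq_zero {M : Type*} [Field M] [CharZero M] [Algebra r M]
    (D : Derivation r M[X] M[X])
    {P : M[X]} (hP : P ≠ 0) {α : M} (hα : P.IsRoot α) {e : M} (he : e ≠ 0)
    (hdvd : P ∣ C e * D P) : (D (X - C α)).eval α = 0 := by
  obtain ⟨H, hH, hndvd⟩ := P.exists_eq_pow_rootMultiplicity_mul_and_not_dvd hP α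
  obtain ⟨m, hm⟩ : ∃ m, P.rootMultiplicity α = m + 1 :=
    Nat.exists_eq_succ_of_ne_zero ((rootMultiplicity_pos hP).2 hα).ne'
  rw [hm] at hH
  have hX : (X - C α) ^ m ≠ 0 := pow_ne_zero _ (X_sub_C_ne_zero α)
  have h1 : (X - C α) ^ (m + 1) ∣ C e * D P := (Dvd.intro _ hH.symm).trans hdvd
  have h2 : C e * D P = (X - C α) ^ m * (C e * (((m + 1 : ℕ) : M[X]) * H * D (X - C α) +
      (X - C α) * D H)) := by
    conv_lhs => rw [hH]
    rw [Derivation.leibniz, Derivation.leibniz_pow]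
    simp only [smul_eq_mul, nsmul_eq_mul, Nat.add_sub_cancel]
    ring
  rw [h2, pow_succ, mul_dvd_mul_iff_left hX, dvd_iff_isRoot, IsRoot] at h1
  rw [dvd_iff_isRoot, IsRoot] at hndvd
  simp only [eval_mul, eval_add, eval_sub, eval_X, eval_C, sub_self, zero_mul, add_zero,
    eval_natCast] at h1
  have hm1 : ((m + 1 : ℕ) : M) ≠ 0 := Nat.cast_ne_zero.2 (Nat.succ_ne_zero m)
  simpa only [mul_eq_zero, he, hndvd, hm1, false_or] using h1

end Polynomial

end PolynomialDerivations

/-! ### Algebraic solutions of the Riccati equation -/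

section Riccati

open Polynomial

/-- The derivation `q (∂_X - U²∂_U) - (p/2) ∂_U` of `A[X][U]`, for `R = p/q`. -/
noncomputable def riccatiDerivation (R : RatFunc ℂ) (A : Type*) [CommRing A] [Algebra ℂ A] :
    Derivation ℂ A[X][X] A[X][X] :=
  (C (R.denom.map (algebraMap ℂ A)) : A[X][X]) •
      mapDeriv ((derivative' : Derivation A A[X] A[X]).restrictScalars ℂ) -
    (C (R.denom.map (algebraMap ℂ A)) * X ^ 2 +
      C (C (algebraMap ℂ A (1 / 2)) * R.num.map (algebraMap ℂ A)) : A[X][X]) •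
      (derivative' : Derivation A[X] A[X][X] A[X][X]).restrictScalars ℂ

theorem riccatiDerivation_apply (R : RatFunc ℂ) {A : Type*} [CommRing A] [Algebra ℂ A]
    (P : A[X][X]) : riccatiDerivation R A P = C (R.denom.map (algebraMap ℂ A)) *
        mapDeriv ((derivative' : Derivation A A[X] A[X]).restrictScalars ℂ) P -
      (C (R.denom.map (algebraMap ℂ A)) * X ^ 2 +
        C (C (algebraMap ℂ A (1 / 2)) * R.num.map (algebraMap ℂ A))) * derivative P := rfl

/-- Naturality in the coefficients moves the invariance relation to a finitely generated subalgebra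
and then to ℂ. -/
theorem map_riccatiDerivation (R : RatFunc ℂ) {A B : Type*} [CommRing A] [Algebra ℂ A]
    [CommRing B] [Algebra ℂ B] (f : A →ₐ[ℂ] B) (P : A[X][X]) :
    (riccatiDerivation R A P).map (mapRingHom (f : A →+* B)) =
      riccatiDerivation R B (P.map (mapRingHom (f : A →+* B))) := by
  have hf : (f : A →+* B).comp (algebraMap ℂ A) = algebraMap ℂ B := f.comp_algebraMap
  rw [riccatiDerivation_apply, riccatiDerivation_apply, Polynomial.map_sub, Polynomial.map_mul,
    map_mapDeriv _ ((derivative' : Derivation B B[X] B[X]).restrictScalars ℂ) _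
      (fun a => by simp [derivative_map])]
  simp [Polynomial.map_map, hf, derivative_map]

/-- Nullstellensatz: the Jacobson radical of a finitely generated domain is zero, so some maximal
ideal avoids a, and its residue field is k. -/
theorem exists_algHom_apply_ne_zero {k A : Type*} [Field k] [IsAlgClosed k] [CommRing A] [IsDomain A]
    [Algebra k A] [Algebra.FiniteType k A] {a : A} (ha : a ≠ 0) : ∃ φ : A →ₐ[k] k, φ a ≠ 0 := by
  have : IsJacobsonRing A := isJacobsonRing_of_finiteType (A := k)
  have h1 : Ideal.jacobson (⊥ : Ideal A) = ⊥ := by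
    exact IsJacobsonRing.out ‹_› Ideal.isPrime_bot.isRadical
  have h2 : a ∉ Ideal.jacobson (⊥ : Ideal A) := by rwa [h1, Ideal.mem_bot]
  rw [Ideal.jacobson, Ideal.mem_sInf] at h2
  push Not at h2
  obtain ⟨m, ⟨-, hm⟩, ham⟩ := h2
  let := Ideal.Quotient.field m
  have := finite_of_finite_type_of_isJacobsonRing k (A ⧸ m)
  let e := AlgEquiv.ofBijective (Algebra.ofId k (A ⧸ m))
    (IsAlgClosed.algebraMap_bijective_of_isIntegral)
  refine ⟨(e.symm : (A ⧸ m) →ₐ[k] k).comp (Ideal.Quotient.mkₐ k m), ?_⟩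
  simpa [Ideal.Quotient.eq_zero_iff_mem] using ham

/-- The relation makes the curve P = 0 invariant under the Riccati vector field, so any root of P in
ℂ(y)^alg is a solution. -/
theorem exists_isAlgebraicRiccatiSolution_of_polynomial_complex (R : RatFunc ℂ) {P Q : ℂ[X][X]}
    (hP : 0 < P.natDegree) {n : ℕ}
    (h : C (P.leadingCoeff ^ n) * riccatiDerivation R ℂ P = Q * P) :
    ∃ u : AlgFun, IsAlgebraicRiccatiSolution R u := by
  set f : ℂ[X] →+* AlgFun := algebraMap ℂ[X] AlgFun with hf
  have hinj : Function.Injective f := by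
    rw [hf, IsScalarTower.algebraMap_eq ℂ[X] (RatFunc ℂ) AlgFun]
    exact (algebraMap (RatFunc ℂ) AlgFun).injective.comp (RatFunc.algebraMap_injective ℂ)
  have hfX : f X = AlgFun.y := by
    rw [hf, IsScalarTower.algebraMap_apply ℂ[X] (RatFunc ℂ) AlgFun, RatFunc.algebraMap_X]
    rfl
  have hfC : ∀ c, f (C c) = algebraMap ℂ AlgFun c := fun c => by
    rw [hf, ← Polynomial.algebraMap_eq, ← IsScalarTower.algebraMap_apply]
  have hfe : ∀ p : ℂ[X], f p = p.aeval AlgFun.y := by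
    intro p
    rw [aeval_def, ← hfX, ← (show f.comp C = algebraMap ℂ AlgFun from RingHom.ext hfC),
      ← hom_eval₂]
    simp
  have hder : ∀ p : ℂ[X], AlgFun.ddy (f p) = f (derivative p) := by
    intro p
    rw [hfe, hfe, AlgFun.ddy.map_aeval, AlgFun.ddy_y, smul_eq_mul, mul_one]
  set r : AlgFun := algebraMap (RatFunc ℂ) AlgFun R with hr
  have hrden : f R.denom * r = f R.num := by
    have := RatFunc.num_div_denom R
    have hd : algebraMap ℂ[X] (RatFunc ℂ) R.denom ≠ 0 :=
      RatFunc.algebraMap_ne_zero R.denom_ne_zero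
    rw [hr, hf, IsScalarTower.algebraMap_apply ℂ[X] (RatFunc ℂ) AlgFun R.denom,
      IsScalarTower.algebraMap_apply ℂ[X] (RatFunc ℂ) AlgFun R.num, ← map_mul]
    congr 1
    rw [div_eq_iff hd] at this
    rw [this, mul_comm]
  -- The Riccati field with the denominator of R divided out: D(X - α) takes the value -(α' + α² +
  -- R/2) at α.
  let D : Derivation ℂ AlgFun[X] AlgFun[X] := mapDeriv AlgFun.ddy -
    (X ^ 2 + C (1 / 2 * r) : AlgFun[X]) •
      (derivative' : Derivation AlgFun AlgFun[X] AlgFun[X]).restrictScalars ℂ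
  have hD : ∀ p, D p = mapDeriv AlgFun.ddy p - (X ^ 2 + C (1 / 2 * r)) * derivative p :=
    fun p => rfl
  have hmap : (riccatiDerivation R ℂ P).map f = C (f R.denom) * D (P.map f) := by
    rw [riccatiDerivation_apply, hD, Polynomial.map_sub, Polynomial.map_mul, map_mapDeriv _ AlgFun.ddy f
      (fun a => by simpa using hder a)]
    simp only [Algebra.algebraMap_self, Polynomial.map_id, map_C, Polynomial.map_mul,
      Polynomial.map_add, Polynomial.map_pow, map_X, RingHom.id_apply, map_mul, hfC, ← hrden,
      derivative_map]
    simp only [map_div₀, map_one, map_ofNat]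
    ring
  have hP' : (P.map f).natDegree = P.natDegree := natDegree_map_eq_of_injective hinj P
  have hP0 : P.map f ≠ 0 := by
    intro h0
    rw [h0] at hP'
    simp at hP'
    omega
  obtain ⟨α, hα⟩ := IsAlgClosed.exists_root (P.map f)
    (by rw [degree_eq_natDegree hP0, hP']; exact_mod_cast hP.ne')
  have he : f (P.leadingCoeff ^ n * R.denom) ≠ 0 := by
    rw [map_ne_zero_iff f hinj]
    refine mul_ne_zero (pow_ne_zero _ ?_) R.denom_ne_zero
    rw [Ne, leadingCoeff_eq_zero]
    rintro rfl
    simp at hP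
  have hdvd : P.map f ∣ C (f (P.leadingCoeff ^ n * R.denom)) * D (P.map f) := by
    refine ⟨Q.map f, ?_⟩
    have := congrArg (Polynomial.map f) h
    rw [Polynomial.map_mul, hmap, map_C, Polynomial.map_mul] at this
    rw [map_mul, C_mul, mul_assoc, this, mul_comm]
  have := eval_deriv_X_sub_C_eq_zero D hP0 hα he hdvd
  rw [hD] at this
  refine ⟨α, ?_⟩
  rw [IsAlgebraicRiccatiSolution, ← hr]
  simp at this
  linear_combination -this

/-- The coefficients of P and Q generate a finitely generated ℂ-algebra. A ℂ-point where the leading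
coefficient of the leading coefficient of P survives preserves both the identity and the degree. -/
theorem exists_isAlgebraicRiccatiSolution_of_polynomial (R : RatFunc ℂ) {k : Type*} [Field k]
    [Algebra ℂ k] {P Q : k[X][X]} (hP : 0 < P.natDegree) {n : ℕ}
    (h : C (P.leadingCoeff ^ n) * riccatiDerivation R k P = Q * P) :
    ∃ u : AlgFun, IsAlgebraicRiccatiSolution R u := by
  classical
  let coeffs : k[X][X] → Finset k := fun P => P.support.biUnion fun i => (P.coeff i).coeffs
  let A := Algebra.adjoin ℂ ((coeffs P ∪ coeffs Q : Finset k) : Set k)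
  have hmem : ∀ (P : k[X][X]) (i j : ℕ), (P.coeff i).coeff j = 0 ∨ (P.coeff i).coeff j ∈ coeffs P := by
    intro P i j
    by_cases h : (P.coeff i).coeff j = 0
    · exact Or.inl h
    · refine Or.inr (Finset.mem_biUnion.2 ⟨i, ?_, coeff_mem_coeffs h⟩)
      rw [mem_support_iff]
      rintro h0
      simp [h0] at h
  have hlift : ∀ P : k[X][X], (∀ i j, (P.coeff i).coeff j ∈ A) →
      ∃ P' : A[X][X], P'.map (mapRingHom (A.val : A →+* k)) = P := by
    intro P hP
    have : P ∈ (mapRingHom (mapRingHom (A.val : A →+* k))).rangeS := by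
      rw [mem_map_rangeS]
      intro i
      rw [mem_map_rangeS]
      intro j
      exact ⟨⟨_, hP i j⟩, rfl⟩
    exact this
  have hin : ∀ (P₁ : k[X][X]) , coeffs P₁ ⊆ coeffs P ∪ coeffs Q → ∀ i j, (P₁.coeff i).coeff j ∈ A := by
    intro P₁ hP₁ i j
    rcases hmem P₁ i j with h | h
    · rw [h]; exact zero_mem _
    · exact Algebra.subset_adjoin (hP₁ h)
  obtain ⟨P', hP'⟩ := hlift P (hin P Finset.subset_union_left)
  obtain ⟨Q', hQ'⟩ := hlift Q (hin Q Finset.subset_union_right)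
  have hinj1 : Function.Injective (mapRingHom (A.val : A →+* k)) :=
    map_injective _ Subtype.val_injective
  have hinj : Function.Injective (Polynomial.map (mapRingHom (A.val : A →+* k))) :=
    map_injective _ hinj1
  rw [← hP', natDegree_map_eq_of_injective hinj1] at hP
  have h' : C (P'.leadingCoeff ^ n) * riccatiDerivation R A P' = Q' * P' := by
    apply hinj
    rw [Polynomial.map_mul, Polynomial.map_mul, map_riccatiDerivation, hP', hQ', ← h, map_C, map_pow,
      ← hP',       leadingCoeff_map_of_injective hinj1]
  have : Algebra.FiniteType ℂ A :=
    Subalgebra.fg_iff_finiteType _ |>.1 (Subalgebra.fg_adjoin_finset _)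
  have hlc : P'.leadingCoeff.leadingCoeff ≠ 0 := by
    rw [Ne, leadingCoeff_eq_zero, leadingCoeff_eq_zero]
    rintro rfl
    simp at hP
  obtain ⟨φ, hφ⟩ := exists_algHom_apply_ne_zero (k := ℂ) hlc
  have hlc' : mapRingHom (φ : A →+* ℂ) P'.leadingCoeff ≠ 0 := by
    intro h0
    apply hφ
    have := congrArg (fun p => coeff p P'.leadingCoeff.natDegree) h0
    simpa using this
  refine exists_isAlgebraicRiccatiSolution_of_polynomial_complex R
    (P := P'.map (mapRingHom (φ : A →+* ℂ))) (Q := Q'.map (mapRingHom (φ : A →+* ℂ))) (n := n) ?_ ?_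
  · rwa [natDegree_map_of_leadingCoeff_ne_zero _ hlc']
  · have := congrArg (Polynomial.map (mapRingHom (φ : A →+* ℂ))) h'
    rwa [Polynomial.map_mul, Polynomial.map_mul, map_riccatiDerivation, map_C, map_pow,
      ← leadingCoeff_map_of_leadingCoeff_ne_zero _ hlc'] at this

end Riccati

/-! ### Descent of algebraic Riccati solutions from larger constants to ℂ -/

section RiccatiDescent

open Polynomial

/-- The value `R(y)` of a rational function. -/
noncomputable def ratEval {L : Type*} [Field L] [Algebra ℂ L] (R : RatFunc ℂ) (y : L) : L :=
  R.num.aeval y / R.denom.aeval y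

variable {L : Type*} [Field L] [Algebra ℂ L]

/-- If `∂y = 1`, then a solution of the Riccati equation which is algebraic over the field
generated by `y` and the constants yields an algebraic solution over `ℂ(y)`. -/
theorem exists_isAlgebraicRiccatiSolution (R : RatFunc ℂ) (D : Derivation ℂ L L) {y u : L}
    (hy : D y = 1) (hu : u ∈ acl ℂ (insert y (D.constants : Set L)))
    (h : D u + u ^ 2 + 1 / 2 * ratEval R y = 0) :
    ∃ u : AlgFun, IsAlgebraicRiccatiSolution R u := by
  have : CharZero L := charZero_of_injective_algebraMap (algebraMap ℂ L).injective
  have hytr : Transcendental D.constants y := fun hy' => by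
    have := D.eq_zero_of_isAlgebraic_constants hy'
    simp [hy] at this
  let k := D.constants
  let f : k[X] →ₐ[k] L := aeval y
  have hfinj : Function.Injective f := transcendental_iff_injective.1 hytr
  let _ : Algebra k[X] L := f.toRingHom.toAlgebra
  have hfa : ∀ a : k[X], algebraMap k[X] L a = aeval y a := fun _ => rfl
  have hualg : IsAlgebraic k[X] u := by
    rw [mem_acl, IntermediateField.isAlgebraic_adjoin_iff] at hu
    have hle : Algebra.adjoin ℂ (insert y (k : Set L)) ≤ (f.restrictScalars ℂ).range := by
      rw [Algebra.adjoin_le_iff]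
      rintro x (rfl | hx)
      · exact ⟨X, aeval_X _⟩
      · exact ⟨C ⟨x, hx⟩, aeval_C _ _⟩
    exact (hu.tower_top_of_subalgebra_le hle).of_ringHom_of_comp_eq
      (f.restrictScalars ℂ).rangeRestrict (RingHom.id L)
      (f.restrictScalars ℂ).rangeRestrict_surjective Function.injective_id rfl
  -- P is an annihilator of u of least degree over k[X]. It need not be monic, whence the
  -- pseudo-division below.
  have hex : ∃ n, ∃ P : k[X][X], P ≠ 0 ∧ aeval u P = 0 ∧ P.natDegree = n := by
    obtain ⟨P, hP, hPu⟩ := hualg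
    exact ⟨_, P, hP, hPu, rfl⟩
  classical
  obtain ⟨P, hP, hPu, hPn⟩ := Nat.find_spec hex
  have hmin : ∀ r : k[X][X], aeval u r = 0 → r.natDegree < P.natDegree → r = 0 := by
    intro r hr hlt
    by_contra hr0
    rw [hPn] at hlt
    exact Nat.find_min hex hlt ⟨r, hr0, hr, rfl⟩
  have hdeg : 0 < P.natDegree := by
    rw [Nat.pos_iff_ne_zero]
    intro h0
    rw [natDegree_eq_zero] at h0
    obtain ⟨a, rfl⟩ := h0
    rw [aeval_C] at hPu
    exact hP (by rw [hfinj (hPu.trans (map_zero f).symm), C_0])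
  have hder : ∀ a : k[X], D (algebraMap k[X] L a) =
      algebraMap k[X] L (((derivative' : Derivation k k[X] k[X]).restrictScalars ℂ) a) := by
    intro a
    have h0 : mapDeriv (0 : Derivation ℂ k k) a = 0 := by
      ext n
      simp
    have := deriv_eval₂ (0 : Derivation ℂ k k) D (algebraMap k L)
      (fun c => by rw [Derivation.zero_apply, map_zero]; exact c.2) a y
    rw [h0, hy, mul_one, eval₂_zero, zero_add] at this
    exact this
  have hmap : ∀ p : ℂ[X], algebraMap k[X] L (p.map (algebraMap ℂ k)) = aeval y p := by
    intro p
    rw [hfa, aeval_map_algebraMap]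
  have hyC : Transcendental ℂ y := hytr.restrictScalars (algebraMap ℂ k).injective
  have hd : aeval y R.denom ≠ 0 := by
    intro h0
    exact R.denom_ne_zero ((transcendental_iff.1 hyC) _ h0)
  -- Differentiating P(u) = 0 along the Riccati equation shows that the derivative of P also
  -- annihilates u, so by minimality its pseudo-remainder by P is zero.
  have hT : aeval u (riccatiDerivation R k P) = 0 := by
    have h1 := deriv_eval₂ ((derivative' : Derivation k k[X] k[X]).restrictScalars ℂ) D
      (algebraMap k[X] L) hder P u
    rw [← aeval_def, hPu, map_zero, ← aeval_def, ← aeval_def] at h1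
    rw [riccatiDerivation_apply]
    simp only [map_sub, map_mul, map_add, map_pow, aeval_X, aeval_C, hmap]
    rw [hfa (C _), aeval_C, ← IsScalarTower.algebraMap_apply]
    rw [ratEval] at h
    have h2 : (algebraMap ℂ L) (1 / 2) = 1 / 2 := by rw [map_div₀, map_one, map_ofNat]
    rw [h2]
    have h3 : aeval y R.denom * (D u + u ^ 2) + 1 / 2 * aeval y R.num = 0 := by
      field_simp at h ⊢
      linear_combination h
    linear_combination (-aeval y R.denom) * h1 - (aeval u (derivative P)) * h3
  obtain ⟨n, Q, r, hQ, hr⟩ := exists_pow_mul_eq_mul_add P (riccatiDerivation R k P) hdeg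
  have hr0 : r = 0 := by
    refine hmin r ?_ hr
    have := congrArg (aeval u) hQ
    rw [map_mul, hT, mul_zero, map_add, map_mul, hPu, mul_zero, zero_add] at this
    exact this.symm
  rw [hr0, add_zero] at hQ
  exact exists_isAlgebraicRiccatiSolution_of_polynomial R hdeg hQ

end RiccatiDescent

/-! ### The case where y' and y'' are algebraic over K(y) -/

section TranscendenceDegreeOne

variable {L : Type*} [Field L]

/-- A derivation killing a subfield and commuting with a given derivation `θ`. -/
theorem exists_derivation_commuting {k : Type*} [Field k] [CharZero k] [Algebra k L]
    (θ : Derivation k L L) (E : IntermediateField k L) (hE : acl k (E : Set L) ≤ E)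
    (hθE : ∀ x ∈ E, θ x ∈ E) (hspan : ∀ x : L, x ∈ acl k (E ∪ θ.constants : Set L))
    {y : L} (hyE : y ∉ E) (hy : θ y ≠ 0) :
    ∃ η : Derivation k L L, (∀ x ∈ E, η x = 0) ∧ (∀ x, η (θ x) = θ (η x)) ∧ η y ≠ 0 := by
  set M := AlgebraicIndependent.matroid k L with hM
  have hcl : ∀ {S : Set L} {x : L}, x ∈ M.closure S ↔ x ∈ acl k S := by
    intro S x
    rw [← SetLike.mem_coe, coe_acl]
  have hgr : ∀ S : Set L, S ⊆ M.E := fun S => by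
    rw [hM, AlgebraicIndependent.matroid_e]; exact Set.subset_univ S
  obtain ⟨I, hI⟩ := M.exists_isBasis (E : Set L) (hgr _)
  obtain ⟨J, hJ, hIJ⟩ := hI.indep.subset_isBasis_of_subset
    (hI.subset.trans (Set.subset_union_left (t := (θ.constants : Set L)))) (hgr _)
  have hJspan : ∀ x, x ∈ M.closure J := fun x => by
    rw [hJ.closure_eq_closure, hcl]; exact hspan x
  have hyI : y ∉ M.closure I := by
    rw [hI.closure_eq_closure, hcl]
    exact fun h => hyE (hE h)
  have hyJ : y ∉ J := by
    intro h
    rcases hJ.subset h with h | h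
    · exact hyE h
    · exact hy h
  have hindy : M.Indep (insert y I) := by
    rw [hI.indep.insert_indep_iff]
    exact Or.inl ⟨hgr Set.univ trivial, hyI⟩
  obtain ⟨J', hJ', hIJ'⟩ := hindy.subset_isBasis_of_subset
    (Set.insert_subset_insert hIJ) (hgr (insert y J))
  have hJ'span : ∀ x, x ∈ M.closure J' := fun x => by
    rw [hJ'.closure_eq_closure]
    exact M.closure_subset_closure (Set.subset_insert y J) (hJspan x)
  -- Bringing y into the basis expels some b. It is not in I, hence not in E, so it is a constant of
  -- θ. The derivation η will be ∂/∂b for the basis J.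
  have hnot : ¬ J ⊆ J' := by
    intro h
    have hy' : y ∉ M.closure (J' \ {y}) :=
      (hJ'.indep.notMem_closure_sdiff_of_mem (hIJ' (Set.mem_insert y I)))
    exact hy' (M.closure_subset_closure (Set.subset_sdiff_singleton h hyJ) (hJspan y))
  obtain ⟨b, hbJ, hbJ'⟩ := Set.not_subset.1 hnot
  have hbcl : b ∉ M.closure (J \ {b}) := hJ.indep.notMem_closure_sdiff_of_mem hbJ
  have hIS : I ⊆ J \ {b} := Set.subset_sdiff_singleton hIJ
    fun h => hbJ' (hIJ' (Set.mem_insert_of_mem y h))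
  have hES : ∀ x ∈ E, x ∈ M.closure (J \ {b}) := by
    intro x hx
    apply M.closure_subset_closure hIS
    rw [hI.closure_eq_closure, hcl]
    exact subset_acl _ hx
  have hbθ : θ b = 0 := by
    rcases hJ.subset hbJ with h | h
    · exact absurd (hES b h) hbcl
    · exact h
  obtain ⟨η, hη, hηb⟩ := exists_derivation_of_notMem_acl (fun h => hbcl (hcl.2 h))
  have hηE : ∀ x ∈ E, η x = 0 := fun x hx => η.eq_zero_of_mem_acl hη (hcl.1 (hES x hx))
  refine ⟨η, hηE, fun x => ?_, fun hηy => ?_⟩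
  -- It suffices to check J: θ sends J into E, where η vanishes, and η sends J into {0, 1}, where θ
  -- vanishes.
  · have : ⁅η, θ⁆ x = 0 := by
      refine Derivation.eq_zero_of_mem_acl _ (S := J) (fun s hs => ?_) (hcl.1 (hJspan x))
      rw [Derivation.commutator_apply]
      by_cases hsb : s = b
      · rw [hsb, hbθ, hηb]; simp
      · rw [hη s ⟨hs, hsb⟩, map_zero, sub_zero]
        rcases hJ.subset hs with h | h
        · exact hηE _ (hθE s h)
        · rw [Derivation.mem_constants.1 h, map_zero]
    rw [Derivation.commutator_apply] at this
    exact sub_eq_zero.1 this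
  -- Were y killed, η would kill the spanning set J'.
  · have : η b = 0 := by
      refine η.eq_zero_of_mem_acl (S := J') (fun s hs => ?_) (hcl.1 (hJ'span b))
      rcases hJ'.subset hs with rfl | h
      · exact hηy
      · exact hη s ⟨h, fun hsb => hbJ' (hsb ▸ hs)⟩
    rw [hηb] at this
    exact one_ne_zero this

variable [Algebra ℂ L]

theorem exists_derivation_ratEval (R : RatFunc ℂ) {y : L} (hy : R.denom.aeval y ≠ 0) :
    ∃ r : L, ∀ D : Derivation ℂ L L, D (ratEval R y) = r * D y := by
  refine ⟨(R.denom.aeval y * R.num.derivative.aeval y - R.num.aeval y *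
    R.denom.derivative.aeval y) / R.denom.aeval y ^ 2, fun D => ?_⟩
  rw [ratEval, Derivation.leibniz_div, D.map_aeval, D.map_aeval]
  simp only [smul_eq_mul]
  field_simp

theorem Derivation.eq_zero_of_apply_sq [CharZero L] (D : Derivation ℂ L L) {x : L} (h : D (x ^ 2) = 0) :
    D x = 0 := by
  rw [Derivation.leibniz_pow] at h
  by_cases hx : x = 0
  · rw [hx, map_zero]
  · simpa [hx] using h

theorem constants_smul {c : L} (hc : c ≠ 0) (D : Derivation ℂ L L) :
    (c • D).constants = D.constants := by
  ext x
  simp [hc]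

variable [IsAlgClosed L]

/-- If an infinitesimal deformation `η` fixes `{y; θ} + R(y) (θ y)²` and moves `y`, then the
symmetric square of `ψ'' + (R/2) ψ = 0` has an algebraic solution, and so has the Riccati
equation. -/
theorem exists_riccati_of_deformation (R : RatFunc ℂ) (θ η : Derivation ℂ L L)
    (hcomm : ∀ x, η (θ x) = θ (η x)) {y : L} (hden : R.denom.aeval y ≠ 0) (hθ : θ y ≠ 0)
    (hη : η y ≠ 0)
    (hQ : η (θ (θ (θ y) / θ y) - (θ (θ y) / θ y) ^ 2 / 2 + ratEval R y * θ y ^ 2) = 0)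
    (hL : ∀ x : L, x ∈ acl ℂ (insert y (θ.constants : Set L))) :
    ∃ u : AlgFun, IsAlgebraicRiccatiSolution R u := by
  have : CharZero L := charZero_of_injective_algebraMap (algebraMap ℂ L).injective
  obtain ⟨r, hr⟩ := exists_derivation_ratEval R hden
  set ρ := ratEval R y with hρ
  set w := η y with hw
  set z := θ y with hz
  have h1 : η z = θ w := hcomm y
  have h2 : η (θ z) = θ (θ w) := by rw [hcomm, h1]
  have h3 : η (θ (θ z)) = θ (θ (θ w)) := by rw [hcomm, h2]
  set z1 := θ z
  set z2 := θ z1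
  set w1 := θ w
  set w2 := θ w1
  set w3 := θ w2
  have hQ' : (w3 * z - z2 * w1) / z ^ 2 - 3 * (z1 / z) * ((w2 * z - z1 * w1) / z ^ 2) +
      r * w * z ^ 2 + 2 * ρ * z * w1 = 0 := by
    rw [← hQ]
    have e1 : θ (z1 / z) = z2 / z - (z1 / z) ^ 2 := by
      rw [Derivation.leibniz_div]; simp only [smul_eq_mul]; field_simp
      change z * z2 - z1 * z1 = _
      ring
    have e2 : η (z1 / z) = (w2 * z - z1 * w1) / z ^ 2 := by
      rw [Derivation.leibniz_div]; simp only [smul_eq_mul, h1, h2]; field_simp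
    have e3 : η (z2 / z) = (w3 * z - z2 * w1) / z ^ 2 := by
      rw [Derivation.leibniz_div]; simp only [smul_eq_mul, h1, h3]; field_simp
    have e4 : θ (z1 / z) - (z1 / z) ^ 2 / 2 + ρ * z ^ 2 =
      z2 / z - algebraMap ℂ L (3 / 2) * (z1 / z) ^ 2 + ρ * z ^ 2 := by
      rw [e1, map_div₀, map_ofNat, map_ofNat]; ring
    rw [e4]
    simp only [map_add, map_sub, Derivation.leibniz, Derivation.leibniz_pow, Derivation.map_algebraMap, smul_eq_mul,
      e2, e3, h1, hr, nsmul_eq_mul]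
    rw [map_div₀, map_ofNat, map_ofNat]
    push_cast
    ring
  -- This is d/dy. In terms of it the linearization reads w''' + 2Rw' + R'w = 0.
  let D : Derivation ℂ L L := z⁻¹ • θ
  have hD : ∀ x, D x = z⁻¹ * θ x := fun _ => rfl
  have hDc : D.constants = θ.constants := constants_smul (inv_ne_zero hθ) θ
  have hDw : D w = w1 / z := by rw [hD]; field_simp; rfl
  have hDw1 : D (w1 / z) = (w2 * z - w1 * z1) / z ^ 3 := by
    rw [hD, Derivation.leibniz_div]; simp only [smul_eq_mul]; field_simp; rfl
  have hDw2 : D ((w2 * z - w1 * z1) / z ^ 3) = (w3 * z - w1 * z2) / z ^ 4 -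
      3 * z1 * (w2 * z - w1 * z1) / z ^ 5 := by
    rw [hD, Derivation.leibniz_div, map_sub, Derivation.leibniz, Derivation.leibniz,
      Derivation.leibniz_pow]
    simp only [smul_eq_mul, nsmul_eq_mul]
    change z⁻¹ * ((z ^ 3)⁻¹ ^ 2 * ((z ^ 3) * (w2 * z1 + z * w3 - (w1 * z2 + z1 * w2)) -
      (w2 * z - w1 * z1) * (((3 : ℕ) : L) * (z ^ (3 - 1) * z1)))) = _
    push_cast
    field_simp
    ring
  have hDρ : D ρ = r := by rw [hr, hD, ← hz, inv_mul_cancel₀ hθ, mul_one]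
  set wy := w1 / z with hwy
  set wyy := (w2 * z - w1 * z1) / z ^ 3 with hwyy
  -- If w = ψ₁ψ₂ with both factors solving ψ'' = -(R/2)ψ, this is the square of the Wronskian, hence
  -- a first integral. With l a square root of it, (w' + l)/(2w) plays the role of ψ₁'/ψ₁.
  set k0 := -2 * (w * wyy) + wy ^ 2 - 2 * (ρ * w ^ 2) with hk0
  have hDk0 : D k0 = 0 := by
    have e : k0 = algebraMap ℂ L (-2) * (w * wyy) + wy ^ 2 - algebraMap ℂ L 2 * (ρ * w ^ 2) := by
      rw [map_neg, map_ofNat]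
    rw [e]
    simp only [map_add, map_sub, Derivation.leibniz, Derivation.leibniz_pow,
      Derivation.map_algebraMap, smul_eq_mul, nsmul_eq_mul, hDw, hDw1, hDw2, hDρ]
    rw [map_neg, map_ofNat]
    have hQ'' : (w3 * z - w1 * z2) / z ^ 4 - 3 * z1 * (w2 * z - w1 * z1) / z ^ 5 + r * w +
        2 * ρ * wy = 0 := by
      have : z ^ 2 * ((w3 * z - w1 * z2) / z ^ 4 - 3 * z1 * (w2 * z - w1 * z1) / z ^ 5 + r * w +
        2 * ρ * wy) = 0 := by
        rw [← hQ', hwy]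
        field_simp
      simpa [hθ] using this
    push_cast
    linear_combination (-2 * w) * hQ''
  obtain ⟨l, hl⟩ := IsAlgClosed.exists_pow_nat_eq k0 (n := 2) (by norm_num)
  have hDl : D l = 0 := D.eq_zero_of_apply_sq (by rw [hl, hDk0])
  have hDy : D y = 1 := by rw [hD, ← hz, inv_mul_cancel₀ hθ]
  refine exists_isAlgebraicRiccatiSolution R D (u := (wy + l) / (2 * w)) hDy
    (by rw [hDc]; exact hL _) ?_
  have e5 : D (2 * w) = 2 * wy := by
    rw [← map_ofNat (algebraMap ℂ L) 2, Derivation.leibniz, Derivation.map_algebraMap, hDw]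
    simp
  rw [Derivation.leibniz_div, map_add, hDw1, hDl, e5, ← hρ]
  simp only [smul_eq_mul]
  rw [hk0] at hl
  field_simp
  linear_combination hl

/-- The case of transcendence degree one over the constants of `∂`. -/
theorem exists_riccati_of_commutator (R : RatFunc ℂ) (Δ D : Derivation ℂ L L) {y v u : L}
    (hden : R.denom.aeval y ≠ 0) (hv : v ≠ 0) (hΔy : Δ y = v) (hΔv : Δ v = 2 * u * v ^ 2)
    (hΔu : Δ u = -v * (u ^ 2 + 1 / 2 * ratEval R y)) (hDy : D y = 1)
    (hcomm : ∀ x, Δ (D x) = D (Δ x) - D v * D x)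
    (hL : ∀ x : L, x ∈ acl ℂ (insert y (D.constants : Set L))) :
    ∃ u : AlgFun, IsAlgebraicRiccatiSolution R u := by
  have : CharZero L := charZero_of_injective_algebraMap (algebraMap ℂ L).injective
  obtain ⟨r, hr⟩ := exists_derivation_ratEval R hden
  set ρ := ratEval R y with hρ
  have hDer2 : ∀ (D' : Derivation ℂ L L) (x : L), D' (2 * x) = 2 * D' x := by
    intro D' x
    rw [← map_ofNat (algebraMap ℂ L) 2, Derivation.leibniz, Derivation.map_algebraMap]
    simp
  have hDer12 : ∀ (D' : Derivation ℂ L L) (x : L), D' (1 / 2 * x) = 1 / 2 * D' x := by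
    intro D' x
    have := hDer2 D' (1 / 2 * x)
    rw [show 2 * (1 / 2 * x) = x by ring] at this
    rw [this]; ring
  -- The defect of u in the Riccati equation.
  set e := D u + u ^ 2 + 1 / 2 * ρ with he
  by_cases he0 : e = 0
  · exact exists_isAlgebraicRiccatiSolution R D hDy (hL u) he0
  -- Δc = -(Dv)c carries the same factor as the commutator, so c⁻¹D commutes with Δ.
  set c := v * e with hc
  have hc0 : c ≠ 0 := mul_ne_zero hv he0
  have hDu : D u = c / v - u ^ 2 - 1 / 2 * ρ := by
    rw [hc, mul_div_cancel_left₀ _ hv, he]; ring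
  have hΔDv : Δ (D v) = 2 * D u * v ^ 2 + 4 * u * v * D v - D v ^ 2 := by
    rw [hcomm, hΔv]
    rw [show 2 * u * v ^ 2 = 2 * (u * v ^ 2) by ring, hDer2, Derivation.leibniz,
      Derivation.leibniz_pow]
    simp only [smul_eq_mul, nsmul_eq_mul]
    push_cast
    ring
  have hΔe : Δ e = -D v * e - 2 * u * v * e := by
    have : Δ (D u) = -D v * (u ^ 2 + 1 / 2 * ρ) - v * (2 * u * D u + 1 / 2 * r) - D v * D u := by
      rw [hcomm, hΔu, Derivation.leibniz, map_add, hDer12, hr, Derivation.leibniz_pow, hDy, map_neg]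
      simp only [smul_eq_mul, nsmul_eq_mul]
      push_cast
      ring
    rw [he, map_add, map_add, this, Derivation.leibniz_pow, hDer12, hr, hΔu, hΔy]
    simp only [smul_eq_mul, nsmul_eq_mul]
    push_cast
    ring
  have hΔc : Δ c = -D v * c := by
    rw [hc, Derivation.leibniz, hΔe, hΔv]
    simp only [smul_eq_mul]
    ring
  -- Coordinates that straighten Δ: Δt = 1 and Δa = 2t, so q = t² - a is a constant of Δ.
  set t := (D v - 2 * u * v) / (2 * v * c) with ht
  set a := 1 / (v * c) with ha
  have ha0 : a ≠ 0 := one_div_ne_zero (mul_ne_zero hv hc0)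
  have hDv : D v = 2 * u * v + 2 * t * v * c := by rw [ht]; field_simp; ring
  have hΔvc : Δ (v * c) = -(2 * t) * (v * c) ^ 2 := by
    rw [Derivation.leibniz, hΔc, hΔv, hDv]
    simp only [smul_eq_mul]
    ring
  have hΔt : Δ t = 1 := by
    have e1 : Δ (D v - 2 * u * v) = 2 * v * c - (2 * t * (v * c)) ^ 2 := by
      rw [map_sub, hΔDv, show 2 * u * v = 2 * (u * v) by ring, hDer2, Derivation.leibniz, hΔu, hΔv,
        hDu]
      simp only [smul_eq_mul]
      rw [hDv]
      field_simp
      ring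
    have e2 : D v - 2 * u * v = 2 * t * (v * c) := by rw [hDv]; ring
    rw [ht, Derivation.leibniz_div, e1, e2, mul_assoc 2 v c, hDer2, hΔvc]
    simp only [smul_eq_mul]
    field_simp
    ring
  have hΔa : Δ a = 2 * t := by
    rw [ha, one_div, Derivation.leibniz_inv, hΔvc]
    simp only [smul_eq_mul]
    field_simp
  set q := t ^ 2 - a with hq
  have hΔq : Δ q = 0 := by
    rw [hq, map_sub, Derivation.leibniz_pow, hΔt, hΔa]
    simp
  have haq : a = t ^ 2 - q := by rw [hq]; ring
  -- Here c = 1/((t² - q)v) with t and q constant for D, and u can be corrected to a Riccati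
  -- solution explicitly, using a square root s of q.
  by_cases hcase : D t = 0 ∧ D q = 0
  · obtain ⟨hDt, hDq⟩ := hcase
    obtain ⟨s, hs⟩ := IsAlgClosed.exists_pow_nat_eq q (n := 2) (by norm_num)
    have hDs : D s = 0 := D.eq_zero_of_apply_sq (by rw [hs, hDq])
    have hΔs : Δ s = 0 := Δ.eq_zero_of_apply_sq (by rw [hs, hΔq])
    have hn : t - s ≠ 0 := by
      intro h0
      have := congrArg Δ h0
      rw [map_sub, hΔt, hΔs, map_zero, sub_zero] at this
      exact one_ne_zero this
    have hn' : t + s ≠ 0 := by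
      intro h0
      have := congrArg Δ h0
      rw [map_add, hΔt, hΔs, map_zero, add_zero] at this
      exact one_ne_zero this
    refine exists_isAlgebraicRiccatiSolution R D (u := u + 1 / ((t - s) * v)) hDy (hL _) ?_
    rw [map_add, one_div, Derivation.leibniz_inv, Derivation.leibniz, map_sub, hDt, hDs, hDu, hDv,
      ← hρ]
    simp only [smul_eq_mul]
    have hcv : c = 1 / ((t - s) * (t + s) * v) := by
      have : (t - s) * (t + s) = a := by rw [haq, ← hs]; ring
      rw [this, ha]; field_simp
    rw [hcv]
    field_simp
    ring
  let θ : Derivation ℂ L L := c⁻¹ • D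
  have hθ : ∀ x, θ x = c⁻¹ * D x := fun _ => rfl
  have hθc : θ.constants = D.constants := constants_smul (inv_ne_zero hc0) D
  have hθΔ : ∀ x, Δ (θ x) = θ (Δ x) := by
    intro x
    rw [hθ, hθ, Derivation.leibniz, Derivation.leibniz_inv, hΔc, hcomm]
    simp only [smul_eq_mul]
    field_simp
    ring
  set E := acl ℂ (insert t (Δ.constants : Set L)) with hE
  have hEE : acl ℂ (E : Set L) ≤ E := acl_le le_rfl
  have htE : t ∈ E := subset_acl _ (Set.mem_insert _ _)
  have hCE : ∀ x, Δ x = 0 → x ∈ E := fun x hx => subset_acl _ (Set.mem_insert_of_mem _ hx)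
  have hqE : q ∈ E := hCE q hΔq
  have hθE : ∀ x ∈ E, θ x ∈ E := by
    intro x hx
    refine θ.apply_mem_acl (subset_acl _) ?_ hx
    rintro s (rfl | hs)
    · exact hCE _ (by rw [hθΔ, hΔt, Derivation.map_one_eq_zero])
    · exact hCE _ (by rw [hθΔ, Derivation.mem_constants.1 hs, map_zero])
  -- If y ∈ E, exchanging t for y makes u algebraic over y and the constants of Δ. Then v⁻¹Δ serves
  -- as d/dy, and u satisfies the Riccati equation for it.
  by_cases hyE : y ∈ E
  · have hΔE : ∀ x ∈ E, Δ x ∈ E := by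
      intro x hx
      refine Δ.apply_mem_acl (subset_acl _) ?_ hx
      rintro s (rfl | hs)
      · rw [hΔt]; exact one_mem _
      · rw [Derivation.mem_constants.1 hs]; exact zero_mem _
    have hvE : v ∈ E := hΔy ▸ hΔE y hyE
    have huE : u ∈ E := by
      have : u = Δ v / (2 * v ^ 2) := by rw [hΔv]; field_simp
      rw [this]
      exact div_mem (hΔE v hvE) (mul_mem (ofNat_mem _ _) (pow_mem hvE 2))
    have hynot : y ∉ acl ℂ (Δ.constants : Set L) := fun h => hv (by
      rw [← hΔy]; exact Δ.eq_zero_of_mem_acl (fun s hs => hs) h)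
    have ht' := acl_exchange hyE hynot
    have hle : E ≤ acl ℂ (insert y (Δ.constants : Set L)) := by
      refine acl_le (Set.insert_subset ht' ((Set.subset_insert _ _).trans (subset_acl _)))
    refine exists_isAlgebraicRiccatiSolution R (v⁻¹ • Δ) (y := y) (u := u) ?_ ?_ ?_
    · simp [hΔy, hv]
    · rw [constants_smul (inv_ne_zero hv)]
      exact hle huE
    · rw [Derivation.smul_apply, hΔu, smul_eq_mul]
      field_simp
      ring
  · have hyθ : θ y ≠ 0 := by rw [hθ, hDy, mul_one]; exact inv_ne_zero hc0
    -- One of t, q is moved by D, so it can replace y as a generator of L over the constants.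
    have hspan : ∀ x : L, x ∈ acl ℂ (E ∪ θ.constants : Set L) := by
      obtain ⟨t₀, ht₀E, ht₀⟩ : ∃ t₀ ∈ E, D t₀ ≠ 0 := by
        by_cases h : D t = 0
        · exact ⟨q, hqE, fun h' => hcase ⟨h, h'⟩⟩
        · exact ⟨t, htE, h⟩
      have h1 := acl_exchange (hL t₀) (fun h => ht₀ (D.eq_zero_of_mem_acl (fun s hs => hs) h))
      intro x
      refine acl_le ?_ (hL x)
      rw [hθc]
      have h2 : insert t₀ (D.constants : Set L) ⊆ (E ∪ D.constants : Set L) :=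
        Set.insert_subset (Or.inl ht₀E) Set.subset_union_right
      refine Set.insert_subset (acl_mono h2 h1)
        (Set.subset_union_right.trans (subset_acl _))
    obtain ⟨η, hηE, hηθ, hηy⟩ := exists_derivation_commuting θ E hEE hθE hspan hyE hyθ
    refine exists_riccati_of_deformation R θ η hηθ hden hyθ hηy ?_ (by rw [hθc]; exact hL)
    apply hηE
    have hθy : θ y = a * v := by rw [hθ, hDy, ha]; field_simp
    have hθv : θ v = 2 * a * u * v ^ 2 + 2 * t * v := by
      rw [hθ, hDv, ha]; field_simp
    have hθu : θ u = -a * v * (u ^ 2 + 1 / 2 * ρ) + 1 / v := by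
      rw [hθ, hDu, ha]; field_simp; ring
    set l := θ a / a with hl
    have haE : a ∈ E := haq ▸ sub_mem (pow_mem htE 2) hqE
    have hlE : l ∈ E := div_mem (hθE a haE) haE
    have hθa : θ a = l * a := by rw [hl]; field_simp
    have hW : θ (θ y) / θ y = l + 2 * (a * (u * v)) + 2 * t := by
      rw [hθy, Derivation.leibniz, hθv, hθa]
      simp only [smul_eq_mul]
      field_simp
      ring
    have hθt : θ a = 2 * t * θ t - θ q := by
      rw [haq, map_sub, Derivation.leibniz_pow]
      simp only [smul_eq_mul, nsmul_eq_mul]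
      push_cast
      ring
    rw [← hρ, hW]
    -- All terms in y, u, v cancel: the Schwarzian expression of y along θ lies in E and is killed
    -- by η.
    have hfin : θ (l + 2 * (a * (u * v)) + 2 * t) - (l + 2 * (a * (u * v)) + 2 * t) ^ 2 / 2 +
        ρ * θ y ^ 2 = -2 * q + 2 * θ t - 2 * t * l + θ l - l ^ 2 / 2 := by
      rw [map_add, map_add, hDer2, hDer2, Derivation.leibniz, Derivation.leibniz, hθu, hθv, hθa, hθy]
      simp only [smul_eq_mul]
      rw [hq]
      field_simp
      ring
    rw [hfin]
    have h2 : (2 : L) ∈ E := ofNat_mem _ _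
    exact sub_mem (add_mem (sub_mem (add_mem (mul_mem (neg_mem h2) hqE) (mul_mem h2 (hθE t htE)))
      (mul_mem (mul_mem h2 htE) hlE)) (hθE l hlE)) (div_mem (pow_mem hlE 2) h2)

end TranscendenceDegreeOne

/-! ### Pole comparison for the Riccati vector field on polynomials in two variables -/

section HigherTranscendenceDegree

open Polynomial

theorem Polynomial.exists_irreducible_dvd_natDegree_pos {A : Type*} [CommRing A] [IsDomain A]
    [UniqueFactorizationMonoid A] {B : A[X]} (hB : 0 < B.natDegree) :
    ∃ p : A[X], Irreducible p ∧ p ∣ B ∧ 0 < p.natDegree := by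
  have hB0 : B ≠ 0 := by rintro rfl; simp at hB
  obtain ⟨s, hs, c, hc⟩ := WfDvdMonoid.exists_factors B hB0
  by_contra! hcon
  have h0 : s.prod.natDegree = 0 := by
    rw [natDegree_multiset_prod _ (fun h => (hs 0 h).ne_zero rfl), Multiset.sum_eq_zero_iff]
    intro n hn
    obtain ⟨p, hp, rfl⟩ := Multiset.mem_map.1 hn
    exact Nat.le_zero.1 (hcon p (hs p hp) ((Multiset.dvd_prod hp).trans ⟨c, hc.symm⟩))
  have hs0 : s.prod ≠ 0 := fun h => hB0 (by rw [← hc, h, zero_mul])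
  rw [← hc, natDegree_mul hs0 c.ne_zero, h0, natDegree_coe_units] at hB
  exact lt_irrefl _ hB

variable {L : Type*} [Field L] [Algebra ℂ L]

/-- Only the term -qU²∂_U raises the degree in U; its contribution governs the behaviour at U = ∞.
-/
theorem coeff_riccatiDerivation_natDegree_succ (R : RatFunc ℂ) {A : Type*} [CommRing A]
    [Algebra ℂ A] (P : A[X][X]) {n : ℕ} (hn : P.natDegree ≤ n) :
    (riccatiDerivation R A P).coeff (n + 1) =
      -((n : A[X]) * R.denom.map (algebraMap ℂ A) * P.coeff n) := by
  have h1 : P.coeff (n + 1) = 0 := coeff_eq_zero_of_natDegree_lt (by omega)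
  have h2 : P.coeff (n + 2) = 0 := coeff_eq_zero_of_natDegree_lt (by omega)
  rw [riccatiDerivation_apply, coeff_sub, coeff_C_mul, coeff_mapDeriv, h1, map_zero, mul_zero,
    zero_sub, add_mul, coeff_add, coeff_C_mul, coeff_derivative, h2, zero_mul, mul_zero, add_zero,
    mul_assoc, coeff_C_mul, coeff_X_pow_mul']
  rcases n with _ | n
  · simp
  · rw [if_pos (by omega), show n + 1 + 1 - 2 = n by omega, coeff_derivative]
    push_cast
    ring

/-- The polynomial identity expressing `∂g - 2jUg = δh/h` for `g = A/B`, `h = P/Q`, with `∂` the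
Riccati derivation and `δ` a derivation of the coefficients, forces `A = 0`. -/
theorem eq_zero_of_riccati_identity (R : RatFunc ℂ)
    (hR : ¬ ∃ u : AlgFun, IsAlgebraicRiccatiSolution R u) {k : Type*} [Field k] [Algebra ℂ k]
    (δ : Derivation ℂ k[X] k[X]) {j : ℕ} (hj : 0 < j) {A B P Q : k[X][X]}
    (hB : B ≠ 0) (hP : P ≠ 0) (hQ : Q ≠ 0)
    (hcop : ∀ p, Irreducible p → 0 < p.natDegree → p ∣ B → ¬ p ∣ A)
    (h : (riccatiDerivation R k A * B - A * riccatiDerivation R k B -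
        2 * (j : k[X][X]) * C (R.denom.map (algebraMap ℂ k)) * X * A * B) * (P * Q) =
      C (R.denom.map (algebraMap ℂ k)) * B ^ 2 * (mapDeriv δ P * Q - P * mapDeriv δ Q)) :
    A = 0 := by
  have hchar : CharZero k := charZero_of_injective_algebraMap (algebraMap ℂ k).injective
  set Γ := riccatiDerivation R k with hΓ
  set q := R.denom.map (algebraMap ℂ k) with hq
  have hq0 : q ≠ 0 := (Polynomial.map_ne_zero_iff (algebraMap ℂ k).injective).2 R.denom_ne_zero
  -- If g has a pole of order r ≥ 1 along p, then ∂g has one of order r + 1 ≥ 2 because p is not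
  -- invariant, while a logarithmic derivative has at most a simple pole. The identity `hmain` below
  -- is this comparison with powers of p cleared.
  have hBdeg : B.natDegree = 0 := by
    by_contra hB0
    obtain ⟨p, hp, hpB, hpdeg⟩ := exists_irreducible_dvd_natDegree_pos (Nat.pos_of_ne_zero hB0)
    have hpp : Prime p := hp.prime
    have hpΓ : ¬ p ∣ Γ p := by
      rintro ⟨c, hc⟩
      refine hR (exists_isAlgebraicRiccatiSolution_of_polynomial R (P := p) (Q := c) (n := 0) hpdeg ?_)
      rw [pow_zero, C_1, one_mul, ← hΓ, hc, mul_comm]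
    have hpA := hcop p hp hpdeg hpB
    have hfin : ∀ T : k[X][X], T ≠ 0 → FiniteMultiplicity p T := fun T hT =>
      FiniteMultiplicity.of_not_isUnit hp.not_isUnit hT
    obtain ⟨B₁, hB₁, hpB₁⟩ := (hfin B hB).exists_eq_pow_mul_and_not_dvd
    obtain ⟨P₁, hP₁, hpP₁⟩ := (hfin P hP).exists_eq_pow_mul_and_not_dvd
    obtain ⟨Q₁, hQ₁, hpQ₁⟩ := (hfin Q hQ).exists_eq_pow_mul_and_not_dvd
    set r := multiplicity p B with hr
    set m := multiplicity p P
    set n := multiplicity p Q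
    have hr0 : r ≠ 0 := by
      intro h0
      rw [h0, pow_zero, one_mul] at hB₁
      exact hpB₁ (hB₁ ▸ hpB)
    have hpow : ∀ (D : Derivation ℂ k[X][X] k[X][X]) (s : ℕ) (T : k[X][X]),
        p * D (p ^ s * T) = p ^ s * ((s : k[X][X]) * D p * T + p * D T) := by
      intro D s T
      rw [Derivation.leibniz, Derivation.leibniz_pow]
      rcases s with _ | s
      · simp
      · simp only [smul_eq_mul, nsmul_eq_mul, Nat.add_sub_cancel, pow_succ]
        ring
    have eB := hpow Γ r B₁
    have eP := hpow (mapDeriv δ) m P₁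
    have eQ := hpow (mapDeriv δ) n Q₁
    rw [← hB₁] at eB
    rw [← hP₁] at eP
    rw [← hQ₁] at eQ
    have hmain : p ^ (r + m + n) * ((p * (Γ A * B₁ - A * Γ B₁ -
        2 * (j : k[X][X]) * C q * X * A * B₁) - (r : k[X][X]) * A * Γ p * B₁) * (P₁ * Q₁)) =
        p ^ (r + m + n) * (p ^ r * (C q * B₁ ^ 2 * (((m : k[X][X]) * mapDeriv δ p * P₁ +
          p * mapDeriv δ P₁) * Q₁ - P₁ * ((n : k[X][X]) * mapDeriv δ p * Q₁ + p * mapDeriv δ Q₁)))) := by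
      have h' := congrArg (p * ·) h
      have e1 : p * ((Γ A * B - A * Γ B - 2 * (j : k[X][X]) * C q * X * A * B) * (P * Q)) =
          (p * Γ A * B - A * (p * Γ B) - p * (2 * (j : k[X][X]) * C q * X * A * B)) * (P * Q) := by
        ring
      have e2 : p * (C q * B ^ 2 * (mapDeriv δ P * Q - P * mapDeriv δ Q)) =
          C q * B ^ 2 * ((p * mapDeriv δ P) * Q - P * (p * mapDeriv δ Q)) := by ring
      rw [e1, e2, eB, eP, eQ] at h'
      rw [hB₁, hP₁, hQ₁] at h'
      rw [pow_add, pow_add]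
      linear_combination h'
    have hmain' := mul_left_cancel₀ (pow_ne_zero _ hp.ne_zero) hmain
    have hdvd : p ∣ (p * (Γ A * B₁ - A * Γ B₁ - 2 * (j : k[X][X]) * C q * X * A * B₁) -
        (r : k[X][X]) * A * Γ p * B₁) * (P₁ * Q₁) := by
      rw [hmain']
      exact (dvd_pow_self p hr0).mul_right _
    have hrunit : IsUnit (r : k[X][X]) := by
      rw [← map_natCast (C : k[X] →+* k[X][X]), ← map_natCast (C : k →+* k[X])]
      exact ((IsUnit.mk0 _ (Nat.cast_ne_zero.2 hr0)).map C).map C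
    rcases hpp.dvd_or_dvd hdvd with h1 | h1
    · rw [dvd_sub_right (dvd_mul_right p _)] at h1
      rcases hpp.dvd_or_dvd h1 with h1 | h1
      · rcases hpp.dvd_or_dvd h1 with h1 | h1
        · rcases hpp.dvd_or_dvd h1 with h1 | h1
          · exact hp.not_isUnit (isUnit_of_dvd_unit h1 hrunit)
          · exact hpA h1
        · exact hpΓ h1
      · exact hpB₁ h1
    · rcases hpp.dvd_or_dvd h1 with h1 | h1
      · exact hpP₁ h1
      · exact hpQ₁ h1
  -- Now g is polynomial in U, of degree n. The left side has degree n + 1, its top coefficient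
  -- being a nonzero multiple of n + 2j, whereas δh/h has degree at most 0.
  by_contra hA
  obtain ⟨b, rfl⟩ := natDegree_eq_zero.1 hBdeg
  have hb : b ≠ 0 := by rintro rfl; simp at hB
  set n := A.natDegree with hn
  set Z := Γ A * C b - A * Γ (C b) - 2 * (j : k[X][X]) * C q * X * A * C b with hZ
  have hΓb : Γ (C b) = C (q * derivative b) := by
    rw [hΓ, riccatiDerivation_apply, mapDeriv_C, derivative_C, mul_zero, sub_zero, C_mul]
    rfl
  have hZc : Z.coeff (n + 1) = -((n + 2 * j : ℕ) * q * A.leadingCoeff * b) := by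
    have e3 : 2 * (j : k[X][X]) * C q * X * A * C b = C (2 * (j : k[X]) * q * b) * (X * A) := by
      simp only [C_mul, map_natCast, map_ofNat]
      ring
    rw [hZ, hΓb, e3, coeff_sub, coeff_sub, coeff_mul_C, coeff_mul_C, coeff_C_mul, coeff_X_mul,
      coeff_riccatiDerivation_natDegree_succ R A le_rfl,
      coeff_eq_zero_of_natDegree_lt (p := A) (n := n + 1) (by omega), leadingCoeff]
    push_cast
    ring
  have hZ0 : Z.coeff (n + 1) ≠ 0 := by
    rw [hZc, neg_ne_zero]
    refine mul_ne_zero (mul_ne_zero (mul_ne_zero ?_ hq0) (leadingCoeff_ne_zero.2 hA)) hb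
    exact Nat.cast_ne_zero.2 (by omega)
  have hZdeg : n + 1 ≤ Z.natDegree := le_natDegree_of_ne_zero hZ0
  have hZne : Z ≠ 0 := by
    intro h0
    rw [h0, coeff_zero] at hZ0
    exact hZ0 rfl
  have hdeg := congrArg natDegree h
  rw [natDegree_mul hZne (mul_ne_zero hP hQ), natDegree_mul hP hQ] at hdeg
  have hle : (C q * C b ^ 2 * (mapDeriv δ P * Q - P * mapDeriv δ Q)).natDegree ≤
      P.natDegree + Q.natDegree := by
    rw [← C_pow, ← C_mul]
    refine (natDegree_C_mul_le _ _).trans ((natDegree_sub_le _ _).trans (max_le ?_ ?_))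
    · exact natDegree_mul_le.trans (add_le_add_left (natDegree_mapDeriv_le δ P) _)
    · exact natDegree_mul_le.trans (add_le_add_right (natDegree_mapDeriv_le δ Q) _)
  omega

end HigherTranscendenceDegree

/-! ### Algebraic dependence of u over K(y) and of v over K(y, u) -/

section HigherTranscendenceDegree

open Polynomial

variable {L : Type*} [Field L]

theorem transcendental_of_notMem_acl {k : Type*} [Field k] [Algebra k L] {S : Set L}
    {E : IntermediateField k L} (hE : E ≤ acl k S) {x : L} (hx : x ∉ acl k S) :
    Transcendental E x :=
  fun h => hx (mem_acl_of_isAlgebraic hE h)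

theorem le_acl {k : Type*} [Field k] [Algebra k L] (K : IntermediateField k L) :
    K ≤ acl k (K : Set L) := subset_acl (K : Set L)

variable [Algebra ℂ L]

/-- Evaluation of polynomials over `K` in two variables at `(y, u)`. -/
noncomputable def evalPair (K : IntermediateField ℂ L) (y u : L) : K[X][X] →+* L :=
  eval₂RingHom (aeval y : K[X] →ₐ[K] L).toRingHom u

theorem evalPair_C (K : IntermediateField ℂ L) (y u : L) (a : K[X]) :
    evalPair K y u (C a) = aeval y a := by
  simp [evalPair]

theorem evalPair_X (K : IntermediateField ℂ L) (y u : L) : evalPair K y u X = u := by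
  simp [evalPair]

theorem evalPair_injective (K : IntermediateField ℂ L) {y u : L} (hy : y ∉ acl ℂ (K : Set L))
    (hu : u ∉ acl ℂ (insert y (K : Set L))) : Function.Injective (evalPair K y u) := by
  rw [injective_iff_map_eq_zero]
  intro P hP
  set E := acl ℂ (insert y (K : Set L))
  have hyK : Transcendental K y := transcendental_of_notMem_acl (le_acl K) hy
  have huE : Transcendental E u := transcendental_of_notMem_acl le_rfl hu
  have hKE : K ≤ E := (le_acl K).trans (acl_mono (Set.subset_insert _ _))
  let y' : E := ⟨y, subset_acl _ (Set.mem_insert _ _)⟩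
  let g : K[X] →+* E := eval₂RingHom (IntermediateField.inclusion hKE).toRingHom y'
  have hg : ∀ a, (g a : L) = aeval y a := by
    intro a
    change algebraMap E L (eval₂ _ _ a) = _
    rw [hom_eval₂]
    rfl
  have hginj : Function.Injective g := by
    intro a b hab
    exact transcendental_iff_injective.1 hyK (by rw [← hg, ← hg, hab])
  have h1 : aeval u (P.map g) = 0 := by
    rw [← hP, aeval_def, eval₂_map]
    change _ = eval₂ _ u P
    congr 1
    ext a
    · exact (hg (C a))
    · exact (hg X)
  exact (Polynomial.map_eq_zero_iff hginj).1 (transcendental_iff.1 huE _ h1)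

theorem exists_evalPair_eq_div (K : IntermediateField ℂ L) {y u x : L}
    (hx : x ∈ IntermediateField.adjoin ℂ (insert u (insert y (K : Set L)))) :
    ∃ A B : K[X][X], evalPair K y u B ≠ 0 ∧ x = evalPair K y u A / evalPair K y u B := by
  have hr : ∀ r ∈ Algebra.adjoin ℂ (insert u (insert y (K : Set L))), ∃ A, evalPair K y u A = r := by
    intro r hr
    induction hr using Algebra.adjoin_induction with
    | mem z hz =>
      rcases hz with rfl | rfl | hz
      · exact ⟨X, evalPair_X K y z⟩
      · exact ⟨C X, by rw [evalPair_C, aeval_X]⟩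
      · exact ⟨C (C ⟨z, hz⟩), by rw [evalPair_C, aeval_C]; rfl⟩
    | algebraMap c => exact ⟨C (C (algebraMap ℂ K c)), by rw [evalPair_C, aeval_C]; rfl⟩
    | add a b _ _ ha hb =>
      obtain ⟨A, rfl⟩ := ha
      obtain ⟨B, rfl⟩ := hb
      exact ⟨A + B, map_add _ _ _⟩
    | mul a b _ _ ha hb =>
      obtain ⟨A, rfl⟩ := ha
      obtain ⟨B, rfl⟩ := hb
      exact ⟨A * B, map_mul _ _ _⟩
  rw [IntermediateField.mem_adjoin_iff_div] at hx
  obtain ⟨r, hr1, s, hs, rfl⟩ := hx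
  obtain ⟨A, rfl⟩ := hr r hr1
  obtain ⟨B, rfl⟩ := hr s hs
  by_cases hB : evalPair K y u B = 0
  · exact ⟨0, 1, by simp, by simp [hB]⟩
  · exact ⟨A, B, hB, rfl⟩

/-- The identity `∂g - 2jug = δh/h` in the field `K(y, u)` forces `g = 0`. -/
theorem eq_zero_of_riccati_eq (R : RatFunc ℂ) (hR : ¬ ∃ u : AlgFun, IsAlgebraicRiccatiSolution R u)
    (K : IntermediateField ℂ L) {y u : L} (hy : y ∉ acl ℂ (K : Set L))
    (hu : u ∉ acl ℂ (insert y (K : Set L))) (D δ : Derivation ℂ L L)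
    (hDK : ∀ x ∈ K, D x = 0) (hDy : D y = 1) (hDu : D u = -(u ^ 2 + 1 / 2 * ratEval R y))
    (hδK : ∀ x ∈ K, δ x ∈ K) (hδy : δ y = 0) (hδu : δ u = 0) {j : ℕ} (hj : 0 < j) {g h : L}
    (hg : g ∈ IntermediateField.adjoin ℂ (insert u (insert y (K : Set L))))
    (hh : h ∈ IntermediateField.adjoin ℂ (insert u (insert y (K : Set L)))) (hh0 : h ≠ 0)
    (heq : D g - 2 * j * u * g = δ h / h) : g = 0 := by
  classical
  set ev := evalPair K y u with hev
  have hinj := evalPair_injective K hy hu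
  have hyK : Transcendental K y := transcendental_of_notMem_acl (le_acl K) hy
  have hyC : Transcendental ℂ y := hyK.restrictScalars (algebraMap ℂ K).injective
  have hd : aeval y R.denom ≠ 0 := fun h0 => R.denom_ne_zero ((transcendental_iff.1 hyC) _ h0)
  let δK := mapDeriv (δ.restrictField K hδK)
  have hδev : ∀ P, ev (mapDeriv δK P) = δ (ev P) := by
    intro P
    have h1 : ∀ a : K[X], δ ((aeval y : K[X] →ₐ[K] L).toRingHom a) =
        (aeval y : K[X] →ₐ[K] L).toRingHom (δK a) := by
      intro a
      have := deriv_eval₂ (δ.restrictField K hδK) δ (algebraMap K L) (fun c => rfl) a y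
      rw [hδy, mul_zero, add_zero] at this
      exact this
    have := deriv_eval₂ δK δ _ h1 P u
    rw [hδu, mul_zero, add_zero] at this
    exact this.symm
  have hmap : ∀ p : ℂ[X], aeval y (p.map (algebraMap ℂ K)) = aeval y p := fun p =>
    aeval_map_algebraMap _ _ _
  have hDev : ∀ P, ev (riccatiDerivation R K P) = aeval y R.denom * D (ev P) := by
    intro P
    have h1 : ∀ a : K[X], D ((aeval y : K[X] →ₐ[K] L).toRingHom a) =
        (aeval y : K[X] →ₐ[K] L).toRingHom
          (((derivative' : Derivation K K[X] K[X]).restrictScalars ℂ) a) := by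
      intro a
      have h0 : mapDeriv (0 : Derivation ℂ K K) a = 0 := by
        ext n
        simp
      have := deriv_eval₂ (0 : Derivation ℂ K K) D (algebraMap K L)
        (fun c => by rw [Derivation.zero_apply, map_zero]; exact hDK _ c.2) a y
      rw [h0, hDy, mul_one, eval₂_zero, zero_add] at this
      exact this
    have := deriv_eval₂ ((derivative' : Derivation K K[X] K[X]).restrictScalars ℂ) D _ h1 P u
    change D (ev P) = ev _ + ev _ * _ at this
    rw [this, riccatiDerivation_apply, hDu]
    simp only [map_sub, map_mul, map_add, map_pow, hev, evalPair_X, evalPair_C, hmap]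
    rw [aeval_C, ← IsScalarTower.algebraMap_apply, ratEval, map_div₀, map_one, map_ofNat]
    field_simp
    ring
  obtain ⟨P, Q, hQ, rfl⟩ := exists_evalPair_eq_div K hh
  have hP : ev P ≠ 0 := fun h0 => hh0 (by rw [← hev, h0, zero_div])
  -- A denominator of least degree replaces lowest terms: a common factor of positive degree could
  -- be cancelled.
  have hex : ∃ n, ∃ A B : K[X][X], ev B ≠ 0 ∧ g = ev A / ev B ∧ B.natDegree = n := by
    obtain ⟨A, B, hB, hAB⟩ := exists_evalPair_eq_div K hg
    exact ⟨_, A, B, hB, hAB, rfl⟩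
  obtain ⟨A, B, hB, hAB, hBn⟩ := Nat.find_spec hex
  have hne : ∀ {T : K[X][X]}, ev T ≠ 0 → T ≠ 0 := by
    rintro T hT rfl
    exact hT (map_zero _)
  have hA : A = 0 := by
    refine eq_zero_of_riccati_identity R hR δK hj (hne hB) (hne hP) (hne hQ) ?_ ?_
    · rintro p hp hpdeg ⟨B', rfl⟩ ⟨A', rfl⟩
      rw [map_mul] at hB
      have hB' := right_ne_zero_of_mul hB
      have hlt : B'.natDegree < Nat.find hex := by
        rw [← hBn, natDegree_mul hp.ne_zero (hne hB')]
        omega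
      refine Nat.find_min hex hlt ⟨A', B', hB', ?_, rfl⟩
      rw [hAB, map_mul, map_mul, mul_div_mul_left _ _ (left_ne_zero_of_mul hB)]
    · apply hinj
      rw [← hev]
      simp only [map_mul, map_sub, map_pow, hDev, hδev, map_natCast, map_ofNat]
      rw [hev, evalPair_X, evalPair_C, hmap, ← hev]
      rw [hAB, Derivation.leibniz_div, ← hev, Derivation.leibniz_div] at heq
      simp only [smul_eq_mul] at heq
      have hQ' : ev Q ≠ 0 := hQ
      field_simp at heq
      linear_combination (aeval y R.denom) * heq
  rw [hAB, hA, map_zero, zero_div]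

/-- A solution of `v' = 2uv²`, `u' = -v (u² + R(y)/2)` with `u` transcendental over `K(y)` has `v`
transcendental over `K(y, u)`. -/
theorem notMem_acl_of_riccati (R : RatFunc ℂ) (hR : ¬ ∃ u : AlgFun, IsAlgebraicRiccatiSolution R u)
    (K : IntermediateField ℂ L) {y v u : L} (hy : y ∉ acl ℂ (K : Set L))
    (hu : u ∉ acl ℂ (insert y (K : Set L))) (Δ : Derivation ℂ L L) (hΔK : ∀ x ∈ K, Δ x ∈ K)
    (hv : v ≠ 0) (hΔy : Δ y = v) (hΔv : Δ v = 2 * u * v ^ 2)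
    (hΔu : Δ u = -v * (u ^ 2 + 1 / 2 * ratEval R y)) :
    v ∉ acl ℂ (insert u (insert y (K : Set L))) := by
  intro hvacl
  set S := insert u (insert y (K : Set L)) with hS
  set E := IntermediateField.adjoin ℂ S with hE
  have hSE : S ⊆ E := IntermediateField.subset_adjoin ℂ S
  have hyE : y ∈ E := hSE (Set.mem_insert_of_mem _ (Set.mem_insert _ _))
  have huE : u ∈ E := hSE (Set.mem_insert _ _)
  have hKE : ∀ x ∈ K, x ∈ E := fun x hx => hSE (Set.mem_insert_of_mem _ (Set.mem_insert_of_mem _ hx))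
  have hy' : y ∉ acl ℂ (insert u (K : Set L)) := fun h => hu (acl_exchange h hy)
  obtain ⟨D₁, hD₁, hD₁y⟩ := exists_derivation_of_notMem_acl hy'
  obtain ⟨D₂, hD₂, hD₂u⟩ := exists_derivation_of_notMem_acl hu
  set ρ := ratEval R y with hρ
  have hρE : ρ ∈ E := by
    have : ∀ p : ℂ[X], aeval y p ∈ E := fun p => by
      have := (aeval (⟨y, hyE⟩ : E) p).2
      rwa [← IntermediateField.algebraMap_apply, ← aeval_algebraMap_apply] at this
    exact div_mem (this _) (this _)
  -- The Riccati vector field ∂_y - (u² + R/2)∂_u, trivial on K. Then Δ = vD + δ, where δ kills y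
  -- and u.
  set D : Derivation ℂ L L := D₁ - (u ^ 2 + 1 / 2 * ρ) • D₂ with hD
  have hDap : ∀ x, D x = D₁ x - (u ^ 2 + 1 / 2 * ρ) * D₂ x := fun _ => rfl
  have hDK : ∀ x ∈ K, D x = 0 := fun x hx => by
    rw [hDap, hD₁ x (Set.mem_insert_of_mem _ hx), hD₂ x (Set.mem_insert_of_mem _ hx)]
    simp
  have hDy : D y = 1 := by rw [hDap, hD₁y, hD₂ y (Set.mem_insert _ _)]; simp
  have hDu : D u = -(u ^ 2 + 1 / 2 * ρ) := by
    rw [hDap, hD₁ u (Set.mem_insert _ _), hD₂u]; simp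
  set δ : Derivation ℂ L L := Δ - v • D with hδ
  have hδap : ∀ x, δ x = Δ x - v * D x := fun _ => rfl
  have hδK : ∀ x ∈ K, δ x ∈ K := fun x hx => by
    rw [hδap, hDK x hx, mul_zero, sub_zero]; exact hΔK x hx
  have hδy : δ y = 0 := by rw [hδap, hDy, hΔy]; ring
  have hδu : δ u = 0 := by rw [hδap, hDu, hΔu]; ring
  have h2E : (1 / 2 : L) ∈ E := div_mem (one_mem _) (ofNat_mem _ _)
  have hDE : ∀ x ∈ E, D x ∈ E := by
    refine fun x hx => D.apply_mem_of_mem_adjoin hSE ?_ hx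
    rintro s (rfl | rfl | hs)
    · rw [hDu]
      exact neg_mem (add_mem (pow_mem huE 2) (mul_mem h2E hρE))
    · rw [hDy]; exact one_mem _
    · rw [hDK s hs]; exact zero_mem _
  have hδE : ∀ x ∈ E, δ x ∈ E := by
    refine fun x hx => δ.apply_mem_of_mem_adjoin hSE ?_ hx
    rintro s (rfl | rfl | hs)
    · rw [hδu]; exact zero_mem _
    · rw [hδy]; exact zero_mem _
    · exact hKE _ (hδK s hs)
  let DE := D.restrictField E hDE
  let δE := δ.restrictField E hδE
  have hint : IsIntegral E v := (mem_acl.1 hvacl).isIntegral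
  set G := minpoly E v with hG
  have hGmonic : G.Monic := minpoly.monic hint
  set d := G.natDegree with hd
  have hdpos : 0 < d := minpoly.natDegree_pos hint
  have hG0 : G.coeff 0 ≠ 0 := minpoly.coeff_zero_ne_zero hint hv
  let u' : E := ⟨u, huE⟩
  -- Applying δ + vD to G(v) = 0 and using v' = 2uv² gives M(v) = 0. As M has degree at most d + 1,
  -- it is G times a linear factor c₁X + c₀.
  set M : E[X] := mapDeriv δE G + X * mapDeriv DE G + C (2 * u') * X ^ 2 * derivative G with hM
  have hMv : aeval v M = 0 := by
    have h1 := deriv_eval₂ δE δ (algebraMap E L) (fun _ => rfl) G v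
    have h2 := deriv_eval₂ DE D (algebraMap E L) (fun _ => rfl) G v
    rw [← aeval_def, minpoly.aeval, map_zero, ← aeval_def, ← aeval_def] at h1 h2
    have h3 : δ v + v * D v = 2 * u * v ^ 2 := by rw [hδap, hΔv]; ring
    have h4 : algebraMap E L (2 * u') = 2 * u := by
      rw [map_mul, map_ofNat]; rfl
    rw [map_mul] at h4
    rw [hM]
    simp only [map_add, map_mul, map_pow, aeval_X, aeval_C]
    linear_combination (-1) * h1 - v * h2 - (aeval v (derivative G)) * h3 +
      v ^ 2 * (aeval v (derivative G)) * h4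
  have hMdeg : M.natDegree ≤ d + 1 := by
    refine natDegree_add_le_of_degree_le (natDegree_add_le_of_degree_le ?_ ?_) ?_
    · exact (natDegree_mapDeriv_le δE G).trans (Nat.le_succ d)
    · refine natDegree_mul_le.trans ?_
      rw [natDegree_X, add_comm]
      exact Nat.add_le_add_right (natDegree_mapDeriv_le DE G) 1
    · rw [mul_assoc]
      refine (natDegree_C_mul_le _ _).trans (natDegree_mul_le.trans ?_)
      rw [natDegree_X_pow]
      have := natDegree_derivative_le G
      omega
  obtain ⟨H, hH⟩ := minpoly.dvd E v hMv
  rw [← hG] at hH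
  have hHdeg : H.natDegree ≤ 1 := by
    by_cases hH0 : H = 0
    · rw [hH0]; simp
    · have := congrArg natDegree hH
      rw [natDegree_mul hGmonic.ne_zero hH0] at this
      omega
  obtain ⟨c₁, c₀, hHc⟩ := exists_eq_X_add_C_of_natDegree_le_one hHdeg
  have hcoeff : ∀ i, δE (G.coeff (i + 1)) + DE (G.coeff i) + 2 * u' * i * G.coeff i =
      c₁ * G.coeff i + c₀ * G.coeff (i + 1) := by
    intro i
    have hMH : mapDeriv δE G + mapDeriv DE G * X + C (2 * u') * (derivative G * X ^ 2) =
        C c₁ * (G * X) + C c₀ * G := by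
      rw [hHc] at hH
      linear_combination hH
    have := congrArg (fun p => coeff p (i + 1)) hMH
    simp only [coeff_add, coeff_mapDeriv, coeff_C_mul, coeff_mul_X] at this
    rw [coeff_mul_X_pow'] at this
    rcases i with _ | i
    · rw [if_neg (by omega)] at this
      rw [Nat.cast_zero]
      linear_combination this
    · rw [if_pos (by omega), show i + 1 + 1 - 2 = i by omega, coeff_derivative] at this
      push_cast
      linear_combination this
  have hcoeff0 : δE (G.coeff 0) = c₀ * G.coeff 0 := by
    have := congrArg (fun p => coeff p 0) hH
    simp only [hM, hHc, coeff_add, coeff_mapDeriv, mul_coeff_zero, coeff_X_zero, zero_mul,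
      coeff_C_zero, coeff_X_pow, mul_zero, coeff_add] at this
    rw [if_neg (by omega)] at this
    linear_combination this
  have hGd : G.coeff d = 1 := hGmonic.coeff_natDegree
  have hc₁ : c₁ = 2 * u' * d := by
    have := hcoeff d
    rw [hGd, coeff_eq_zero_of_natDegree_lt (p := G) (n := d + 1) (by omega)] at this
    simp only [map_zero, Derivation.map_one_eq_zero] at this
    linear_combination -this
  have key : ∀ j, 0 < j → j ≤ d → ∀ h ∈ E, h ≠ 0 →
      D (G.coeff (d - j)) - 2 * j * u * G.coeff (d - j) = δ h / h → G.coeff (d - j) = 0 := by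
    intro j hj hjd h hh hh0 heq
    have := eq_zero_of_riccati_eq R hR K hy hu D δ hDK hDy hDu hδK hδy hδu hj
      (G.coeff (d - j)).2 hh hh0 heq
    exact_mod_cast this
  have hcoe : ∀ j, j < d → δ (G.coeff (d - j)) + D (G.coeff (d - (j + 1))) -
      2 * ((j + 1 : ℕ) : L) * u * G.coeff (d - (j + 1)) = c₀ * G.coeff (d - j) := by
    intro j hj
    have h1 := congrArg (algebraMap E L) (hcoeff (d - (j + 1)))
    rw [show d - (j + 1) + 1 = d - j by omega, hc₁] at h1
    simp only [map_add, map_mul, map_natCast, map_ofNat] at h1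
    have h2 : ((d - (j + 1) : ℕ) : L) = d - (j + 1 : ℕ) := by
      rw [Nat.cast_sub (by omega)]
    rw [h2] at h1
    change δ (G.coeff (d - j)) + D (G.coeff (d - (j + 1))) + _ = _ at h1
    have h3 : algebraMap E L u' = u := rfl
    rw [h3] at h1
    change _ = (algebraMap E L c₀) * (algebraMap E L (G.coeff (d - j)))
    change _ + _ - _ * (algebraMap E L (G.coeff (d - (j + 1)))) = _
    linear_combination h1
  -- The constant coefficient gives c₀ = δh/h with h = G(0), so the equation for the coefficient
  -- below the top one has the form treated above.
  have hfirst : G.coeff (d - 1) = 0 := by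
    refine key 1 one_pos hdpos (G.coeff 0) (G.coeff 0).2 (by exact_mod_cast hG0) ?_
    have h1 := hcoe 0 hdpos
    rw [Nat.sub_zero, hGd] at h1
    have h2 : δ (G.coeff 0) = c₀ * G.coeff 0 := congrArg (algebraMap E L) hcoeff0
    have hG0' : (G.coeff 0 : L) ≠ 0 := by exact_mod_cast hG0
    rw [h2, mul_div_cancel_right₀ _ hG0']
    have h3 : ((1 : E) : L) = 1 := rfl
    rw [h3, Derivation.map_one_eq_zero] at h1
    simpa using h1
  have hc₀ : c₀ = 0 := by
    have h1 := hcoe 0 hdpos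
    rw [Nat.sub_zero, hGd, zero_add, hfirst] at h1
    have h3 : ((1 : E) : L) = 1 := rfl
    rw [h3, Derivation.map_one_eq_zero] at h1
    have : (c₀ : L) = 0 := by simpa using h1.symm
    exact_mod_cast this
  -- With c₀ = 0 the recursion is homogeneous, and vanishing propagates down to the constant
  -- coefficient, which is nonzero as v ≠ 0.
  have hall : ∀ j, 0 < j → j ≤ d → G.coeff (d - j) = 0 := by
    intro j hj
    induction j, hj using Nat.le_induction with
    | base => exact fun _ => hfirst
    | succ j hj ih =>
      intro hjd
      refine key (j + 1) (Nat.succ_pos j) hjd 1 (one_mem _) one_ne_zero ?_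
      have h1 := hcoe j (by omega)
      rw [ih (by omega), hc₀] at h1
      rw [Derivation.map_one_eq_zero, zero_div]
      simpa using h1
  have := hall d hdpos le_rfl
  rw [Nat.sub_self] at this
  exact hG0 this

/-- Δ - v∂ kills y and agrees with Δ on K, so it preserves the algebraic closure of K(y). On u it
equals -v times the Riccati defect of u, which is nonzero by `hR`; dividing gives v. -/
theorem riccati_of_notMem_acl (R : RatFunc ℂ) (hR : ¬ ∃ u : AlgFun, IsAlgebraicRiccatiSolution R u)
    (K : IntermediateField ℂ L) {y v u : L} (hy : y ∉ acl ℂ (K : Set L))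
    (hu : u ∈ acl ℂ (insert y (K : Set L))) (Δ : Derivation ℂ L L) (hΔK : ∀ x ∈ K, Δ x ∈ K)
    (hΔy : Δ y = v)
    (hΔu : Δ u = -v * (u ^ 2 + 1 / 2 * ratEval R y)) :
    v ∈ acl ℂ (insert y (K : Set L)) := by
  set E := acl ℂ (insert y (K : Set L)) with hE
  obtain ⟨D, hDK, hDy⟩ := exists_derivation_of_notMem_acl hy
  have hSE : insert y (K : Set L) ⊆ E := subset_acl _
  have hDu : D u ∈ E := by
    refine D.apply_mem_acl hSE ?_ hu
    rintro s (rfl | hs)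
    · rw [hDy]; exact one_mem _
    · rw [hDK s hs]; exact zero_mem _
  have hδu : Δ u - v * D u ∈ E := by
    refine (Δ - v • D).apply_mem_acl hSE ?_ hu
    rintro s (rfl | hs)
    · simp [hDy, hΔy]
    · simp only [Derivation.sub_apply, Derivation.smul_apply, hDK s hs, smul_zero, sub_zero]
      exact hSE (Set.mem_insert_of_mem _ (hΔK s hs))
  have hyE : y ∈ E := hSE (Set.mem_insert _ _)
  have hρE : ratEval R y ∈ E := by
    have : ∀ p : ℂ[X], aeval y p ∈ E := fun p => by
      have := (aeval (⟨y, hyE⟩ : E) p).2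
      rwa [← IntermediateField.algebraMap_apply, ← aeval_algebraMap_apply] at this
    exact div_mem (this _) (this _)
  have h2E : (1 / 2 : L) ∈ E := div_mem (one_mem _) (ofNat_mem _ _)
  have heE : D u + u ^ 2 + 1 / 2 * ratEval R y ∈ E :=
    add_mem (add_mem hDu (pow_mem hu 2)) (mul_mem h2E hρE)
  have he0 : D u + u ^ 2 + 1 / 2 * ratEval R y ≠ 0 := by
    intro h0
    refine hR (exists_isAlgebraicRiccatiSolution R D hDy (acl_mono ?_ hu) h0)
    exact Set.insert_subset_insert hDK
  have : v = -(Δ u - v * D u) / (D u + u ^ 2 + 1 / 2 * ratEval R y) := by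
    rw [hΔu, eq_div_iff he0]
    ring
  rw [this]
  exact div_mem (neg_mem hδu) heE

end HigherTranscendenceDegree

/-! ### Algebraic independence of y, u, v -/

section SchwarzianIndependence

open Polynomial

/-- Dependence over a subset of E may be tested inside E, so an algebraic closure can serve as its
own ambient field. -/
theorem mem_acl_preimage {k L : Type*} [Field k] [Field L] [Algebra k L]
    (E : IntermediateField k L) {S : Set L} (hS : S ⊆ E) {x : E} (hx : (x : L) ∈ acl k S) :
    x ∈ acl k ((↑) ⁻¹' S : Set E) := by
  set A : IntermediateField k E := IntermediateField.adjoin k ((↑) ⁻¹' S : Set E) with hA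
  have hle : IntermediateField.adjoin k S ≤ (E.val.comp A.val).fieldRange := by
    refine IntermediateField.adjoin_le_iff.2 fun z hz => ?_
    exact ⟨⟨⟨z, hS hz⟩, IntermediateField.subset_adjoin _ _ hz⟩, rfl⟩
  have h1 : IsAlgebraic (E.val.comp A.val).fieldRange (x : L) :=
    (mem_acl.1 hx).mono_intermediateField hle
  exact mem_acl.2 (h1.of_ringHom_of_comp_eq (E.val.comp A.val).rangeRestrict.toRingHom
    E.val.toRingHom (E.val.comp A.val).rangeRestrict_surjective Subtype.val_injective rfl)

variable {L : Type*} [Field L] [Algebra ℂ L] [IsAlgClosed L]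

/-- Otherwise Δ and ∂ both preserve the algebraic closure of K(y). There [Δ, ∂] = -(∂v)∂, since both
sides agree on y and on K, so `exists_riccati_of_commutator` applies inside it. -/
theorem notMem_acl_of_algebraic_jet (R : RatFunc ℂ)
    (hR : ¬ ∃ u : AlgFun, IsAlgebraicRiccatiSolution R u)
    (K : IntermediateField ℂ L) {y v u : L} (hy : y ∉ acl ℂ (K : Set L))
    (hu : u ∈ acl ℂ (insert y (K : Set L))) (Δ : Derivation ℂ L L) (hΔK : ∀ x ∈ K, Δ x ∈ K)
    (hden : R.denom.aeval y ≠ 0)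
    (hv : v ≠ 0) (hΔy : Δ y = v) (hΔv : Δ v = 2 * u * v ^ 2)
    (hΔu : Δ u = -v * (u ^ 2 + 1 / 2 * ratEval R y)) :
    v ∉ acl ℂ (insert y (K : Set L)) := by
  intro hvE
  set S := insert y (K : Set L) with hS
  let E := acl ℂ S
  have hSE : S ⊆ E := subset_acl _
  have : IsAlgClosed E :=
    (algebraicClosure.isAlgClosure (F := IntermediateField.adjoin ℂ S) (E := L)).isAlgClosed
  have hyE : y ∈ E := hSE (Set.mem_insert _ _)
  obtain ⟨D, hDK, hDy⟩ := exists_derivation_of_notMem_acl hy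
  have hDE : ∀ x ∈ E, D x ∈ E := fun x hx => by
    refine D.apply_mem_acl hSE ?_ hx
    rintro s (rfl | hs)
    · rw [hDy]; exact one_mem _
    · rw [hDK s hs]; exact zero_mem _
  have hΔE : ∀ x ∈ E, Δ x ∈ E := fun x hx => by
    refine Δ.apply_mem_acl hSE ?_ hx
    rintro s (rfl | hs)
    · rw [hΔy]; exact hvE
    · exact hSE (Set.mem_insert_of_mem _ (hΔK s hs))
  have hcomm : ∀ x ∈ E, Δ (D x) = D (Δ x) - D v * D x := by
    intro x hx
    have : ⁅Δ, D⁆ x = (-(D v) • D) x := by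
      refine Derivation.eqOn_acl (S := S) ?_ hx
      rintro s (rfl | hs)
      · simp [Derivation.commutator_apply, hDy, hΔy]
      · simp [Derivation.commutator_apply, hDK s hs, hDK _ (hΔK s hs)]
    rw [Derivation.commutator_apply] at this
    simp only [Derivation.smul_apply, smul_eq_mul] at this
    linear_combination this
  have haev : ∀ p : ℂ[X], ((aeval (⟨y, hyE⟩ : E) p : E) : L) = aeval y p := fun p => by
    rw [← IntermediateField.algebraMap_apply, ← aeval_algebraMap_apply]; rfl
  have hrat : ((ratEval R (⟨y, hyE⟩ : E) : E) : L) = ratEval R y := by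
    rw [ratEval, ratEval, ← haev, ← haev]
    rfl
  refine hR (exists_riccati_of_commutator R (Δ.restrictField E hΔE) (D.restrictField E hDE)
    (y := ⟨y, hyE⟩) (v := ⟨v, hvE⟩) (u := ⟨u, hu⟩) ?_ ?_ ?_ ?_ ?_ ?_ ?_ ?_)
  · intro h0
    apply hden
    rw [← haev, h0]
    rfl
  · exact fun h => hv (congrArg Subtype.val h)
  · exact Subtype.ext hΔy
  · exact Subtype.ext hΔv
  · apply Subtype.ext
    rw [Derivation.coe_restrictField]
    change Δ u = -v * (u ^ 2 + 1 / 2 * ((ratEval R (⟨y, hyE⟩ : E) : E) : L))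
    rw [hΔu, hrat]
  · exact Subtype.ext hDy
  · exact fun x => Subtype.ext (hcomm x x.2)
  · intro x
    refine acl_mono ?_ (mem_acl_preimage E hSE x.2)
    rintro s (hs | hs)
    · exact Or.inl (Subtype.ext hs)
    · exact Or.inr (Subtype.ext (hDK _ hs))

/-- A solution of the Schwarzian equation which is transcendental over `K` has algebraically
independent `y`, `u = y''/(2y'²)`, `v = y'`. -/
theorem notMem_acl_jet (R : RatFunc ℂ)
    (hR : ¬ ∃ u : AlgFun, IsAlgebraicRiccatiSolution R u)
    (K : IntermediateField ℂ L) {y v u : L} (hy : y ∉ acl ℂ (K : Set L))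
    (Δ : Derivation ℂ L L) (hΔK : ∀ x ∈ K, Δ x ∈ K)
    (hden : R.denom.aeval y ≠ 0)
    (hv : v ≠ 0) (hΔy : Δ y = v) (hΔv : Δ v = 2 * u * v ^ 2)
    (hΔu : Δ u = -v * (u ^ 2 + 1 / 2 * ratEval R y)) :
    u ∉ acl ℂ (insert y (K : Set L)) ∧ v ∉ acl ℂ (insert u (insert y (K : Set L))) := by
  have hu : u ∉ acl ℂ (insert y (K : Set L)) := fun h =>
    notMem_acl_of_algebraic_jet R hR K hy h Δ hΔK hden hv hΔy hΔv hΔu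
      (riccati_of_notMem_acl R hR K hy h Δ hΔK hΔy hΔu)
  exact ⟨hu, notMem_acl_of_riccati R hR K hy hu Δ hΔK hv hΔy hΔv hΔu⟩

end SchwarzianIndependence

/-! ### Transcendence degree of K⟨y⟩ -/

section SchwarzianTrdeg

open Polynomial

theorem AlgebraicIndependent.finCons {A B : Type*} [CommRing A] [CommRing B] [Algebra A B] {n : ℕ}
    {x : Fin n → B} (hx : AlgebraicIndependent A x) {a : B}
    (ha : Transcendental (Algebra.adjoin A (Set.range x)) a) :
    AlgebraicIndependent A (Fin.cons a x : Fin (n + 1) → B) := by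
  rw [← algebraicIndependent_equiv (finSuccEquiv n).symm]
  convert AlgebraicIndependent.option_iff.2 ⟨hx, ha⟩ using 1
  ext (_ | i)
  · simp
  · simp

variable {F : Type*} [Field F] [Differential F] [Algebra ℂ F] [DifferentialAlgebra ℂ F]

theorem deriv_algebraMap_complex (c : ℂ) : (algebraMap ℂ F c)′ = 0 := by
  rw [deriv_algebraMap]
  exact map_zero _

variable (F) in
/-- The derivation of a differential field whose constants contain `ℂ`, as a `ℂ`-linear map. -/
def complexDerivation : Derivation ℂ F F where
  toFun x := (x′)
  map_add' := map_add _
  map_smul' c x := by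
    rw [Algebra.smul_def, Derivation.leibniz, deriv_algebraMap_complex]
    simp [Algebra.smul_def]
  map_one_eq_zero' := Derivation.map_one_eq_zero _
  leibniz' := Derivation.leibniz _

/-- Half the logarithmic derivative of y' with respect to y turns the third-order equation into a
Riccati equation. -/
theorem IsSchwarzianSolution.deriv_u {R : RatFunc ℂ} {y : F} (h : IsSchwarzianSolution R y) :
    (y′′ / (2 * y′ ^ 2))′ = -y′ * ((y′′ / (2 * y′ ^ 2)) ^ 2 + 1 / 2 * ratEval R y) := by
  have : CharZero F := charZero_of_injective_algebraMap (algebraMap ℂ F).injective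
  have hv := h.deriv_ne_zero
  have he := h.equation
  rw [schwarzian] at he
  have e1 : y′′ / (2 * y′ ^ 2) = (y′′ / y′) / (2 * y′) := by field_simp
  have e2 : (2 * y′)′ = 2 * y′′ := by
    rw [← map_ofNat (algebraMap ℂ F) 2, Derivation.leibniz, deriv_algebraMap_complex]
    simp
  rw [e1, Derivation.leibniz_div, e2]
  have e3 : (y′′ / y′)′ = 1 / 2 * (y′′ / y′) ^ 2 - y′ ^ 2 * ratEval R y := by
    rw [ratEval]; linear_combination he
  rw [e3]
  simp only [smul_eq_mul]
  field_simp
  ring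

/-- The derivation is carried to the algebraic closure of F, where `notMem_acl_jet` applies. The
order v, u, y lets each entry be adjoined in front of those it is transcendental over. -/
theorem isAlgebraic_or_algebraicIndependent (R : RatFunc ℂ)
    (hR : ¬ ∃ u : AlgFun, IsAlgebraicRiccatiSolution R u)
    {K : Type*} [Field K] [Differential K] [Algebra ℂ K]
    [Algebra K F] [IsScalarTower ℂ K F] [DifferentialAlgebra K F] {y : F}
    (h : IsSchwarzianSolution R y) :
    IsAlgebraic K y ∨ AlgebraicIndependent K ![y′, y′′ / (2 * y′ ^ 2), y] := by
  by_cases hyalg : IsAlgebraic K y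
  · exact Or.inl hyalg
  refine Or.inr ?_
  have : CharZero F := charZero_of_injective_algebraMap (algebraMap ℂ F).injective
  let Ω := AlgebraicClosure F
  have hinj : Function.Injective (algebraMap F Ω) := (algebraMap F Ω).injective
  have : Algebra.FormallyEtale F Ω := Algebra.FormallyEtale.of_isSeparable _ _
  obtain ⟨Δ, hΔ⟩ := Derivation.exists_extension_of_formallyEtale (R := ℂ)
    ((Algebra.linearMap F Ω).compDer (complexDerivation F))
  have hΔ' : ∀ x : F, Δ (algebraMap F Ω x) = algebraMap F Ω (x′) := hΔ
  let K₀ : IntermediateField ℂ Ω := (IsScalarTower.toAlgHom ℂ K Ω).fieldRange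
  have hK₀ : ∀ c : K, algebraMap K Ω c ∈ K₀ := fun c => ⟨c, rfl⟩
  have hΔK : ∀ x ∈ K₀, Δ x ∈ K₀ := by
    rintro _ ⟨c, rfl⟩
    refine ⟨c′, ?_⟩
    change algebraMap K Ω c′ = Δ (algebraMap K Ω c)
    rw [IsScalarTower.algebraMap_apply K F Ω, IsScalarTower.algebraMap_apply K F Ω, hΔ',
      deriv_algebraMap]
  set v := y′ with hv
  set u := y′′ / (2 * y′ ^ 2) with hu
  have hv0 : v ≠ 0 := h.deriv_ne_zero
  have haev : ∀ p : ℂ[X], algebraMap F Ω (aeval y p) = aeval (algebraMap F Ω y) p := fun p =>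
    (aeval_algebraMap_apply _ _ _).symm
  have hrat : algebraMap F Ω (ratEval R y) = ratEval R (algebraMap F Ω y) := by
    rw [ratEval, ratEval, map_div₀, haev, haev]
  have hyK₀ : algebraMap F Ω y ∉ acl ℂ (K₀ : Set Ω) := by
    intro hy
    rw [mem_acl] at hy
    have hle : IntermediateField.adjoin ℂ (K₀ : Set Ω) ≤ K₀ :=
      IntermediateField.adjoin_le_iff.2 le_rfl
    have h1 : IsAlgebraic K₀ (algebraMap F Ω y) := hy.mono_intermediateField hle
    apply hyalg
    exact h1.of_ringHom_of_comp_eq (IsScalarTower.toAlgHom ℂ K Ω).rangeRestrict (algebraMap F Ω)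
      (IsScalarTower.toAlgHom ℂ K Ω).rangeRestrict_surjective hinj (by
        ext c
        exact (IsScalarTower.algebraMap_apply K F Ω c))
  obtain ⟨hu', hv'⟩ := notMem_acl_jet R hR K₀ hyK₀ Δ hΔK (v := algebraMap F Ω v)
    (u := algebraMap F Ω u)
    (by rw [← haev, Ne, map_eq_zero_iff _ hinj]; exact h.denom_ne_zero)
    (by rwa [Ne, map_eq_zero_iff _ hinj])
    (hΔ' y)
    (by rw [hΔ', ← map_ofNat (algebraMap F Ω) 2, ← map_pow, ← map_mul, ← map_mul]
        congr 1
        rw [hu]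
        change v′ = 2 * (v′ / (2 * v ^ 2)) * v ^ 2
        field_simp)
    (by rw [hΔ', h.deriv_u, ← hrat]
        simp only [map_mul, map_neg, map_add, map_pow, map_div₀, map_one, map_ofNat, hu, hv])
  have htr : ∀ (s : Set Ω) (T : Set Ω) (x : Ω), (K₀ : Set Ω) ⊆ T → s ⊆ T → x ∉ acl ℂ T →
      Transcendental (Algebra.adjoin K s) x := by
    intro s T x hKT hsT hx halg
    apply hx
    have hmem : ∀ z ∈ Algebra.adjoin K s, z ∈ acl ℂ T := by
      intro z hz
      induction hz using Algebra.adjoin_induction with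
      | mem z hz => exact subset_acl _ (hsT hz)
      | algebraMap c => exact subset_acl _ (hKT (hK₀ c))
      | add a b _ _ ha hb => exact add_mem ha hb
      | mul a b _ _ ha hb => exact mul_mem ha hb
    refine mem_acl_of_isAlgebraic (E := acl ℂ T) le_rfl ?_
    let f : Algebra.adjoin K s →+* acl ℂ T :=
      (Algebra.adjoin K s).val.toRingHom.codRestrict (acl ℂ T) (fun z => hmem z z.2)
    exact halg.ringHom_of_comp_eq f (RingHom.id Ω)
      (fun a b hab => Subtype.ext (congrArg (fun z : acl ℂ T => (z : Ω)) hab)) rfl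
  have hind : AlgebraicIndependent K ![algebraMap F Ω v, algebraMap F Ω u, algebraMap F Ω y] := by
    have h0 : AlgebraicIndependent K (![] : Fin 0 → Ω) := by
      rw [algebraicIndependent_empty_type_iff]
      exact (algebraMap K Ω).injective
    have h1 : AlgebraicIndependent K ![algebraMap F Ω y] :=
      h0.finCons (htr _ K₀ _ le_rfl (by simp) hyK₀)
    have h2 : AlgebraicIndependent K ![algebraMap F Ω u, algebraMap F Ω y] :=
      h1.finCons (htr _ _ _ (Set.subset_insert _ _) (by simp) hu')
    exact h2.finCons (htr _ _ _ ((Set.subset_insert _ _).trans (Set.subset_insert _ _))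
      (by simp [Set.insert_subset_iff]) hv')
  refine AlgebraicIndependent.of_comp (IsScalarTower.toAlgHom K F Ω) ?_
  convert hind using 1
  ext i
  fin_cases i <;> rfl

theorem isAlgebraic_deriv {K E : Type*} [Field K] [Differential K] [CharZero K] [Field E]
    [Differential E] [Algebra K E]
    [DifferentialAlgebra K E] {x : E} (hx : IsAlgebraic K x) : IsAlgebraic K x′ := by
  have hs : aeval x (derivative (minpoly K x)) ≠ 0 :=
    (minpoly.irreducible hx.isIntegral).separable.aeval_derivative_ne_zero (minpoly.aeval _ x)
  have h := Differential.deriv_aeval_eq x (minpoly K x)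
  rw [minpoly.aeval, map_zero] at h
  have hmem : ∀ p : K[X], aeval x p ∈ algebraicClosure K E := fun p =>
    (aeval (⟨x, mem_algebraicClosure_iff.2 hx⟩ : algebraicClosure K E) p).2 |> fun h => by
      rwa [← IntermediateField.algebraMap_apply, ← aeval_algebraMap_apply] at h
  have : x′ = -aeval x (Differential.mapCoeffs (minpoly K x)) /
      aeval x (derivative (minpoly K x)) := by
    rw [eq_div_iff hs]
    linear_combination -h
  rw [this]
  exact mem_algebraicClosure_iff.1 (div_mem (neg_mem (hmem _)) (hmem _))

theorem iterDer_succ {F : Type*} [Field F] [Differential F] (n : ℕ) (y : F) :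
    iterDer (n + 1) y = (iterDer n y)′ :=
  Function.iterate_succ_apply' _ _ _

theorem iterDer_zero {F : Type*} [Field F] [Differential F] (y : F) : iterDer 0 y = y := rfl

theorem trdeg_adjoin_range {K F ι : Type*} [Field K] [Field F] [Algebra K F] [Fintype ι] {x : ι → F}
    (hx : AlgebraicIndependent K x) :
    Algebra.trdeg K (IntermediateField.adjoin K (Set.range x)) = Fintype.card ι := by
  have : Algebra.IsAlgebraic (MvPolynomial ι K) (FractionRing (MvPolynomial ι K)) :=
    IsLocalization.isAlgebraic _ (nonZeroDivisors (MvPolynomial ι K))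
  have h1 : IsTranscendenceBasis K
      (algebraMap (MvPolynomial ι K) (FractionRing (MvPolynomial ι K)) ∘ MvPolynomial.X) :=
    (IsTranscendenceBasis.mvPolynomial ι K).algebraMap_comp
  have h2 := hx.aevalEquivField.isTranscendenceBasis h1
  have := h2.lift_cardinalMk_eq_trdeg
  simpa using this.symm

/-- K(y, u, v) is already closed under the derivation, the derivatives of y, u, v being rational in
them. -/
theorem diffAdjoin_eq {R : RatFunc ℂ} {K : Type*} [Field K] [Differential K] [Algebra ℂ K]
    [Algebra K F] [IsScalarTower ℂ K F] [DifferentialAlgebra K F] {y : F}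
    (h : IsSchwarzianSolution R y) :
    diffAdjoin K y = IntermediateField.adjoin K (Set.range ![y′, y′′ / (2 * y′ ^ 2), y]) := by
  set E := IntermediateField.adjoin K (Set.range ![y′, y′′ / (2 * y′ ^ 2), y]) with hE
  have hmem : ∀ i, ![y′, y′′ / (2 * y′ ^ 2), y] i ∈ E := fun i =>
    IntermediateField.subset_adjoin _ _ ⟨i, rfl⟩
  have hv : y′ ∈ E := hmem 0
  have hu : y′′ / (2 * y′ ^ 2) ∈ E := hmem 1
  have hy : y ∈ E := hmem 2
  have hv0 := h.deriv_ne_zero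
  have : CharZero F := charZero_of_injective_algebraMap (algebraMap ℂ F).injective
  have hw : y′′ ∈ E := by
    have e : y′′ = (y′′ / (2 * y′ ^ 2)) * (2 * y′ ^ 2) := by field_simp
    rw [e]
    exact mul_mem hu (mul_mem (ofNat_mem _ _) (pow_mem hv 2))
  apply le_antisymm
  · have haev : ∀ p : ℂ[X], aeval y p ∈ E := fun p => by
      have := (aeval (⟨y, hy⟩ : E) (p.map (algebraMap ℂ K))).2
      rwa [← IntermediateField.algebraMap_apply, ← aeval_algebraMap_apply,
        aeval_map_algebraMap] at this
    have hD : ∀ x ∈ E, x′ ∈ E := by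
      intro x hx
      induction hx using IntermediateField.adjoin_induction with
      | mem z hz =>
        obtain ⟨i, rfl⟩ := hz
        fin_cases i
        · exact hw
        · change (y′′ / (2 * y′ ^ 2))′ ∈ E
          rw [h.deriv_u]
          exact mul_mem (neg_mem hv) (add_mem (pow_mem hu 2) (mul_mem
            (div_mem (one_mem _) (ofNat_mem _ _)) (div_mem (haev _) (haev _))))
        · exact hv
      | algebraMap c => rw [deriv_algebraMap]; exact E.algebraMap_mem _
      | add a b _ _ ha hb => rw [map_add]; exact add_mem ha hb
      | mul a b ha' hb' ha hb =>
        rw [Derivation.leibniz]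
        exact add_mem (mul_mem ha' hb) (mul_mem hb' ha)
      | inv a ha' ha =>
        rw [Derivation.leibniz_inv]
        exact mul_mem (neg_mem (pow_mem (inv_mem ha') 2)) ha
    refine IntermediateField.adjoin_le_iff.2 ?_
    rintro _ ⟨n, rfl⟩
    change iterDer n y ∈ E
    induction n with
    | zero => exact hy
    | succ n ih => rw [iterDer_succ]; exact hD _ ih
  · have h0 : ∀ n, iterDer n y ∈ diffAdjoin K y := fun n =>
      IntermediateField.subset_adjoin _ _ ⟨n, rfl⟩
    refine IntermediateField.adjoin_le_iff.2 ?_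
    rintro _ ⟨i, rfl⟩
    have hv1 : y′ ∈ diffAdjoin K y := h0 1
    fin_cases i
    · exact hv1
    · exact div_mem (h0 2) (mul_mem (ofNat_mem _ _) (pow_mem hv1 2))
    · exact h0 0

theorem trdeg_diffAdjoin (R : RatFunc ℂ)
    (hR : ¬ ∃ u : AlgFun, IsAlgebraicRiccatiSolution R u)
    {K : Type*} [Field K] [Differential K] [Algebra ℂ K]
    [Algebra K F] [IsScalarTower ℂ K F] [DifferentialAlgebra K F] {y : F}
    (h : IsSchwarzianSolution R y) :
    Algebra.trdeg K (diffAdjoin K y) = 0 ∨ Algebra.trdeg K (diffAdjoin K y) = 3 := by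
  have : CharZero K := charZero_of_injective_algebraMap (algebraMap ℂ K).injective
  rcases isAlgebraic_or_algebraicIndependent R hR (K := K) h with halg | hind
  · left
    have : Algebra.IsAlgebraic K (diffAdjoin K y) := by
      refine (IntermediateField.isAlgebraic_adjoin_iff_isAlgebraic _ _).2 ?_
      rintro _ ⟨n, rfl⟩
      change IsAlgebraic K (iterDer n y)
      induction n with
      | zero => exact halg
      | succ n ih => rw [iterDer_succ]; exact isAlgebraic_deriv ih
    exact trdeg_eq_zero
  · right
    rw [diffAdjoin_eq h, trdeg_adjoin_range hind]
    simp

end SchwarzianTrdeg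

/-! ### Ultrapowers of differential fields and Łoś's theorem -/

section Ultrapower

open Filter FirstOrder Language

/-- Diagonal argument: at index i use the sequence for the largest N ≤ i whose first N conditions
hold there. Almost everywhere this N exceeds any given m. -/
theorem exists_forall_eventually_hyperfilter {X : Type*} [Nonempty X] (p : ℕ → ℕ → X → Prop)
    (h : ∀ N, ∃ x : ℕ → X, ∀ m < N, ∀ᶠ i in (hyperfilter ℕ : Filter ℕ), p m i (x i)) :
    ∃ d : ℕ → X, ∀ m, ∀ᶠ i in (hyperfilter ℕ : Filter ℕ), p m i (d i) := by
  classical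
  choose x hx using h
  let N : ℕ → ℕ := fun i => Nat.findGreatest (fun N => ∀ m < N, p m i (x N i)) i
  refine ⟨fun i => x (N i) i, fun m => ?_⟩
  have h1 : ∀ᶠ i in (hyperfilter ℕ : Filter ℕ), ∀ m' < m + 1, p m' i (x (m + 1) i) := by
    have := (Set.finite_Iio (m + 1)).eventually_all
      (l := (hyperfilter ℕ : Filter ℕ)) (p := fun m' i => p m' i (x (m + 1) i))
    exact this.2 fun m' hm' => hx (m + 1) m' hm'
  have h2 : ∀ᶠ i in (hyperfilter ℕ : Filter ℕ), m + 1 ≤ i :=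
    Nat.hyperfilter_le_atTop (eventually_ge_atTop (m + 1))
  filter_upwards [h1, h2] with i hi1 hi2
  have h3 : m + 1 ≤ N i := Nat.le_findGreatest hi2 hi1
  have h4 : ∀ m' < N i, p m' i (x (N i) i) :=
    Nat.findGreatest_spec (P := fun N => ∀ m < N, p m i (x N i)) hi2 hi1
  exact h4 m (by omega)

/-- The ultrapower of `U` along a nonprincipal ultrafilter on `ℕ`. -/
def Ultrapower (U : Type*) : Type _ := Germ (hyperfilter ℕ : Filter ℕ) U

namespace Ultrapower

variable {U : Type*} [Field U]

noncomputable instance : Field (Ultrapower U) :=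
  inferInstanceAs (Field (Germ (hyperfilter ℕ : Filter ℕ) U))

variable (U) in
/-- The class of a sequence in the ultrapower. -/
noncomputable def mk : (ℕ → U) →+* Ultrapower U := Germ.coeRingHom _

theorem mk_surjective : Function.Surjective (mk U) := Quot.mk_surjective

theorem mk_eq_iff {x y : ℕ → U} : mk U x = mk U y ↔
    ∀ᶠ i in (hyperfilter ℕ : Filter ℕ), x i = y i := Germ.coe_eq

theorem mk_eq_zero_iff {x : ℕ → U} : mk U x = 0 ↔
    ∀ᶠ i in (hyperfilter ℕ : Filter ℕ), x i = 0 := by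
  rw [← map_zero (mk U), mk_eq_iff]
  rfl

theorem mk_ne_zero_iff {x : ℕ → U} : mk U x ≠ 0 ↔
    ∀ᶠ i in (hyperfilter ℕ : Filter ℕ), x i ≠ 0 := by
  rw [Ne, mk_eq_zero_iff, Ultrafilter.eventually_not]

noncomputable instance : Algebra U (Ultrapower U) := ((mk U).comp (Pi.constRingHom ℕ U)).toAlgebra

noncomputable instance [Algebra ℂ U] : Algebra ℂ (Ultrapower U) :=
  ((algebraMap U (Ultrapower U)).comp (algebraMap ℂ U)).toAlgebra

instance [Algebra ℂ U] : IsScalarTower ℂ U (Ultrapower U) :=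
  IsScalarTower.of_algebraMap_eq fun _ => rfl

variable [Differential U]

/-- The derivation on the ultrapower. -/
noncomputable instance : Differential (Ultrapower U) where
  deriv := Derivation.mk' (AddMonoidHom.toIntLinearMap
    { toFun := Germ.map fun x : U => (x′)
      map_zero' := by
        rw [← map_zero (mk U)]
        exact mk_eq_iff.2 (Eventually.of_forall fun i => map_zero (Differential.deriv (R := U)))
      map_add' := by
        intro a b
        obtain ⟨x, rfl⟩ := mk_surjective a
        obtain ⟨y, rfl⟩ := mk_surjective b
        exact mk_eq_iff.2 (Eventually.of_forall fun i =>
          map_add (Differential.deriv (R := U)) (x i) (y i)) }) (by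
    intro a b
    obtain ⟨x, rfl⟩ := mk_surjective a
    obtain ⟨y, rfl⟩ := mk_surjective b
    exact mk_eq_iff.2 (Eventually.of_forall fun i =>
      Derivation.leibniz (Differential.deriv (R := U)) (x i) (y i)))

theorem deriv_mk (x : ℕ → U) : (mk U x)′ = mk U fun i => (x i)′ := rfl

theorem iterDer_mk (n : ℕ) (x : ℕ → U) : iterDer n (mk U x) = mk U fun i => iterDer n (x i) := by
  induction n with
  | zero => rfl
  | succ n ih => simp only [iterDer_succ, ih, deriv_mk]

instance : DifferentialAlgebra U (Ultrapower U) where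
  deriv_algebraMap _ := deriv_mk _

theorem term_realize_mk {α : Type*} (t : diffRingLang.Term α) (x : α → ℕ → U) :
    t.realize (fun i => mk U (x i)) = mk U fun k => t.realize fun i => x i k := by
  induction t with
  | var => rfl
  | func f ts ih =>
    cases f with
    | add => exact congrArg₂ (· + ·) (ih 0) (ih 1)
    | mul => exact congrArg₂ (· * ·) (ih 0) (ih 1)
    | neg => exact congrArg (- ·) (ih 0)
    | zero => exact (map_zero (mk U)).symm
    | one => exact (map_one (mk U)).symm
    | der => exact congrArg (fun z => (z′)) (ih 0)

/-- **Łoś's theorem**. -/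
theorem realize_mk {α : Type*} {n : ℕ} (φ : diffRingLang.BoundedFormula α n) (x : α → ℕ → U)
    (v : Fin n → ℕ → U) :
    φ.Realize (fun i => mk U (x i)) (fun i => mk U (v i)) ↔
      ∀ᶠ k in (hyperfilter ℕ : Filter ℕ), φ.Realize (fun i => x i k) fun i => v i k := by
  have hsum : ∀ {n : ℕ} (v : Fin n → ℕ → U) (t : diffRingLang.Term (α ⊕ Fin n)),
      t.realize (Sum.elim (fun i => mk U (x i)) fun i => mk U (v i)) =
        mk U fun k => t.realize (Sum.elim (fun i => x i k) fun i => v i k) := by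
    intro n v t
    have h1 : (Sum.elim (fun i => mk U (x i)) fun i => mk U (v i)) =
        fun i => mk U (Sum.elim x v i) := by
      ext (_ | _) <;> rfl
    have h2 : ∀ k, (Sum.elim (fun i => x i k) fun i => v i k) = fun i => Sum.elim x v i k := by
      intro k
      ext (_ | _) <;> rfl
    simp only [h1, h2, term_realize_mk]
  induction φ with
  | falsum => simp only [BoundedFormula.Realize, eventually_const]
  | equal t₁ t₂ => simp only [BoundedFormula.Realize, hsum, mk_eq_iff]
  | rel R => exact R.elim
  | imp _ _ ih ih' => simp only [BoundedFormula.Realize, ih v, ih' v, Ultrafilter.eventually_imp]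
  | @all k φ ih =>
    simp only [BoundedFormula.Realize]
    have hsnoc : ∀ m : ℕ → U,
        (Fin.snoc (fun i => mk U (v i)) (mk U m) : Fin (k + 1) → Ultrapower U) = fun i => mk U ((Fin.snoc v m : Fin (k + 1) → ℕ → U) i) := by
      intro m
      ext i
      refine Fin.lastCases ?_ (fun i => ?_) i <;> simp
    have hsnoc' : ∀ (m : ℕ → U) (j : ℕ), (fun i => (Fin.snoc v m : Fin (k + 1) → ℕ → U) i j) =
        Fin.snoc (fun i => v i j) (m j) := by
      intro m j
      ext i
      refine Fin.lastCases ?_ (fun i => ?_) i <;> simp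
    rw [mk_surjective.forall]
    simp only [hsnoc, ih, hsnoc']
    refine ⟨fun h => ?_, fun h m => h.mono fun j hj => hj (m j)⟩
    by_contra hcon
    rw [← Ultrafilter.eventually_not] at hcon
    simp only [not_forall] at hcon
    classical
    -- A sequence of counterexamples, one for each index that has one; the default 0 is irrelevant.
    let m : ℕ → U := fun j => if hj : ∃ a, ¬ φ.Realize (fun i => x i j)
      (Fin.snoc (fun i => v i j) a) then hj.choose else 0
    obtain ⟨j, hj1, hj2⟩ := (hcon.and (h m)).exists
    have : m j = hj1.choose := dif_pos hj1
    rw [this] at hj2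
    exact hj1.choose_spec hj2

end Ultrapower
end Ultrapower

/-! ### Countable saturation of the ultrapower -/

section Saturation

open Filter

theorem MvPolynomial.degreeOf_pos_iff {σ R : Type*} [CommSemiring R] {s : σ}
    {p : MvPolynomial σ R} : 0 < p.degreeOf s ↔ ∃ m, p.coeff m ≠ 0 ∧ 0 < m s := by
  rw [← not_le, MvPolynomial.degreeOf_le_iff]
  push Not
  simp [MvPolynomial.mem_support_iff]

theorem MvPolynomial.map_ringHom_eval {σ R S : Type*} [CommSemiring R] [CommSemiring S]
    (φ : R →+* S) (x : σ → R) (p : MvPolynomial σ R) :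
    φ (eval x p) = eval (fun s => φ (x s)) (map φ p) := by
  induction p using MvPolynomial.induction_on with
  | C a => simp
  | add p q hp hq => simp [hp, hq]
  | mul_X p s hp => simp [hp]

/-- If p has order at most n, the harmless equation a⁽ⁿ⁺¹⁾ = 0 lets p act as the inequation of an
axiom. -/
theorem IsDifferentiallyClosed.exists_eval_ne_zero {U : Type*} [Field U] [Differential U]
    (hU : IsDifferentiallyClosed U) {p : MvPolynomial ℕ U} (hp : p ≠ 0) :
    ∃ a : U, p.eval (fun i => iterDer i a) ≠ 0 := by
  obtain ⟨n, hn⟩ := p.vars.bddAbove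
  obtain ⟨q, rfl⟩ := MvPolynomial.exists_rename_eq_of_vars_subset_range p
    (fun i : Fin (n + 1) => (i : ℕ)) Fin.val_injective
    fun i hi => ⟨⟨i, Nat.lt_succ_of_le (hn hi)⟩, rfl⟩
  have hq : q ≠ 0 := by
    rintro rfl
    exact hp (map_zero _)
  obtain ⟨a, -, ha⟩ := hU (n + 1) (MvPolynomial.X (Fin.last (n + 1))) q (by simp) hq
  exact ⟨a, by rwa [MvPolynomial.eval_rename]⟩

namespace Ultrapower

variable {U : Type*} [Field U]

theorem eval_map_mk {σ : Type*} (p : MvPolynomial σ (ℕ → U)) (x : σ → ℕ → U) :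
    (p.map (mk U)).eval (fun s => mk U (x s)) =
      mk U fun i => (p.map (Pi.evalRingHom _ i)).eval fun s => x s i := by
  rw [← MvPolynomial.map_ringHom_eval]
  congr 1
  ext i
  exact MvPolynomial.map_ringHom_eval (Pi.evalRingHom (fun _ => U) i) x p

theorem eventually_map_ne_zero {σ : Type*} {p : MvPolynomial σ (ℕ → U)} (hp : p.map (mk U) ≠ 0) :
    ∀ᶠ i in (hyperfilter ℕ : Filter ℕ), p.map (Pi.evalRingHom (fun _ => U) i) ≠ 0 := by
  obtain ⟨m, hm⟩ := MvPolynomial.ne_zero_iff.1 hp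
  rw [MvPolynomial.coeff_map, mk_ne_zero_iff] at hm
  exact hm.mono fun i hi => MvPolynomial.ne_zero_iff.2 ⟨m, by rwa [MvPolynomial.coeff_map]⟩

theorem eventually_degreeOf_pos {σ : Type*} {p : MvPolynomial σ (ℕ → U)} {s : σ}
    (hp : 0 < (p.map (mk U)).degreeOf s) :
    ∀ᶠ i in (hyperfilter ℕ : Filter ℕ), 0 < (p.map (Pi.evalRingHom (fun _ => U) i)).degreeOf s := by
  obtain ⟨m, hm, hs⟩ := MvPolynomial.degreeOf_pos_iff.1 hp
  rw [MvPolynomial.coeff_map, mk_ne_zero_iff] at hm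
  exact hm.mono fun i hi =>
    MvPolynomial.degreeOf_pos_iff.2 ⟨m, by rwa [MvPolynomial.coeff_map], hs⟩

theorem exists_lift_seq {σ : Type*} {G : Set (MvPolynomial σ (Ultrapower U))} (hG : G.Countable)
    (h0 : 0 ∉ G) : ∃ g : ℕ → MvPolynomial σ (ℕ → U), (∀ m, (g m).map (mk U) ≠ 0) ∧
      ∀ p ∈ G, ∃ m, (g m).map (mk U) = p := by
  -- Adding 1 makes the set nonempty, hence enumerable, without a new condition.
  obtain ⟨e, he⟩ := (hG.insert 1).exists_eq_range (Set.insert_nonempty 1 G)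
  choose g hg using fun m => MvPolynomial.map_surjective (mk U) mk_surjective (e m)
  refine ⟨g, fun m => ?_, fun p hp => ?_⟩
  · rw [hg]
    have : e m ∈ insert 1 G := he ▸ ⟨m, rfl⟩
    rcases this with h | h
    · rw [h]; exact one_ne_zero
    · exact fun h' => h0 (h' ▸ h)
  · obtain ⟨m, hm⟩ := he ▸ Set.mem_insert_of_mem 1 hp
    exact ⟨m, (hg m).trans hm⟩

variable [Differential U]

/-- Finitely many inequations amount to one for their product, solvable in almost every coordinate.
The diagonal argument then handles countably many. -/
theorem exists_forall_eval_ne_zero (hU : IsDifferentiallyClosed U)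
    {G : Set (MvPolynomial ℕ (Ultrapower U))} (hG : G.Countable) (h0 : 0 ∉ G) :
    ∃ a : Ultrapower U, ∀ p ∈ G, p.eval (fun i => iterDer i a) ≠ 0 := by
  obtain ⟨g, hg0, hg⟩ := exists_lift_seq hG h0
  obtain ⟨d, hd⟩ := exists_forall_eventually_hyperfilter
    (fun m i (a : U) => ((g m).map (Pi.evalRingHom (fun _ => U) i)).eval
      (fun j => iterDer j a) ≠ 0) (by
    intro N
    have hne : (∏ m ∈ Finset.range N, g m).map (mk U) ≠ 0 := by
      rw [map_prod]
      exact Finset.prod_ne_zero_iff.2 fun m _ => hg0 m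
    have hex : ∀ i, ∃ a : U, (∏ m ∈ Finset.range N, g m).map (Pi.evalRingHom (fun _ => U) i) ≠ 0 →
        ((∏ m ∈ Finset.range N, g m).map (Pi.evalRingHom (fun _ => U) i)).eval
          (fun j => iterDer j a) ≠ 0 := by
      intro i
      by_cases h : (∏ m ∈ Finset.range N, g m).map (Pi.evalRingHom (fun _ => U) i) = 0
      · exact ⟨0, fun h' => absurd h h'⟩
      · obtain ⟨a, ha⟩ := hU.exists_eval_ne_zero h
        exact ⟨a, fun _ => ha⟩
    choose x hx using hex
    refine ⟨x, fun m hm => (eventually_map_ne_zero hne).mono fun i hi => ?_⟩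
    have := hx i hi
    rw [map_prod, map_prod, Finset.prod_ne_zero_iff] at this
    exact this m (Finset.mem_range.2 hm))
  refine ⟨mk U d, fun p hp => ?_⟩
  obtain ⟨m, rfl⟩ := hg p hp
  simp only [iterDer_mk]
  rw [eval_map_mk, mk_ne_zero_iff]
  exact hd m

theorem exists_eval_eq_zero_and_forall_eval_ne_zero (hU : IsDifferentiallyClosed U) {n : ℕ}
    {f : MvPolynomial (Fin (n + 1)) (Ultrapower U)} (hf : 0 < f.degreeOf (Fin.last n))
    {G : Set (MvPolynomial (Fin n) (Ultrapower U))} (hG : G.Countable) (h0 : 0 ∉ G) :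
    ∃ a : Ultrapower U, f.eval (fun i : Fin _ => iterDer (i : ℕ) a) = 0 ∧
      ∀ p ∈ G, p.eval (fun i : Fin _ => iterDer (i : ℕ) a) ≠ 0 := by
  obtain ⟨g, hg0, hg⟩ := exists_lift_seq hG h0
  obtain ⟨f, rfl⟩ := MvPolynomial.map_surjective (mk U) mk_surjective f
  obtain ⟨d, hd⟩ := exists_forall_eventually_hyperfilter
    (fun m i (a : U) => (f.map (Pi.evalRingHom (fun _ => U) i)).eval
      (fun j : Fin _ => iterDer (j : ℕ) a) = 0 ∧ ((g m).map (Pi.evalRingHom (fun _ => U) i)).eval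
      (fun j : Fin _ => iterDer (j : ℕ) a) ≠ 0) (by
    intro N
    have hne : (∏ m ∈ Finset.range N, g m).map (mk U) ≠ 0 := by
      rw [map_prod]
      exact Finset.prod_ne_zero_iff.2 fun m _ => hg0 m
    have hex : ∀ i, ∃ a : U, 0 < (f.map (Pi.evalRingHom (fun _ => U) i)).degreeOf (Fin.last n) →
        (∏ m ∈ Finset.range N, g m).map (Pi.evalRingHom (fun _ => U) i) ≠ 0 →
        (f.map (Pi.evalRingHom (fun _ => U) i)).eval (fun j : Fin _ => iterDer (j : ℕ) a) = 0 ∧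
        ((∏ m ∈ Finset.range N, g m).map (Pi.evalRingHom (fun _ => U) i)).eval
          (fun j : Fin _ => iterDer (j : ℕ) a) ≠ 0 := by
      intro i
      by_cases h : 0 < (f.map (Pi.evalRingHom (fun _ => U) i)).degreeOf (Fin.last n) ∧
        (∏ m ∈ Finset.range N, g m).map (Pi.evalRingHom (fun _ => U) i) ≠ 0
      · obtain ⟨a, ha⟩ := hU n _ _ h.1 h.2
        exact ⟨a, fun _ _ => ha⟩
      · exact ⟨0, fun h1 h2 => absurd ⟨h1, h2⟩ h⟩
    choose x hx using hex
    refine ⟨x, fun m hm => ?_⟩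
    filter_upwards [eventually_degreeOf_pos hf, eventually_map_ne_zero hne] with i hi1 hi2
    have := hx i hi1 hi2
    rw [map_prod, map_prod, Finset.prod_ne_zero_iff] at this
    exact ⟨this.1, this.2 m (Finset.mem_range.2 hm)⟩)
  refine ⟨mk U d, ?_, fun p hp => ?_⟩
  · simp only [iterDer_mk]
    rw [eval_map_mk, mk_eq_zero_iff]
    exact (hd 0).mono fun i hi => hi.1
  · obtain ⟨m, rfl⟩ := hg p hp
    simp only [iterDer_mk]
    rw [eval_map_mk, mk_ne_zero_iff]
    exact (hd m).mono fun i hi => hi.2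

end Ultrapower

end Saturation

/-! ### One-step extension of partial isomorphisms -/

section BackAndForth

universe w'

variable {κ W : Type w'} [Field κ] [Field W] [Differential W]

/-- Two embeddings `f`, `g` of a field into a differential field have differentially closed images
and induce the same derivation on the field. -/
def IsDiffSpan (f g : κ →+* W) : Prop := ∀ x, ∃ x', f x' = (f x)′ ∧ g x' = (g x)′

theorem IsDiffSpan.symm {f g : κ →+* W} (h : IsDiffSpan f g) : IsDiffSpan g f := fun x =>
  (h x).imp fun _ hx => hx.symm

/-- The elements on which two embeddings induce the same derivative. -/
def derivEqSubfield (f g : κ →+* W) : Subfield κ where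
  carrier := {x | ∃ x', f x' = (f x)′ ∧ g x' = (g x)′}
  zero_mem' := ⟨0, by simp⟩
  one_mem' := ⟨0, by simp⟩
  add_mem' := by
    rintro a b ⟨a', ha⟩ ⟨b', hb⟩
    exact ⟨a' + b', by simp only [map_add, ha, hb, and_self]⟩
  neg_mem' := by
    rintro a ⟨a', ha⟩
    exact ⟨-a', by simp only [map_neg, ha, and_self]⟩
  mul_mem' := by
    rintro a b ⟨a', ha⟩ ⟨b', hb⟩
    exact ⟨a * b' + b * a', by simp [map_add, map_mul, ha, hb, Derivation.leibniz]⟩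
  inv_mem' := by
    rintro a ⟨a', ha⟩
    exact ⟨-a⁻¹ ^ 2 * a', by simp [ha, Derivation.leibniz_inv]⟩

theorem map_fractionRing_mem {κ κ' ι : Type*} [Field κ] [Field κ'] (S : Subfield κ')
    (Φ : FractionRing (MvPolynomial ι κ) →+* κ')
    (hC : ∀ a, Φ (algebraMap (MvPolynomial ι κ) _ (MvPolynomial.C a)) ∈ S)
    (hX : ∀ j, Φ (algebraMap (MvPolynomial ι κ) _ (MvPolynomial.X j)) ∈ S) (z) : Φ z ∈ S := by
  have hp : ∀ p : MvPolynomial ι κ, Φ (algebraMap (MvPolynomial ι κ) _ p) ∈ S := by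
    intro p
    induction p using MvPolynomial.induction_on with
    | C a => exact hC a
    | add p q hp hq => rw [map_add, map_add]; exact add_mem hp hq
    | mul_X p j hp => rw [map_mul, map_mul]; exact mul_mem hp (hX j)
  obtain ⟨p, q, -, rfl⟩ := IsFractionRing.div_surjective (A := MvPolynomial ι κ) z
  rw [map_div₀]
  exact div_mem (hp p) (hp q)

/-- The extension of `f : κ →+* W` to the rational functions over `κ`, sending the variables to
elements which are algebraically independent over the image of `f`. -/
noncomputable def evalFraction {κ W ι : Type*} [Field κ] [Field W] (f : κ →+* W) (c : ι → W)
    (hc : ∀ p : MvPolynomial ι κ, p ≠ 0 → p.eval₂ f c ≠ 0) :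
    FractionRing (MvPolynomial ι κ) →+* W :=
  IsFractionRing.lift (g := MvPolynomial.eval₂Hom f c)
    ((injective_iff_map_eq_zero _).2 fun p hp => by_contra fun h => hc p h hp)

theorem evalFraction_algebraMap {κ W ι : Type*} [Field κ] [Field W] (f : κ →+* W) (c : ι → W)
    (hc : ∀ p : MvPolynomial ι κ, p ≠ 0 → p.eval₂ f c ≠ 0) (p : MvPolynomial ι κ) :
    evalFraction f c hc (algebraMap _ _ p) = p.eval₂ f c :=
  IsFractionRing.lift_algebraMap _ _

/-- Separating the last variable turns a differential polynomial of order n into a polynomial in the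
highest derivative over the lower jet. -/
theorem MvPolynomial.exists_equiv_polynomial_last (κ : Type*) [CommRing κ] (n : ℕ) :
    ∃ e : MvPolynomial (Fin (n + 1)) κ ≃+* (MvPolynomial (Fin n) κ)[X],
      (∀ F, (e F).natDegree = F.degreeOf (Fin.last n)) ∧
      ∀ {W : Type w'} [CommRing W] (g : κ →+* W) (d : ℕ → W) (F),
        F.eval₂ g (fun i : Fin (n + 1) => d i) =
          (e F).eval₂ (MvPolynomial.eval₂Hom g fun i : Fin n => d i) (d n) := by
  refine ⟨((MvPolynomial.renameEquiv κ finSuccEquivLast).trans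
    (MvPolynomial.optionEquivLeft κ (Fin n))).toRingEquiv, fun F => ?_, fun g d F => ?_⟩
  · change (MvPolynomial.optionEquivLeft κ (Fin n) (MvPolynomial.rename _ F)).natDegree = _
    rw [MvPolynomial.natDegree_optionEquivLeft, ← finSuccEquivLast_last,
      MvPolynomial.degreeOf_rename_of_injective finSuccEquivLast.injective]
  · change F.eval₂ g _ = (MvPolynomial.optionEquivLeft κ (Fin n)
      (MvPolynomial.rename finSuccEquivLast F)).eval₂ _ _
    induction F using MvPolynomial.induction_on with
    | C a => simp
    | add p q hp hq => simp only [MvPolynomial.eval₂_add, map_add, hp, hq, Polynomial.eval₂_add]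
    | mul_X p j hp =>
      rw [MvPolynomial.eval₂_mul, hp, map_mul, map_mul, Polynomial.eval₂_mul]
      congr 1
      refine Fin.lastCases ?_ (fun j => ?_) j <;> simp

/-- κ carries no derivation here: only the derivatives of the images of coefficients occur. -/
theorem deriv_eval₂_sum {κ W : Type*} [CommRing κ] [CommRing W] [Differential W] (f : κ →+* W)
    (c : W) (m : κ[X]) :
    (m.eval₂ f c)′ = (m.sum fun j a => (f a)′ * c ^ j) + m.derivative.eval₂ f c * c′ := by
  induction m using Polynomial.induction_on' with
  | add p q hp hq =>
    rw [Polynomial.eval₂_add, map_add, hp, hq, Polynomial.sum_add_index _ _ _ (by simp)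
      (by intros; rw [map_add, map_add, add_mul]), map_add, Polynomial.eval₂_add]
    ring
  | monomial j a =>
    rw [Polynomial.sum_monomial_index _ _ (by simp), Polynomial.eval₂_monomial,
      Polynomial.derivative_monomial, Polynomial.eval₂_monomial, Derivation.leibniz,
      Derivation.leibniz_pow]
    simp only [smul_eq_mul, nsmul_eq_mul, map_mul, map_natCast]
    ring


theorem MvPolynomial.countable {σ R : Type*} [CommSemiring R] [Countable σ] [Countable R] :
    Countable (MvPolynomial σ R) := by
  rw [← Cardinal.mk_le_aleph0_iff]
  refine MvPolynomial.cardinalMk_le_max_lift.trans ?_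
  simp

theorem Polynomial.countable {R : Type*} [Semiring R] [Countable R] : Countable R[X] := by
  rw [← Cardinal.mk_le_aleph0_iff]
  refine Polynomial.cardinalMk_le_max.trans ?_
  simp

theorem FractionRing.countable {R : Type*} [CommRing R] [Countable R] :
    Countable (FractionRing R) := by
  rw [← Cardinal.mk_le_aleph0_iff, FractionRing.cardinalMk]
  exact Cardinal.mk_le_aleph0

/-- For free jets the new field is κ(X₀, X₁, …), with X_j differentiating to X_{j+1} under both
embeddings. -/
theorem IsDiffSpan.exists_extension_of_independent [Countable κ] {f g : κ →+* W}
    (h : IsDiffSpan f g) {c d : W}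
    (hc : ∀ p : MvPolynomial ℕ κ, p ≠ 0 → p.eval₂ f (fun i => iterDer i c) ≠ 0)
    (hd : ∀ p : MvPolynomial ℕ κ, p ≠ 0 → p.eval₂ g (fun i => iterDer i d) ≠ 0) :
    ∃ (κ' : Type w') (_ : Field κ') (f' g' : κ' →+* W) (i : κ →+* κ'), Countable κ' ∧
      f'.comp i = f ∧ g'.comp i = g ∧ IsDiffSpan f' g' ∧ c ∈ Set.range f' := by
  have hcount : Countable (MvPolynomial ℕ κ) := MvPolynomial.countable
  refine ⟨FractionRing (MvPolynomial ℕ κ), inferInstance, evalFraction f _ hc, evalFraction g _ hd,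
    (algebraMap (MvPolynomial ℕ κ) _).comp MvPolynomial.C, ?_, ?_, ?_, ?_, ?_⟩
  · exact FractionRing.countable
  · ext a
    simp [evalFraction_algebraMap]
  · ext a
    simp [evalFraction_algebraMap]
  · intro x
    refine map_fractionRing_mem (derivEqSubfield (evalFraction f _ hc) (evalFraction g _ hd))
      (RingHom.id _) (fun a => ?_) (fun j => ?_) x
    · obtain ⟨a', ha⟩ := h a
      refine ⟨algebraMap (MvPolynomial ℕ κ) _ (MvPolynomial.C a'), ?_⟩
      simp only [RingHom.id_apply, evalFraction_algebraMap, MvPolynomial.eval₂_C]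
      exact ha
    · refine ⟨algebraMap (MvPolynomial ℕ κ) _ (MvPolynomial.X (j + 1)), ?_⟩
      simp only [RingHom.id_apply, evalFraction_algebraMap, MvPolynomial.eval₂_X, iterDer_succ,
        and_self]
  · exact ⟨algebraMap (MvPolynomial ℕ κ) _ (MvPolynomial.X 0), by
      rw [evalFraction_algebraMap, MvPolynomial.eval₂_X, iterDer_zero]⟩

/-- The new field is κ(X₀, …, X_{n-1})[X]/(m). As m is separable, the derivative of its root is
forced, by the same formula under both embeddings. -/
theorem IsDiffSpan.exists_extension_of_root [CharZero W] [Countable κ] {f g : κ →+* W}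
    (h : IsDiffSpan f g) {c d : W} {n : ℕ}
    (hc : ∀ p : MvPolynomial (Fin n) κ, p ≠ 0 → p.eval₂ f (fun i : Fin n => iterDer (i : ℕ) c) ≠ 0)
    (hd : ∀ p : MvPolynomial (Fin n) κ, p ≠ 0 → p.eval₂ g (fun i : Fin n => iterDer (i : ℕ) d) ≠ 0)
    {m : (FractionRing (MvPolynomial (Fin n) κ))[X]} (hm : Irreducible m)
    (hmc : m.eval₂ (evalFraction f _ hc) (iterDer n c) = 0)
    (hmd : m.eval₂ (evalFraction g _ hd) (iterDer n d) = 0) :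
    ∃ (κ' : Type w') (_ : Field κ') (f' g' : κ' →+* W) (i : κ →+* κ'), Countable κ' ∧
      f'.comp i = f ∧ g'.comp i = g ∧ IsDiffSpan f' g' ∧ c ∈ Set.range f' := by
  have : Fact (Irreducible m) := ⟨hm⟩
  have hcount : Countable (MvPolynomial (Fin n) κ) := MvPolynomial.countable
  have hcount1 : Countable (FractionRing (MvPolynomial (Fin n) κ)) :=
    FractionRing.countable
  have : CharZero (FractionRing (MvPolynomial (Fin n) κ)) :=
    ((evalFraction f _ hc).charZero_iff (evalFraction f _ hc).injective).2 inferInstance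
  let f' := AdjoinRoot.lift (evalFraction f _ hc) (iterDer n c) hmc
  let g' := AdjoinRoot.lift (evalFraction g _ hd) (iterDer n d) hmd
  have hf'of : ∀ z, f' (AdjoinRoot.of m z) = evalFraction f _ hc z := fun z => AdjoinRoot.lift_of _
  have hg'of : ∀ z, g' (AdjoinRoot.of m z) = evalFraction g _ hd z := fun z => AdjoinRoot.lift_of _
  have hf'root : f' (AdjoinRoot.root m) = iterDer n c := AdjoinRoot.lift_root _
  have hg'root : g' (AdjoinRoot.root m) = iterDer n d := AdjoinRoot.lift_root _
  -- The generator standing for the i-th derivative, meaningful only for i ≤ n.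
  let e : ℕ → AdjoinRoot m := fun i => if hi : i < n then
    AdjoinRoot.of m (algebraMap (MvPolynomial (Fin n) κ) _ (MvPolynomial.X ⟨i, hi⟩))
    else AdjoinRoot.root m
  have hfe : ∀ i ≤ n, f' (e i) = iterDer i c := by
    intro i hi
    by_cases hin : i < n
    · simp only [e, dif_pos hin, hf'of, evalFraction_algebraMap, MvPolynomial.eval₂_X]
    · obtain rfl : i = n := by omega
      simp only [e, dif_neg hin, hf'root]
  have hge : ∀ i ≤ n, g' (e i) = iterDer i d := by
    intro i hi
    by_cases hin : i < n
    · simp only [e, dif_pos hin, hg'of, evalFraction_algebraMap, MvPolynomial.eval₂_X]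
    · obtain rfl : i = n := by omega
      simp only [e, dif_neg hin, hg'root]
  have hof : ∀ z, AdjoinRoot.of m z ∈ derivEqSubfield f' g' := by
    refine map_fractionRing_mem _ (AdjoinRoot.of m) (fun a => ?_) fun j => ?_
    · obtain ⟨a', ha⟩ := h a
      refine ⟨AdjoinRoot.of m (algebraMap (MvPolynomial (Fin n) κ) _ (MvPolynomial.C a')), ?_⟩
      simp only [hf'of, hg'of, evalFraction_algebraMap, MvPolynomial.eval₂_C]
      exact ha
    · refine ⟨e (j + 1), ?_⟩
      rw [hfe _ (by omega), hge _ (by omega)]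
      simp only [hf'of, hg'of, evalFraction_algebraMap, MvPolynomial.eval₂_X, iterDer_succ,
        and_self]
  have hroot : AdjoinRoot.root m ∈ derivEqSubfield f' g' := by
    choose δ hδ using hof
    have key : ∀ (φ' : AdjoinRoot m →+* W) (φ : FractionRing (MvPolynomial (Fin n) κ) →+* W)
        (hφ : ∀ z, φ' (AdjoinRoot.of m z) = φ z) (hδφ : ∀ z, φ' (δ z) = (φ z)′),
        φ' (-(m.sum fun j a => δ a * AdjoinRoot.root m ^ j) /
          m.derivative.eval₂ (AdjoinRoot.of m) (AdjoinRoot.root m)) =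
            (φ' (AdjoinRoot.root m))′ := by
      intro φ' φ hφ hδφ
      have hφ' : φ'.comp (AdjoinRoot.of m) = φ := RingHom.ext hφ
      have hr : m.eval₂ φ (φ' (AdjoinRoot.root m)) = 0 := by
        rw [← hφ', ← Polynomial.hom_eval₂, AdjoinRoot.eval₂_root, map_zero]
      have hs := hm.separable.eval₂_derivative_ne_zero φ hr
      have hD := deriv_eval₂_sum φ (φ' (AdjoinRoot.root m)) m
      rw [hr, map_zero] at hD
      rw [map_div₀, Polynomial.hom_eval₂, hφ', div_eq_iff hs, map_neg, Polynomial.sum, map_sum]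
      simp only [map_mul, map_pow, hδφ]
      rw [Polynomial.sum] at hD
      linear_combination hD
    exact ⟨_, key f' _ hf'of fun z => by rw [(hδ z).1, hf'of],
      key g' _ hg'of fun z => by rw [(hδ z).2, hg'of]⟩
  refine ⟨AdjoinRoot m, inferInstance, f', g', (AdjoinRoot.of m).comp
    ((algebraMap (MvPolynomial (Fin n) κ) _).comp MvPolynomial.C), ?_, ?_, ?_, ?_, ?_⟩
  · have : Countable (FractionRing (MvPolynomial (Fin n) κ))[X] := Polynomial.countable
    exact AdjoinRoot.mk_surjective.countable
  · ext a
    simp [hf'of, evalFraction_algebraMap]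
  · ext a
    simp [hg'of, evalFraction_algebraMap]
  · intro x
    change x ∈ derivEqSubfield f' g'
    induction x using AdjoinRoot.induction_on with
    | ih p =>
      induction p using Polynomial.induction_on' with
      | add p q hp hq => rw [map_add]; exact add_mem hp hq
      | monomial j a =>
        rw [← Polynomial.C_mul_X_pow_eq_monomial, map_mul, map_pow, AdjoinRoot.mk_C,
          AdjoinRoot.mk_X]
        exact mul_mem (hof a) (pow_mem hroot j)
  · exact ⟨e 0, by rw [hfe 0 (Nat.zero_le _), iterDer_zero]⟩

end BackAndForth

/-! ### Back-and-forth and elementary equivalence -/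

section Homogeneity

open FirstOrder Language

universe w'

/-- Countably many conditions on the jet of an element, of the kind that occur in the axioms of
differentially closed fields, are satisfied simultaneously. -/
structure IsCountablySaturated (W : Type*) [Field W] [Differential W] : Prop where
  exists_forall_eval_ne_zero : ∀ G : Set (MvPolynomial ℕ W), G.Countable → 0 ∉ G →
    ∃ a : W, ∀ p ∈ G, p.eval (fun i => iterDer i a) ≠ 0
  exists_eval_eq_zero_and_forall_eval_ne_zero : ∀ (n : ℕ) (f : MvPolynomial (Fin (n + 1)) W),
    0 < f.degreeOf (Fin.last n) → ∀ G : Set (MvPolynomial (Fin n) W), G.Countable → 0 ∉ G →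
      ∃ a : W, f.eval (fun i : Fin _ => iterDer (i : ℕ) a) = 0 ∧
        ∀ p ∈ G, p.eval (fun i : Fin _ => iterDer (i : ℕ) a) ≠ 0

theorem Ultrapower.isCountablySaturated {U : Type*} [Field U] [Differential U]
    (hU : IsDifferentiallyClosed U) : IsCountablySaturated (Ultrapower U) :=
  ⟨fun _ hG h0 => exists_forall_eval_ne_zero hU hG h0,
    fun _ _ hf _ hG h0 => exists_eval_eq_zero_and_forall_eval_ne_zero hU hf hG h0⟩

variable {κ W : Type w'} [Field κ] [Field W] [Differential W]

theorem MvPolynomial.countable_image_map {σ κ W : Type*} [Field κ] [Field W] [Countable σ]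
    [Countable κ] (g : κ →+* W) :
    (MvPolynomial.map (σ := σ) g '' {p | p ≠ 0}).Countable ∧
      0 ∉ MvPolynomial.map (σ := σ) g '' {p | p ≠ 0} := by
  have : Countable (MvPolynomial σ κ) := MvPolynomial.countable
  refine ⟨(Set.to_countable _).image _, ?_⟩
  rintro ⟨p, hp, hp0⟩
  exact hp (MvPolynomial.map_injective g g.injective (hp0.trans (map_zero _).symm))

theorem exists_irreducible_eval₂_eq_zero {κ₁ W : Type*} [Field κ₁] [Field W] (f : κ₁ →+* W) (c : W)
    {Q : κ₁[X]} (hQ : Q ≠ 0) (hc : Q.eval₂ f c = 0) :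
    ∃ m : κ₁[X], Irreducible m ∧ m.eval₂ f c = 0 := by
  let := f.toAlgebra
  have halg : IsAlgebraic κ₁ c := ⟨Q, hQ, hc⟩
  exact ⟨minpoly κ₁ c, minpoly.irreducible halg.isIntegral, minpoly.aeval κ₁ c⟩

/-- The position of c over κ is determined by the least order n of an equation for c and the minimal
polynomial of c⁽ⁿ⁾ over the lower jet. Saturation realizes the same data on the side of g. -/
theorem IsDiffSpan.exists_extension [CharZero W] (hW : IsCountablySaturated W) [Countable κ]
    {f g : κ →+* W} (h : IsDiffSpan f g) (c : W) :
    ∃ (κ' : Type w') (_ : Field κ') (f' g' : κ' →+* W) (i : κ →+* κ'), Countable κ' ∧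
      f'.comp i = f ∧ g'.comp i = g ∧ IsDiffSpan f' g' ∧ c ∈ Set.range f' := by
  classical
  by_cases hdep : ∃ n, ∃ p : MvPolynomial (Fin n) κ, p ≠ 0 ∧
    p.eval₂ f (fun i : Fin n => iterDer (i : ℕ) c) = 0
  -- The minimum counts the entries of the shortest dependent jet, so the order is one less; the
  -- empty jet is never dependent.
  · obtain ⟨n, hn⟩ : ∃ n, Nat.find hdep = n + 1 := by
      refine Nat.exists_eq_succ_of_ne_zero fun h0 => ?_
      have := Nat.find_spec hdep
      rw [h0] at this
      obtain ⟨p, hp0, hp⟩ := this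
      obtain ⟨a, rfl⟩ := MvPolynomial.C_surjective (Fin 0) p
      rw [MvPolynomial.eval₂_C, map_eq_zero] at hp
      exact hp0 (by rw [hp, map_zero])
    have hc : ∀ p : MvPolynomial (Fin n) κ, p ≠ 0 →
        p.eval₂ f (fun i : Fin n => iterDer (i : ℕ) c) ≠ 0 := fun p hp0 hp =>
      Nat.find_min hdep (m := n) (by omega) ⟨p, hp0, hp⟩
    have hspec := Nat.find_spec hdep
    rw [hn] at hspec
    obtain ⟨p₀, hp₀, hp₀c⟩ := hspec
    obtain ⟨e, hedeg, heval⟩ := MvPolynomial.exists_equiv_polynomial_last.{w'} κ n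
    let A := MvPolynomial (Fin n) κ
    have hinj : Function.Injective (algebraMap A (FractionRing A)) := IsFractionRing.injective _ _
    have hmap : ∀ (g : κ →+* W) (d : W) (hd) (P : A[X]),
        (P.map (algebraMap A (FractionRing A))).eval₂
          (evalFraction g (fun i : Fin n => iterDer (i : ℕ) d) hd) (iterDer n d) =
        (e.symm P).eval₂ g (fun i : Fin (n + 1) => iterDer (i : ℕ) d) := by
      intro g d hd P
      rw [heval g (fun i => iterDer i d), e.apply_symm_apply, Polynomial.eval₂_map]
      congr 1
      exact RingHom.ext fun p => evalFraction_algebraMap g _ hd p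
    obtain ⟨m, hm, hmc⟩ := exists_irreducible_eval₂_eq_zero
      (evalFraction f (fun i : Fin n => iterDer (i : ℕ) c) hc) (iterDer n c)
      (Q := (e p₀).map (algebraMap A (FractionRing A)))
      ((Polynomial.map_ne_zero_iff hinj).2 ((map_ne_zero_iff e e.injective).2 hp₀))
      (by rw [hmap, e.symm_apply_apply, hp₀c])
    -- Clearing denominators gives an equation of order exactly n; the factor b does not vanish on
    -- an independent lower jet.
    obtain ⟨b, hbA, hb⟩ := IsLocalization.integerNormalization_spec (nonZeroDivisors A) m
    set P := IsLocalization.integerNormalization (nonZeroDivisors A) m with hP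
    have hb0 : algebraMap A (FractionRing A) b ≠ 0 := by
      rw [Ne, map_eq_zero_iff _ hinj]
      exact nonZeroDivisors.ne_zero hbA
    have hb' : P.map (algebraMap A (FractionRing A)) =
        Polynomial.C (algebraMap A (FractionRing A) b) * m := by
      rw [hb, ← Polynomial.smul_eq_C_mul, algebraMap_smul]
    have hPdeg : 0 < P.natDegree := by
      rw [← Polynomial.natDegree_map_eq_of_injective hinj, hb', Polynomial.natDegree_C_mul hb0]
      exact hm.natDegree_pos
    obtain ⟨hG, h0⟩ := MvPolynomial.countable_image_map (σ := Fin n) g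
    obtain ⟨d, hdF, hdG⟩ := hW.exists_eval_eq_zero_and_forall_eval_ne_zero n
      (MvPolynomial.map g (e.symm P)) (by
        rw [← e.apply_symm_apply P, hedeg] at hPdeg
        obtain ⟨s, hs, hs'⟩ := MvPolynomial.degreeOf_pos_iff.1 hPdeg
        refine MvPolynomial.degreeOf_pos_iff.2 ⟨s, ?_, hs'⟩
        rwa [MvPolynomial.coeff_map, Ne, map_eq_zero]) _ hG h0
    have hd : ∀ p : MvPolynomial (Fin n) κ, p ≠ 0 →
        p.eval₂ g (fun i : Fin n => iterDer (i : ℕ) d) ≠ 0 := fun p hp => by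
      rw [← MvPolynomial.eval_map]
      exact hdG _ ⟨p, hp, rfl⟩
    refine h.exists_extension_of_root hc hd hm hmc ?_
    rw [MvPolynomial.eval_map, ← hmap g d hd, hb', Polynomial.eval₂_mul, Polynomial.eval₂_C] at hdF
    exact (mul_eq_zero.1 hdF).resolve_left ((map_ne_zero _).2 hb0)
  · push Not at hdep
    obtain ⟨hG, h0⟩ := MvPolynomial.countable_image_map (σ := ℕ) g
    obtain ⟨d, hd⟩ := hW.exists_forall_eval_ne_zero _ hG h0
    refine h.exists_extension_of_independent (d := d) (fun p hp => ?_) (fun p hp => ?_)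
    · obtain ⟨n, hn⟩ := p.vars.bddAbove
      obtain ⟨q, rfl⟩ := MvPolynomial.exists_rename_eq_of_vars_subset_range p
        (fun i : Fin (n + 1) => (i : ℕ)) Fin.val_injective
        fun i hi => ⟨⟨i, Nat.lt_succ_of_le (hn hi)⟩, rfl⟩
      rw [MvPolynomial.eval₂_rename]
      exact hdep _ q (by rintro rfl; exact hp (map_zero _))
    · rw [← MvPolynomial.eval_map]
      exact hd _ ⟨p, hp, rfl⟩

theorem IsDiffSpan.exists_term_realize {f g : κ →+* W} (h : IsDiffSpan f g) {α : Type*}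
    (t : diffRingLang.Term α) (a : α → κ) :
    ∃ x, f x = t.realize (fun i => f (a i)) ∧ g x = t.realize fun i => g (a i) := by
  induction t with
  | var i => exact ⟨a i, rfl, rfl⟩
  | func s ts ih =>
    choose x hx using ih
    cases s with
    | add => exact ⟨x 0 + x 1, by rw [map_add, (hx 0).1, (hx 1).1]; rfl,
        by rw [map_add, (hx 0).2, (hx 1).2]; rfl⟩
    | mul => exact ⟨x 0 * x 1, by rw [map_mul, (hx 0).1, (hx 1).1]; rfl,
        by rw [map_mul, (hx 0).2, (hx 1).2]; rfl⟩
    | neg => exact ⟨-x 0, by rw [map_neg, (hx 0).1]; rfl, by rw [map_neg, (hx 0).2]; rfl⟩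
    | zero => exact ⟨0, map_zero f, map_zero g⟩
    | one => exact ⟨1, map_one f, map_one g⟩
    | der =>
      obtain ⟨y, hy1, hy2⟩ := h (x 0)
      exact ⟨y, by rw [hy1, (hx 0).1]; rfl, by rw [hy2, (hx 0).2]; rfl⟩

/-- The two embeddings of a countable differential field into a saturated differentially closed
field are elementarily equivalent. -/
theorem IsDiffSpan.realize_iff [CharZero W] (hW : IsCountablySaturated W) {α : Type*} {n : ℕ}
    (φ : diffRingLang.BoundedFormula α n) {κ : Type w'} [Field κ] [Countable κ] {f g : κ →+* W}
    (h : IsDiffSpan f g) (a : α → κ) (v : Fin n → κ) :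
    φ.Realize (fun i => f (a i)) (fun i => f (v i)) ↔
      φ.Realize (fun i => g (a i)) fun i => g (v i) := by
  induction φ generalizing κ with
  | falsum => exact Iff.rfl
  | @equal n t₁ t₂ =>
    have hsum : ∀ f : κ →+* W, (Sum.elim (fun i => f (a i)) fun i => f (v i)) =
        fun i => f (Sum.elim a v i) := by
      intro f
      ext (_ | _) <;> rfl
    obtain ⟨x, hx1, hx2⟩ := h.exists_term_realize t₁ (Sum.elim a v)
    obtain ⟨y, hy1, hy2⟩ := h.exists_term_realize t₂ (Sum.elim a v)
    simp only [BoundedFormula.Realize, hsum]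
    rw [← hx1, ← hx2, ← hy1, ← hy2, f.injective.eq_iff, g.injective.eq_iff]
  | rel R => exact R.elim
  | imp _ _ ih ih' => exact imp_congr (ih h a v) (ih' h a v)
  | @all k φ ih =>
    have hsnoc : ∀ {κ' : Type w'} [Field κ'] (f' : κ' →+* W) (i : κ →+* κ') (z : κ'),
        (Fin.snoc (fun j => f' (i (v j))) (f' z) : Fin (k + 1) → W) =
          fun j => f' ((Fin.snoc (fun j => i (v j)) z : Fin (k + 1) → κ') j) := by
      intro κ' _ f' i z
      ext j
      refine Fin.lastCases ?_ (fun j => ?_) j <;> simp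
    have key : ∀ {f g : κ →+* W}, IsDiffSpan f g →
        (∀ z : W, φ.Realize (fun i => f (a i)) (Fin.snoc (fun i => f (v i)) z)) →
        ∀ z : W, φ.Realize (fun i => g (a i)) (Fin.snoc (fun i => g (v i)) z) := by
      intro f g h hf z
      -- The span is enlarged until it contains the challenged element; its partner is the image of
      -- the same element under the other embedding.
      obtain ⟨κ', _, g', f', i, _, rfl, rfl, h', z, rfl⟩ := h.symm.exists_extension hW z
      have := hf (f' z)
      simp only [RingHom.comp_apply] at this ⊢
      rw [hsnoc] at this ⊢
      exact (ih h'.symm (fun j => i (a j)) _).1 this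
    exact ⟨key h, key h.symm⟩

end Homogeneity

/-! ### Definable sets of solutions are finite or cofinite -/

section Dichotomy

open FirstOrder Language Filter

universe w'

/-- Saturation handles only countably many conditions while U may be uncountable. Since a formula
uses finitely many parameters, a countable subfield closed under the derivation suffices. -/
theorem IsDiffSpan.exists_countable_restriction {κ W : Type w'} [Field κ] [Field W]
    [Differential W] {f g : κ →+* W} (h : IsDiffSpan f g) {S : Set κ} (hS : S.Countable) :
    ∃ E : Subfield κ, S ⊆ E ∧ Countable E ∧ IsDiffSpan (f.comp E.subtype) (g.comp E.subtype) := by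
  choose δ hδ using h
  let T : Set κ := ⋃ n, δ^[n] '' S
  have hT : T.Countable := Set.countable_iUnion fun n => hS.image _
  let E := Subfield.closure T
  have hTE : T ⊆ E := Subfield.subset_closure
  have hδT : ∀ t ∈ T, δ t ∈ T := by
    intro t ht
    obtain ⟨n, s, hs, rfl⟩ := Set.mem_iUnion.1 ht
    exact Set.mem_iUnion.2 ⟨n + 1, s, hs, Function.iterate_succ_apply' _ _ _⟩
  refine ⟨E, fun s hs => hTE (Set.mem_iUnion.2 ⟨0, s, hs, rfl⟩), ?_, ?_⟩
  · rw [← Cardinal.mk_le_aleph0_iff]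
    exact (Subfield.cardinalMk_closure_le_max T).trans (max_le hT.le_aleph0 le_rfl)
  · have hle : E ≤ (derivEqSubfield (f.comp E.subtype) (g.comp E.subtype)).map E.subtype := by
      refine Subfield.closure_le.2 fun t ht => ?_
      exact ⟨⟨t, hTE ht⟩, ⟨⟨δ t, hTE (hδT t ht)⟩, hδ t⟩, rfl⟩
    rintro ⟨x, hx⟩
    obtain ⟨z, hz, hzx⟩ := hle hx
    obtain rfl : z = ⟨x, hx⟩ := Subtype.ext hzx
    exact hz

/-- Both jets (v, u, y) are algebraically independent over K, and their derivatives are given by the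
same rational functions, so K(X₀, X₁, X₂) embeds along each of them with one induced derivation. -/
theorem exists_isDiffSpan_of_isSchwarzianSolution (R : RatFunc ℂ)
    (hR : ¬ ∃ u : AlgFun, IsAlgebraicRiccatiSolution R u) {K F : Type w'} [Field K] [Differential K]
    [Algebra ℂ K] [Field F] [Differential F] [Algebra ℂ F] [DifferentialAlgebra ℂ F] [Algebra K F]
    [IsScalarTower ℂ K F] [DifferentialAlgebra K F] {y z : F} (hy : IsSchwarzianSolution R y)
    (hz : IsSchwarzianSolution R z) (hy' : ¬ IsAlgebraic K y) (hz' : ¬ IsAlgebraic K z) :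
    ∃ (κ : Type w') (_ : Field κ) (f g : κ →+* F) (i : K →+* κ) (t : κ), IsDiffSpan f g ∧
      f.comp i = algebraMap K F ∧ g.comp i = algebraMap K F ∧ f t = y ∧ g t = z := by
  have hc : ∀ {y : F}, IsSchwarzianSolution R y → ¬ IsAlgebraic K y →
      ∀ p : MvPolynomial (Fin 3) K, p ≠ 0 →
        p.eval₂ (algebraMap K F) ![y′, y′′ / (2 * y′ ^ 2), y] ≠ 0 := by
    intro y hy hy' p hp hp0
    have := (isAlgebraic_or_algebraicIndependent R hR (K := K) hy).resolve_left hy'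
    exact hp (algebraicIndependent_iff.1 this p hp0)
  have : CharZero F := charZero_of_injective_algebraMap (algebraMap ℂ F).injective
  let A := MvPolynomial (Fin 3) K
  let ι : A →+* FractionRing A := algebraMap A (FractionRing A)
  let x : Fin 3 → FractionRing A := fun j => ι (MvPolynomial.X j)
  let ψ : ℂ →+* FractionRing A := ι.comp (MvPolynomial.C.comp (algebraMap ℂ K))
  -- The right-hand sides of the system for v, u, y, in that order.
  let x' : Fin 3 → FractionRing A := ![2 * x 1 * x 0 ^ 2,
    -x 0 * (x 1 ^ 2 + 1 / 2 * (R.num.eval₂ ψ (x 2) / R.denom.eval₂ ψ (x 2))), x 0]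
  have hC : ∀ {y : F} (hy : IsSchwarzianSolution R y) (hy' : ¬ IsAlgebraic K y) (a : K),
      evalFraction (algebraMap K F) _ (hc hy hy') (ι (MvPolynomial.C a)) = algebraMap K F a := by
    intro y hy hy' a
    rw [evalFraction_algebraMap, MvPolynomial.eval₂_C]
  have hX : ∀ {y : F} (hy : IsSchwarzianSolution R y) (hy' : ¬ IsAlgebraic K y) (j : Fin 3),
      evalFraction (algebraMap K F) _ (hc hy hy') (x j) = ![y′, y′′ / (2 * y′ ^ 2), y] j := by
    intro y hy hy' j
    rw [evalFraction_algebraMap, MvPolynomial.eval₂_X]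
  have hx' : ∀ {y : F} (hy : IsSchwarzianSolution R y) (hy' : ¬ IsAlgebraic K y) (j : Fin 3),
      evalFraction (algebraMap K F) _ (hc hy hy') (x' j) =
        (evalFraction (algebraMap K F) _ (hc hy hy') (x j))′ := by
    intro y hy hy' j
    set f := evalFraction (algebraMap K F) _ (hc hy hy') with hf
    have hψ : f.comp ψ = algebraMap ℂ F := by
      ext c
      change f (ι (MvPolynomial.C (algebraMap ℂ K c))) = _
      rw [hf, hC hy hy', ← IsScalarTower.algebraMap_apply]
    have hv := hy.deriv_ne_zero
    have h0 : f (x 0) = y′ := hX hy hy' 0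
    have h1 : f (x 1) = y′′ / (2 * y′ ^ 2) := hX hy hy' 1
    have h2 : f (x 2) = y := hX hy hy' 2
    fin_cases j
    · change f (2 * x 1 * x 0 ^ 2) = ((f (x 0))′)
      rw [map_mul, map_mul, map_pow, map_ofNat, h0, h1]
      field_simp
    · change f (-x 0 * (x 1 ^ 2 + 1 / 2 * (R.num.eval₂ ψ (x 2) / R.denom.eval₂ ψ (x 2)))) =
        ((f (x 1))′)
      rw [h1, hy.deriv_u, ratEval]
      simp only [map_mul, map_neg, map_add, map_pow, map_div₀, map_one, map_ofNat, h0, h1,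
        Polynomial.hom_eval₂, hψ, h2]
      rfl
    · change f (x 0) = ((f (x 2))′)
      rw [h0, h2]
  refine ⟨FractionRing A, inferInstance, evalFraction (algebraMap K F) _ (hc hy hy'),
    evalFraction (algebraMap K F) _ (hc hz hz'), ι.comp MvPolynomial.C, x 2, fun s => ?_, ?_, ?_,
    ?_, ?_⟩
  · refine map_fractionRing_mem (derivEqSubfield (evalFraction (algebraMap K F) _ (hc hy hy'))
      (evalFraction (algebraMap K F) _ (hc hz hz'))) (RingHom.id _) (fun a => ?_) (fun j => ?_) s
    · refine ⟨ι (MvPolynomial.C (a′)), (hC hy hy' _).trans ?_, (hC hz hz' _).trans ?_⟩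
      · rw [← deriv_algebraMap, RingHom.id_apply]
        exact congrArg (fun b => (b′)) (hC hy hy' a).symm
      · rw [← deriv_algebraMap, RingHom.id_apply]
        exact congrArg (fun b => (b′)) (hC hz hz' a).symm
    · exact ⟨x' j, hx' hy hy' j, hx' hz hz' j⟩
  · exact RingHom.ext fun a => hC hy hy' a
  · exact RingHom.ext fun a => hC hz hz' a
  · exact hX hy hy' 2
  · exact hX hz hz' 2

namespace Ultrapower

variable {U : Type w'} [Field U]

theorem aeval_mk [Algebra ℂ U] (x : ℕ → U) (p : ℂ[X]) :
    Polynomial.aeval (mk U x) p = mk U fun i => Polynomial.aeval (x i) p := by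
  induction p using Polynomial.induction_on' with
  | add p q hp hq => simp only [map_add, hp, hq]; rfl
  | monomial n a => simp only [Polynomial.aeval_monomial]; rfl

/-- A nonzero polynomial has finitely many roots, so it vanishes on an injective sequence at
finitely many indices only, and a nonprincipal ultrafilter ignores them. -/
theorem transcendental_mk {x : ℕ → U} (hx : Function.Injective x) :
    ¬ IsAlgebraic U (mk U x) := by
  rintro ⟨p, hp, hpx⟩
  have h1 : Polynomial.aeval (mk U x) p = mk U fun i => p.eval (x i) := by
    clear hp hpx
    induction p using Polynomial.induction_on' with
    | add p q hp hq => simp only [map_add, hp, hq, Polynomial.eval_add]; rfl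
    | monomial n a => simp only [Polynomial.aeval_monomial, Polynomial.eval_monomial]; rfl
  rw [h1, mk_eq_zero_iff] at hpx
  have hfin : {i | p.eval (x i) = 0}.Finite := by
    refine Set.Finite.of_finite_image (f := x) ?_ hx.injOn
    refine (Polynomial.finite_setOfPred_isRoot hp).subset ?_
    rintro _ ⟨i, hi, rfl⟩
    exact hi
  exact hfin.notMem_hyperfilter hpx

variable [Differential U]

instance [Algebra ℂ U] [DifferentialAlgebra ℂ U] : DifferentialAlgebra ℂ (Ultrapower U) where
  deriv_algebraMap a := by
    rw [IsScalarTower.algebraMap_apply ℂ U (Ultrapower U), deriv_algebraMap, deriv_algebraMap,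
      ← IsScalarTower.algebraMap_apply ℂ U (Ultrapower U)]

theorem isSchwarzianSolution_mk [Algebra ℂ U] {R : RatFunc ℂ} {x : ℕ → U}
    (h : ∀ i, IsSchwarzianSolution R (x i)) : IsSchwarzianSolution R (mk U x) where
  deriv_ne_zero := by
    rw [deriv_mk, mk_ne_zero_iff]
    exact Eventually.of_forall fun i => (h i).deriv_ne_zero
  denom_ne_zero := by
    rw [aeval_mk, mk_ne_zero_iff]
    exact Eventually.of_forall fun i => (h i).denom_ne_zero
  equation := by
    rw [aeval_mk, aeval_mk]
    change mk U (fun i => schwarzian (x i) + (x i)′ ^ 2 *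
      (Polynomial.aeval (x i) R.num / Polynomial.aeval (x i) R.denom)) = 0
    rw [mk_eq_zero_iff]
    exact Eventually.of_forall fun i => (h i).equation

end Ultrapower

/-- Injective sequences inside and outside D give two transcendental solutions in the ultrapower.
They satisfy the same formulas over the parameters of D, against Łoś's theorem. -/
theorem finite_or_finite_of_definable (R : RatFunc ℂ)
    (hR : ¬ ∃ u : AlgFun, IsAlgebraicRiccatiSolution R u) {U : Type w'} [Field U] [Differential U]
    [Algebra ℂ U] [DifferentialAlgebra ℂ U] (hU : IsDifferentiallyClosed U) {D : Set U}
    (hD : (Set.univ : Set U).Definable₁ diffRingLang D) :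
    ({y | IsSchwarzianSolution R y} ∩ D).Finite ∨ ({y | IsSchwarzianSolution R y} \ D).Finite := by
  by_contra! hcon
  obtain ⟨h1, h2⟩ := hcon
  let x₁ := h1.natEmbedding
  let x₂ := h2.natEmbedding
  obtain ⟨A, -, hA⟩ := Set.definable_iff_finitely_definable.1 hD
  obtain ⟨φ, hφ⟩ := Set.definable_iff_exists_formula_sum.1 hA
  have hφ' : ∀ z : U, z ∈ D ↔ φ.Realize (Sum.elim (fun a : (A : Set U) => (a : U)) ![z]) := by
    intro z
    exact iff_of_eq (congrArg (fun s : Set (Fin 1 → U) => ![z] ∈ s) hφ)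
  let y₁ := Ultrapower.mk U fun i => (x₁ i : U)
  let y₂ := Ultrapower.mk U fun i => (x₂ i : U)
  have : CharZero (Ultrapower U) :=
    charZero_of_injective_algebraMap (algebraMap ℂ (Ultrapower U)).injective
  obtain ⟨κ, _, f, g, i, t, hfg, hfi, hgi, hft, hgt⟩ :=
    exists_isDiffSpan_of_isSchwarzianSolution R hR (K := U) (F := Ultrapower U) (y := y₁) (z := y₂)
      (Ultrapower.isSchwarzianSolution_mk fun j => (x₁ j).2.1)
      (Ultrapower.isSchwarzianSolution_mk fun j => (x₂ j).2.1)
      (Ultrapower.transcendental_mk (Subtype.val_injective.comp x₁.injective))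
      (Ultrapower.transcendental_mk (Subtype.val_injective.comp x₂.injective))
  obtain ⟨E, hSE, _, hE⟩ := hfg.exists_countable_restriction (S := insert t (i '' A))
    (((A.finite_toSet.image i).insert t).countable)
  let a : (A : Set U) ⊕ Fin 1 → E := Sum.elim
    (fun a => ⟨i a, hSE (Or.inr ⟨a, a.2, rfl⟩)⟩) fun _ => ⟨t, hSE (Or.inl rfl)⟩
  have key : ∀ (h : E →+* Ultrapower U) (x : ℕ → U), (∀ b : (A : Set U),
      h (a (Sum.inl b)) = algebraMap U _ (b : U)) → h (a (Sum.inr 0)) = Ultrapower.mk U x →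
      (BoundedFormula.Realize φ (fun s => h (a s)) (fun s => h ((default : Fin 0 → E) s)) ↔
        ∀ᶠ j in (hyperfilter ℕ : Filter ℕ), x j ∈ D) := by
    intro h x hA hx
    have e1 : (fun s => h (a s)) = fun s => Ultrapower.mk U
        ((Sum.elim (fun b _ => (b : U)) fun _ => x : (A : Set U) ⊕ Fin 1 → ℕ → U) s) := by
      ext (b | b)
      · exact hA b
      · rw [Subsingleton.elim b 0]
        exact hx
    have e2 : (fun s => h ((default : Fin 0 → E) s)) =
        fun s => Ultrapower.mk U ((default : Fin 0 → ℕ → U) s) := Subsingleton.elim _ _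
    rw [e1, e2, Ultrapower.realize_mk]
    refine eventually_congr (Eventually.of_forall fun j => ?_)
    rw [hφ', Formula.Realize]
    have e3 : (fun s => (Sum.elim (fun b _ => (b : U)) fun _ => x :
        (A : Set U) ⊕ Fin 1 → ℕ → U) s j) = Sum.elim (fun a : (A : Set U) => (a : U)) ![x j] := by
      ext (b | b)
      · rfl
      · simp
    rw [e3]
    exact iff_of_eq (congrArg _ (Subsingleton.elim _ _))
  have hiff := hE.realize_iff (Ultrapower.isCountablySaturated hU) φ a default
  rw [key _ (fun j => (x₁ j : U)) (fun b => RingHom.congr_fun hfi b) hft,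
    key _ (fun j => (x₂ j : U)) (fun b => RingHom.congr_fun hgi b) hgt] at hiff
  obtain ⟨j, hj⟩ := (hiff.1 (Eventually.of_forall fun j => (x₁ j).2.2)).exists
  exact (x₂ j).2.2 hj

end Dichotomy

/-! ### Definability and infinitude of the solution set -/

section SolutionSet

open FirstOrder Language

variable {U : Type*} [Field U] [Differential U] [Algebra ℂ U]

/-- The form without divisions serves both as a formula and as an instance of the axioms. -/
theorem isSchwarzianSolution_iff (R : RatFunc ℂ) (y : U) : IsSchwarzianSolution R y ↔
    y′ ≠ 0 ∧ R.denom.aeval y ≠ 0 ∧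
      2 * (y′′)′ * y′ * R.denom.aeval y + 2 * y′ ^ 4 * R.num.aeval y =
        3 * y′′ ^ 2 * R.denom.aeval y := by
  have : CharZero U := charZero_of_injective_algebraMap (algebraMap ℂ U).injective
  have key : y′ ≠ 0 → R.denom.aeval y ≠ 0 →
      (schwarzian y + y′ ^ 2 * (R.num.aeval y / R.denom.aeval y) = 0 ↔
        2 * (y′′)′ * y′ * R.denom.aeval y + 2 * y′ ^ 4 * R.num.aeval y =
          3 * y′′ ^ 2 * R.denom.aeval y) := by
    intro h1 h2
    have e : schwarzian y + y′ ^ 2 * (R.num.aeval y / R.denom.aeval y) =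
        (2 * (y′′)′ * y′ * R.denom.aeval y + 2 * y′ ^ 4 * R.num.aeval y -
          3 * y′′ ^ 2 * R.denom.aeval y) / (2 * y′ ^ 2 * R.denom.aeval y) := by
      rw [schwarzian, Derivation.leibniz_div]
      simp only [smul_eq_mul]
      field_simp
      ring
    rw [e, div_eq_zero_iff, sub_eq_zero]
    exact or_iff_left (by simp [h1, h2])
  exact ⟨fun h => ⟨h.1, h.2, (key h.1 h.2).1 h.3⟩, fun h => ⟨h.1, h.2.1, (key h.1 h.2.1).2 h.2.2⟩⟩

theorem definable₁_setOf_isSchwarzianSolution (R : RatFunc ℂ) :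
    (Set.univ : Set U).Definable₁ diffRingLang {y : U | IsSchwarzianSolution R y} := by
  have hconst : ∀ a : U, (Set.univ : Set U).DefinableFun diffRingLang fun _ : Fin 1 → U => a :=
    fun a => definableFun_const diffRingLang _ (Set.mem_univ a)
  have hadd : ∀ {f g : (Fin 1 → U) → U}, (Set.univ : Set U).DefinableFun diffRingLang f →
      (Set.univ : Set U).DefinableFun diffRingLang g →
      (Set.univ : Set U).DefinableFun diffRingLang fun v => f v + g v := by
    intro f g hf hg
    exact (Set.DefinableFun.fun_symbol (L := diffRingLang) (M := U) DiffRingFunc.add).of_empty.comp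
      (g := fun v => ![f v, g v]) fun i => by fin_cases i <;> assumption
  have hmul : ∀ {f g : (Fin 1 → U) → U}, (Set.univ : Set U).DefinableFun diffRingLang f →
      (Set.univ : Set U).DefinableFun diffRingLang g →
      (Set.univ : Set U).DefinableFun diffRingLang fun v => f v * g v := by
    intro f g hf hg
    exact (Set.DefinableFun.fun_symbol (L := diffRingLang) (M := U) DiffRingFunc.mul).of_empty.comp
      (g := fun v => ![f v, g v]) fun i => by fin_cases i <;> assumption
  have hder : ∀ {f : (Fin 1 → U) → U}, (Set.univ : Set U).DefinableFun diffRingLang f →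
      (Set.univ : Set U).DefinableFun diffRingLang fun v => ((f v)′) := by
    intro f hf
    exact (Set.DefinableFun.fun_symbol (L := diffRingLang) (M := U) DiffRingFunc.der).of_empty.comp
      (g := fun v => ![f v]) fun i => by fin_cases i; assumption
  have hpow : ∀ {f : (Fin 1 → U) → U} (n : ℕ), (Set.univ : Set U).DefinableFun diffRingLang f →
      (Set.univ : Set U).DefinableFun diffRingLang fun v => f v ^ n := by
    intro f n hf
    induction n with
    | zero => simpa only [pow_zero] using hconst 1
    | succ n ih => simpa only [pow_succ] using hmul ih hf
  have hy : (Set.univ : Set U).DefinableFun diffRingLang fun v : Fin 1 → U => v 0 :=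
    Set.DefinableFun.proj diffRingLang
  have haev : ∀ p : ℂ[X], (Set.univ : Set U).DefinableFun diffRingLang
      fun v : Fin 1 → U => p.aeval (v 0) := by
    intro p
    induction p using Polynomial.induction_on' with
    | add p q hp hq => simpa only [map_add] using hadd hp hq
    | monomial n a =>
      simpa only [Polynomial.aeval_monomial] using hmul (hconst (algebraMap ℂ U a)) (hpow n hy)
  have h1 : (Set.univ : Set U).Definable diffRingLang {v : Fin 1 → U | (v 0)′ = 0} :=
    (hder hy).ofPred_eq_const (Set.mem_univ _)
  have h2 : (Set.univ : Set U).Definable diffRingLang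
      {v : Fin 1 → U | R.denom.aeval (v 0) = 0} := (haev _).ofPred_eq_const (Set.mem_univ _)
  have h3 : (Set.univ : Set U).Definable diffRingLang {v : Fin 1 → U |
      2 * ((v 0)′′)′ * (v 0)′ * R.denom.aeval (v 0) + 2 * (v 0)′ ^ 4 * R.num.aeval (v 0) =
        3 * (v 0)′′ ^ 2 * R.denom.aeval (v 0)} :=
    (hadd (hmul (hmul (hmul (hconst 2) (hder (hder (hder hy)))) (hder hy)) (haev _))
      (hmul (hmul (hconst 2) (hpow 4 (hder hy))) (haev _))).ofPred_eq
      (hmul (hmul (hconst 3) (hpow 2 (hder (hder hy)))) (haev _))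
  have h := (h1.compl.inter h2.compl).inter h3
  have hset : {v : Fin 1 → U | v 0 ∈ {y : U | IsSchwarzianSolution R y}} =
      ({v : Fin 1 → U | (v 0)′ = 0}ᶜ ∩ {v : Fin 1 → U | R.denom.aeval (v 0) = 0}ᶜ) ∩
      {v : Fin 1 → U |
      2 * ((v 0)′′)′ * (v 0)′ * R.denom.aeval (v 0) + 2 * (v 0)′ ^ 4 * R.num.aeval (v 0) =
        3 * (v 0)′′ ^ 2 * R.denom.aeval (v 0)} := by
    ext v
    exact (isSchwarzianSolution_iff R (v 0)).trans and_assoc.symm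
  change (Set.univ : Set U).Definable diffRingLang _
  rw [← hset] at h
  exact h

/-- Given a finite list of all solutions, the order-three axiom yields a further one: the inequation
excludes y' = 0, the zeros of the denominator and the whole list. -/
theorem infinite_setOf_isSchwarzianSolution (hU : IsDifferentiallyClosed U) (R : RatFunc ℂ) :
    {y : U | IsSchwarzianSolution R y}.Infinite := by
  classical
  have : CharZero U := charZero_of_injective_algebraMap (algebraMap ℂ U).injective
  intro hfin
  let s := hfin.toFinset
  let φ : ∀ {n : ℕ}, ℂ[X] → Fin n → MvPolynomial (Fin n) U := fun p j =>
    p.eval₂ (MvPolynomial.C.comp (algebraMap ℂ U)) (MvPolynomial.X j)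
  have hφ : ∀ {n : ℕ} (x : Fin n → U) (p : ℂ[X]) (j : Fin n),
      MvPolynomial.eval x (φ p j) = p.aeval (x j) := by
    intro n x p j
    rw [Polynomial.hom_eval₂, MvPolynomial.eval_X, Polynomial.aeval_def]
    congr 1
    ext c
    simp
  -- Evaluation at the jet (t, 1, 0) shows g ≠ 0, and at (t, 1, 0, 0) and (t, 1, 0, 1) that f really
  -- involves the third derivative.
  obtain ⟨t, ht⟩ := Infinite.exists_notMem_finset
    (s ∪ (R.denom.map (algebraMap ℂ U)).roots.toFinset)
  rw [Finset.notMem_union] at ht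
  have hden : R.denom.aeval t ≠ 0 := by
    intro h
    apply ht.2
    rw [Multiset.mem_toFinset, Polynomial.mem_roots', Polynomial.IsRoot.def,
      Polynomial.eval_map_algebraMap]
    exact ⟨Polynomial.map_ne_zero R.denom_ne_zero, h⟩
  let f : MvPolynomial (Fin 4) U := 2 * MvPolynomial.X 3 * MvPolynomial.X 1 * φ R.denom 0 +
    2 * MvPolynomial.X 1 ^ 4 * φ R.num 0 - 3 * MvPolynomial.X 2 ^ 2 * φ R.denom 0
  let g : MvPolynomial (Fin 3) U := MvPolynomial.X 1 * φ R.denom 0 *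
    ∏ a ∈ s, (MvPolynomial.X 0 - MvPolynomial.C a)
  have hf : ∀ x, MvPolynomial.eval x f = 2 * x 3 * x 1 * R.denom.aeval (x 0) +
      2 * x 1 ^ 4 * R.num.aeval (x 0) - 3 * x 2 ^ 2 * R.denom.aeval (x 0) := by
    intro x
    simp only [f, map_sub, map_add, map_mul, map_pow, map_ofNat, MvPolynomial.eval_X, hφ]
  have hg : ∀ x, MvPolynomial.eval x g = x 1 * R.denom.aeval (x 0) * ∏ a ∈ s, (x 0 - a) := by
    intro x
    simp only [g, map_sub, map_mul, map_prod, MvPolynomial.eval_X, MvPolynomial.eval_C, hφ]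
  obtain ⟨y, hy1, hy2⟩ := hU 3 f g (by
    rw [Nat.pos_iff_ne_zero]
    intro hdeg
    have hvars : Fin.last 3 ∉ f.vars := fun h => by
      rw [MvPolynomial.mem_vars_iff_degreeOf_ne_zero] at h
      exact h hdeg
    have h0 := hf ![t, 1, 0, 0]
    have h1 := hf ![t, 1, 0, 1]
    have heq : MvPolynomial.eval ![t, 1, 0, 0] f = MvPolynomial.eval ![t, 1, 0, 1] f := by
      refine MvPolynomial.eval₂Hom_congr' rfl (fun i hi _ => ?_) rfl
      fin_cases i
      · rfl
      · rfl
      · rfl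
      · exact absurd hi hvars
    rw [h0, h1] at heq
    have e0 : (2 : U) * R.denom.aeval t = 0 := by
      simp at heq
      simpa using heq
    exact hden ((mul_eq_zero.1 e0).resolve_left two_ne_zero)) (by
    intro h0
    have := hg ![t, 1, 0]
    rw [h0, map_zero] at this
    refine mul_ne_zero (mul_ne_zero one_ne_zero hden) (Finset.prod_ne_zero_iff.2 fun a ha => ?_)
      this.symm
    rw [sub_ne_zero]
    rintro rfl
    exact ht.1 ha)
  rw [hf] at hy1
  rw [hg] at hy2
  have hy : IsSchwarzianSolution R y := by
    refine (isSchwarzianSolution_iff R y).2 ⟨?_, ?_, sub_eq_zero.1 hy1⟩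
    · exact left_ne_zero_of_mul (left_ne_zero_of_mul hy2)
    · exact right_ne_zero_of_mul (left_ne_zero_of_mul hy2)
  refine right_ne_zero_of_mul hy2 (Finset.prod_eq_zero (i := y) (hfin.mem_toFinset.2 hy) ?_)
  exact sub_self y

end SolutionSet

theorem theorem3p2 (R : RatFunc ℂ) (hR : ¬ ∃ u : AlgFun, IsAlgebraicRiccatiSolution R u) :
    (∀ (K : Type u) [Field K] [Differential K] [Algebra ℂ K] [DifferentialAlgebra ℂ K]
      (F : Type v) [Field F] [Differential F] [Algebra ℂ F] [DifferentialAlgebra ℂ F]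
      [Algebra K F] [IsScalarTower ℂ K F] [DifferentialAlgebra K F] (y : F),
      IsSchwarzianSolution R y →
        Algebra.trdeg K (diffAdjoin K y) = 0 ∨ Algebra.trdeg K (diffAdjoin K y) = 3) ∧
    (∀ (U : Type w) [Field U] [Differential U] [Algebra ℂ U] [DifferentialAlgebra ℂ U],
      IsDifferentiallyClosed U → IsStronglyMinimal {y : U | IsSchwarzianSolution R y}) := by
  refine ⟨?_, ?_⟩
  · intro K _ _ _ _ F _ _ _ _ _ _ _ y hy
    exact trdeg_diffAdjoin R hR hy
  · intro U _ _ _ _ hU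
    refine ⟨definable₁_setOf_isSchwarzianSolution R, infinite_setOf_isSchwarzianSolution hU R,
      fun D hDY hD => ?_⟩
    have := finite_or_finite_of_definable R hR hU hD
    rwa [Set.inter_eq_right.2 hDY] at this
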